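/- Let $\Sigma$ be a set (the alphabet). Let $L\subseteq\Sigma^\omega$ be $\omega$-regular, i.e. recognised by a complete deterministic automaton with finitely many states, priorities from $\{1,\dots,d'\}$ on its transitions, and min-parity acceptance (the least priority seen infinitely often is even). **Layered automata.** A layered automaton $\mathcal A$ consists of pairwise disjoint deterministic transition systems $\mathcal T_1,\dots,\mathcal T_d$ (with state sets $Q_1,\dots,Q_d$ and partial transition functions over $\Sigma$) and morphisms $\mu_x:\mathcal T_{x+1}\to\mathcal T_x$; $\mathcal T_1$ is complete, has an initial state $q_{\mathsf{init}}$, and all its states are reachable from $q_{\mathsf{init}}$. The maps $\mu_x$ are seen as the parent maps of a forest; for a state $q$ on a layer $\ge x$, let $\tilde\mu_x(q)$ be its ancestor on layer $x$ (a state is an ancestor of itself). A leaf is a state without children. The semantics $[\![\mathcal A]\!]$ is the alternating parity automaton whose states are the leaves: in a leaf $q$ the letter $a$ has priority $x$, the greatest layer such that $\tilde\mu_x(q)\xrightarrow{a}p$ is defined in $\mathcal T_x$ for some $p$, and a leaf below $p$ is chosen as the next state, by Eve if $x$ is odd and by Adam if $x$ is even. A word is accepted from a leaf if Eve has a strategy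 ensuring that the least priority seen infinitely often is even. $\mathcal A$ recognises $L$ if $L$ is the language of $[\![\mathcal A]\!]$ from the leaves below $q_{\mathsf{init}}$. For a state $q$, $L(q)$ is the language of the leaves below $q$. The $x$-safe language $L_x(q)$ is the set of finite and infinite words with a run from $\tilde\mu_x(q)$ in $\mathcal T_x$. For $p\in Q_x$, a word $w\in\Sigma^\omega$ is strongly accepted ($x$ even) or strongly rejected ($x$ odd) by $p$ if $w\in L_x(p)$ and there are no $u,w',p'$ with $w=uw'$, $p'\in Q_{x+1}$, $p\xrightarrow{u}\mu_x(p')$ and $w'\in L_{x+1}(p')$. The automaton $\mathcal A$ is - *consistent* if no $w$ is strongly accepted by some $p$ and strongly rejected by some $p'$ with $\tilde\mu_1(p)=\tilde\mu_1(p')$; - *normal* if for all $x\ge2$ and $q\in Q_x$: (N1) $q\xrightarrow{u}q'$ in $\mathcal T_x$ with $u\in\Sigma^*$ implies $q'\xrightarrow{v}q$ for some $v\in\Sigma^+$; (N2) for every child $p$ of $q$ there is a finite word that has a run from $q$ in $\mathcal T_x$ but none from $p$ in $\mathcal T_{x+1}$; - *centralised* if for all $x\ge2$ and $p,q\in Q_x$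 with the same parent, $L_x(p)\subseteq L_x(q)$ implies that $p,q$ are in the same strongly connected component of $\mathcal T_x$; - *safe minimal* if for all $x\ge1$ and $p,q\in Q_x$: $L(p)=L(q)$ and $L_y(p)=L_y(q)$ for all $2\le y\le x$ imply $p=q$. A morphism of layered automata is a map on the states that preserves the initial state, transitions and the ancestor relation (it may change layers); it is strong if it also preserves the absence of transitions. A subautomaton of $\mathcal A$ is a layered automaton with an injective morphism to $\mathcal A$. An isomorphism is a bijection on the states preserving the initial state, layers, transitions and parents. **The congruence automaton.** For tuples $\bar u=(u_1,\dots,u_x)$ of finite words, $x\ge1$, write $\bar u\cdot v=(u_1,\dots,u_{x-1},u_xv)$ and $(\bar u,v)=(u_1,\dots,u_x,v)$. By induction on the length define $\bar u\approx\bot$, $\bar u\approx\bar v$ and "pointed". For length $1$: $(u)\not\approx\bot$; $(u)\approx(v)$ iff $u^{-1}L=v^{-1}L$; $(u)$ is pointed. For length $x+1$: - $(\bar u,u_{x+1})\approx\bot$ iff $\bar u\cdot u_{x+1}\approx\bot$, or for all $w\in\Sigma^+$ with $\bar u\cdot u_{x+1}w\approx\bar u$: $u_1\cdots u_x(u_{x+1}w)^\omega\in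 L\Leftrightarrow x$ is even; - $(\bar u,u_{x+1})\approx(\bar v,v_{x+1})$ iff $\bar u\cdot u_{x+1}\approx\bar v\cdot v_{x+1}$ and for all $w\in\Sigma^*$: $(\bar u,u_{x+1}w)\approx\bot\Leftrightarrow(\bar v,v_{x+1}w)\approx\bot$; - $(\bar u,u_{x+1})$ is pointed iff $(\bar u,u_{x+1})\not\approx\bot$, $\bar u$ is pointed, and for all pointed $\bar v$ and all $v_{x+1}$ with $\bar v\cdot v_{x+1}\approx\bar u$: if $(\bar v,v_{x+1}u_{x+1})\not\approx\bot$ then $(\bar v,v_{x+1}u_{x+1})\approx(\bar u,u_{x+1})$. Let $d$ be the greatest length of a tuple $\not\approx\bot$. The congruence automaton $\mathcal A_\approx$ has layers $1,\dots,d$; the states on layer $x$ are the classes $[\bar u]$ of the pointed tuples $\bar u$ of length $x$, $[\bar u]\xrightarrow{a}[\bar u\cdot a]$ if $\bar u\cdot a\not\approx\bot$ (undefined otherwise), $\mu_x([(\bar u,u_{x+1})])=[\bar u\cdot u_{x+1}]$, and the initial state is $[(\varepsilon)]$. **Theorem.** For every $\omega$-regular language $L$, the number $d$ exists and $\mathcal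 A_\approx$ is a layered automaton with finitely many states that is consistent, recognises $L$, and is safe minimal, normal and centralised. It is the unique minimal consistent layered automaton for $L$: for every consistent layered automaton $\mathcal B$ with finitely many states that recognises $L$, 1. if $\mathcal B$ is safe minimal, normal and centralised, then $\mathcal B$ is isomorphic to $\mathcal A_\approx$; 2. $\mathcal B$ has a subautomaton that admits a surjective strong morphism to $\mathcal A_\approx$; 3. $\mathcal B$ has at least as many states as $\mathcal A_\approx$, and $[\![\mathcal B]\!]$ has at least as many states as $[\![\mathcal A_\approx]\!]$. -/

import Mathlib

universe u v w

open Filter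

namespace LayeredAutomata

/-! ### Words, the parity condition and omega-regular languages

Finite words over `α` are lists, infinite words are streams `Stream' α`. -/

/-- Min-parity: the least value occurring infinitely often exists and is even. -/
def ParityCondition (c : ℕ → ℕ) : Prop :=
  ∃ x, Even x ∧ (∀ᶠ n in atTop, x ≤ c n) ∧ ∃ᶠ n in atTop, c n = x

/-- The finite words in `S` together with the infinite words all of whose finite prefixes
are in `S`; a subset of the disjoint union of finite and infinite words. -/
def withLimits {α : Type u} (S : Set (List α)) : Set (List α ⊕ Stream' α) :=
  {w | Sum.elim (fun s => s ∈ S) (fun s => ∀ n, Stream'.take n s ∈ S) w}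

/-- Complete deterministic automaton with priorities in `{1, …, d}` on the transitions. -/
structure DetParityAutomaton (α : Type u) (Q : Type v) where
  d : ℕ
  init : Q
  next : Q → α → Q
  prio : Q → α → ℕ
  one_le_prio : ∀ q a, 1 ≤ prio q a
  prio_le : ∀ q a, prio q a ≤ d

namespace DetParityAutomaton

variable {α : Type u} {Q : Type v}

/-- The state reached after the first `n` letters of `w`. -/
def stateAt (A : DetParityAutomaton α Q) (w : Stream' α) (n : ℕ) : Q :=
  (Stream'.take n w).foldl A.next A.init

def language (A : DetParityAutomaton α Q) : Set (Stream' α) :=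
  {w | ParityCondition fun n => A.prio (A.stateAt w n) (w.get n)}

end DetParityAutomaton

/-- Recognised by a deterministic parity automaton with finitely many states. -/
def IsOmegaRegular {α : Type u} (L : Set (Stream' α)) : Prop :=
  ∃ (Q : Type) (_ : Finite Q) (A : DetParityAutomaton α Q), A.language = L

/-! ### Simple-by-priorities alternating automata -/

/-- Alternating parity automaton in which all `a`-transitions from a state `q` have the same
priority `prio q a`. -/
structure AlternatingAutomaton (α : Type u) where
  State : Type v
  prio : State → α → ℕ
  step : State → α → State → Prop
  complete : ∀ q a, ∃ q', step q a q'

namespace AlternatingAutomaton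

variable {α : Type u}

/-- `ρ` is an infinite run over `w` from `q`. -/
def IsRun (A : AlternatingAutomaton.{u, v} α) (w : Stream' α) (q : A.State)
    (ρ : Stream' A.State) : Prop :=
  ρ.get 0 = q ∧ ∀ n, A.step (ρ.get n) (w.get n) (ρ.get (n + 1))

/-- Eve has a winning strategy in the acceptance game on `w` from `q`: Eve moves when the priority
of the current letter is odd, Adam moves when it is even, and Eve wins the runs satisfying the
parity condition. A strategy maps the list `h` of the earlier states and the current state to the
next state. -/
def Accepts (A : AlternatingAutomaton.{u, v} α) (q : A.State) (w : Stream' α) : Prop :=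
  ∃ σ : List A.State → A.State → A.State,
    (∀ (h : List A.State) (p : A.State), Odd (A.prio p (w.get h.length)) →
      A.step p (w.get h.length) (σ h p)) ∧
    ∀ ρ : Stream' A.State, A.IsRun w q ρ →
      (∀ n, Odd (A.prio (ρ.get n) (w.get n)) → ρ.get (n + 1) = σ (ρ.take n) (ρ.get n)) →
      ParityCondition fun n => A.prio (ρ.get n) (w.get n)

/-- The language of a state. -/
def language (A : AlternatingAutomaton.{u, v} α) (q : A.State) : Set (Stream' α) :=
  {w | A.Accepts q w}

end AlternatingAutomaton

/-! ### Layered automata -/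

/-- A layered automaton with layers `1, …, depth`. `State` is the disjoint union of the state sets
of all the layers, `δ` the union of the partial deterministic transition functions of the layers
(`none` means undefined), and `μ` the union of the morphisms from each layer `x + 1` to layer `x`,
that is, the parent map of the forest. The value of `μ` on layer `1` carries no information and is
fixed to be the state itself. -/
structure LayeredAutomaton (α : Type u) where
  State : Type v
  depth : ℕ
  layer : State → ℕ
  one_le_layer : ∀ q, 1 ≤ layer q
  layer_le_depth : ∀ q, layer q ≤ depth
  δ : State → α → Option State
  layer_δ : ∀ q a q', δ q a = some q' → layer q' = layer q
  μ : State → State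
  layer_μ : ∀ q, 2 ≤ layer q → layer (μ q) + 1 = layer q
  μ_root : ∀ q, layer q = 1 → μ q = q
  μ_δ : ∀ q a q', δ q a = some q' → δ (μ q) a = some (μ q')
  init : State
  layer_init : layer init = 1
  complete : ∀ q, layer q = 1 → ∀ a, ∃ q', δ q a = some q'
  reachable : ∀ q, layer q = 1 → ∃ w : List α, w.foldlM δ init = some q

namespace LayeredAutomaton

variable {α : Type u}

section Basic

variable (A : LayeredAutomaton.{u, v} α)

/-- The state reached from `q` by the finite word `w` inside the layer of `q`, if defined. -/
def run (q : A.State) (w : List α) : Option A.State := w.foldlM A.δ q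

/-- The ancestor of `q` on layer `x`, for `1 ≤ x ≤ A.layer q`. -/
def anc (x : ℕ) (q : A.State) : A.State := A.μ^[A.layer q - x] q

/-- `p` is an ancestor of `q` (every state is an ancestor of itself). -/
def IsAncestor (p q : A.State) : Prop :=
  A.layer p ≤ A.layer q ∧ A.anc (A.layer p) q = p

/-- `q` has no children. -/
def IsLeaf (q : A.State) : Prop := ∀ p, 2 ≤ A.layer p → A.μ p ≠ q

open Classical in
/-- The greatest layer `x ≤ A.layer q` such that the ancestor of `q` on layer `x` has an
`a`-transition. -/
noncomputable def actionLayer (q : A.State) (a : α) : ℕ :=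
  Nat.findGreatest (fun x => A.δ (A.anc x q) a ≠ none) (A.layer q)

theorem layer_iterate (q : A.State) (k : ℕ) (hk : k < A.layer q) :
    A.layer (A.μ^[k] q) + k = A.layer q := by
  induction k with
  | zero => simp
  | succ k ih =>
    have h1 := ih (by omega)
    rw [Function.iterate_succ_apply']
    have := A.layer_μ (A.μ^[k] q) (by omega)
    omega

theorem layer_anc (x : ℕ) (q : A.State) (h1 : 1 ≤ x) (h2 : x ≤ A.layer q) :
    A.layer (A.anc x q) = x := by
  have := A.layer_iterate q (A.layer q - x) (by omega)
  unfold anc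
  omega

theorem exists_leaf (q : A.State) : ∃ q', A.IsLeaf q' ∧ A.IsAncestor q q' := by
  obtain ⟨k, hk⟩ : ∃ k, k = A.depth - A.layer q := ⟨_, rfl⟩
  induction k using Nat.strong_induction_on generalizing q with
  | _ k ih =>
    by_cases hq : A.IsLeaf q
    · exact ⟨q, hq, le_rfl, by simp [anc]⟩
    · unfold IsLeaf at hq
      push Not at hq
      obtain ⟨p, hp, rfl⟩ := hq
      have h1 := A.layer_μ p hp
      have h2 := A.layer_le_depth p
      obtain ⟨q', hl, hle, ha⟩ := ih (A.depth - A.layer p) (by omega) p rfl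
      refine ⟨q', hl, by omega, ?_⟩
      unfold anc at ha ⊢
      rw [show A.layer q' - A.layer (A.μ p) = (A.layer q' - A.layer p) + 1 by omega,
        Function.iterate_succ_apply', ha]

theorem actionLayer_spec (q : A.State) (a : α) :
    1 ≤ A.actionLayer q a ∧ A.actionLayer q a ≤ A.layer q ∧
      A.δ (A.anc (A.actionLayer q a) q) a ≠ none := by
  classical
  have h1 := A.one_le_layer q
  have h2 : A.δ (A.anc 1 q) a ≠ none := by
    obtain ⟨r, hr⟩ := A.complete _ (A.layer_anc 1 q le_rfl h1) a
    simp [hr]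
  unfold actionLayer
  exact ⟨Nat.le_findGreatest h1 h2, Nat.findGreatest_le _,
    Nat.findGreatest_spec (P := fun x => A.δ (A.anc x q) a ≠ none) h1 h2⟩

/-- The alternating automaton that gives the semantics of `A`. Its states are the leaves; from `q`
the letter `a` has priority `x = actionLayer q a` and leads to all the leaves below the
`a`-successor of the ancestor of `q` on layer `x`. -/
noncomputable def semantics : AlternatingAutomaton.{u, v} α where
  State := {q : A.State // A.IsLeaf q}
  prio q a := A.actionLayer q.1 a
  step q a q' := A.actionLayer q.1 a ≤ A.layer q'.1 ∧
    A.δ (A.anc (A.actionLayer q.1 a) q.1) a = some (A.anc (A.actionLayer q.1 a) q'.1)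
  complete := by
    rintro ⟨q, hq⟩ a
    obtain ⟨h1, h2, h3⟩ := A.actionLayer_spec q a
    obtain ⟨r, hr⟩ := Option.ne_none_iff_exists'.mp h3
    have hl : A.layer r = A.actionLayer q a :=
      (A.layer_δ _ _ _ hr).trans (A.layer_anc _ q h1 h2)
    obtain ⟨q', hq', hle, ha⟩ := A.exists_leaf r
    rw [hl] at hle ha
    exact ⟨⟨q', hq'⟩, hle, by rw [ha]; exact hr⟩

/-- `A` recognises `L`: the language of `A.semantics` is `L`, whichever leaf below the
initial state of layer `1` is taken as initial state. -/
def Recognizes (L : Set (Stream' α)) : Prop :=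
  ∀ q : A.semantics.State, A.anc 1 q.1 = A.init → A.semantics.language q = L

/-- The `x`-safe language of `q`: the finite and infinite words with a run from the ancestor of `q`
on layer `x`. -/
def safe (x : ℕ) (q : A.State) : Set (List α ⊕ Stream' α) :=
  withLimits {w | A.run (A.anc x q) w ≠ none}

/-- `w` is safe from `p` on the layer of `p`, and no suffix of `w` is safe from a child of
the state reached by the corresponding prefix. -/
def StaysExactly (p : A.State) (w : Stream' α) : Prop :=
  Sum.inr w ∈ A.safe (A.layer p) p ∧
    ∀ (s : List α) (w' : Stream' α), w = s ++ₛ w' →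
      ∀ p' : A.State, A.layer p' = A.layer p + 1 → A.run p s = some (A.μ p') →
        Sum.inr w' ∉ A.safe (A.layer p + 1) p'

def StronglyAccepts (p : A.State) (w : Stream' α) : Prop :=
  Even (A.layer p) ∧ A.StaysExactly p w

def StronglyRejects (p : A.State) (w : Stream' α) : Prop :=
  Odd (A.layer p) ∧ A.StaysExactly p w

def Consistent : Prop :=
  ¬ ∃ p p' : A.State, A.anc 1 p = A.anc 1 p' ∧
    ∃ w : Stream' α, A.StronglyAccepts p w ∧ A.StronglyRejects p' w

/-- Normal form: properties N1 and N2. -/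
def Normal : Prop :=
  ∀ q : A.State, 2 ≤ A.layer q →
    (∀ (s : List α) (q' : A.State), A.run q s = some q' →
      ∃ t : List α, t ≠ [] ∧ A.run q' t = some q) ∧
    (∀ p : A.State, A.layer p = A.layer q + 1 → A.μ p = q →
      ∃ s : List α, A.run q s ≠ none ∧ A.run p s = none)

/-- `p` and `q` are in the same strongly connected component of their layer. -/
def SameSCC (p q : A.State) : Prop :=
  (∃ s : List α, A.run p s = some q) ∧ ∃ t : List α, A.run q t = some p

/-- Two states with the same parent and comparable safe languages are in the same strongly
connected component. -/
def Centralised : Prop :=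
  ∀ p q : A.State, 2 ≤ A.layer p → A.layer q = A.layer p → A.μ p = A.μ q →
    A.safe (A.layer p) p ⊆ A.safe (A.layer p) q → A.SameSCC p q

/-- The language of a state: the language of the semantics automaton started in a leaf below it
(in a consistent automaton all these leaves have the same language). -/
def stateLanguage (p : A.State) : Set (Stream' α) :=
  {w | ∃ q : A.semantics.State, A.IsAncestor p q.1 ∧ w ∈ A.semantics.language q}

/-- `p` and `q` have the same language and the same `y`-safe languages for `2 ≤ y ≤ x`. -/
def SafeEquiv (x : ℕ) (p q : A.State) : Prop :=
  A.stateLanguage p = A.stateLanguage q ∧ ∀ y, 2 ≤ y → y ≤ x → A.safe y p = A.safe y q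

def SafeMinimal : Prop :=
  ∀ p q : A.State, A.layer p = A.layer q → A.SafeEquiv (A.layer p) p q → p = q

end Basic

/-- A morphism preserves the initial state, transitions and the ancestor relation; it may change
layers. -/
structure IsMorphism (A : LayeredAutomaton.{u, v} α) (B : LayeredAutomaton.{u, w} α)
    (φ : A.State → B.State) : Prop where
  init : φ A.init = B.init
  δ : ∀ q a q', A.δ q a = some q' → B.δ (φ q) a = some (φ q')
  ancestor : ∀ p q, A.IsAncestor p q → B.IsAncestor (φ p) (φ q)

/-- A strong morphism also preserves the absence of transitions. -/
structure IsStrongMorphism (A : LayeredAutomaton.{u, v} α) (B : LayeredAutomaton.{u, w} α)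
    (φ : A.State → B.State) : Prop extends IsMorphism A B φ where
  none : ∀ q a, A.δ q a = none → B.δ (φ q) a = none

/-- A bijection of the states that preserves the initial state, the layers, the transitions (and
their absence) and the parent maps. -/
def Isomorphic (A : LayeredAutomaton.{u, v} α) (B : LayeredAutomaton.{u, w} α) : Prop :=
  ∃ φ : A.State ≃ B.State, φ A.init = B.init ∧ (∀ q, B.layer (φ q) = A.layer q) ∧
    (∀ q a, B.δ (φ q) a = (A.δ q a).map φ) ∧ ∀ q, B.μ (φ q) = φ (A.μ q)

/-- `B` is a subautomaton of `A`: there is an injective morphism from `B` to `A`. -/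
def IsSubautomaton (B : LayeredAutomaton.{u, w} α) (A : LayeredAutomaton.{u, v} α) : Prop :=
  ∃ φ : B.State → A.State, Function.Injective φ ∧ IsMorphism B A φ

end LayeredAutomaton

/-! ### Congruences on tuples of words -/

/-- `Tup α n` is the type of `(n + 1)`-tuples of finite words: `snoc u v` is the tuple `u` with the
additional last component `v`. -/
inductive Tup (α : Type u) : ℕ → Type u
  | single : List α → Tup α 0
  | snoc {n : ℕ} : Tup α n → List α → Tup α (n + 1)

namespace Tup

variable {α : Type u}

/-- The tuple without its last component. -/
def front {n : ℕ} : Tup α (n + 1) → Tup α n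
  | snoc t _ => t

/-- The last component. -/
def last {n : ℕ} : Tup α (n + 1) → List α
  | snoc _ v => v

/-- Concatenation of a word to the last component. -/
def concat : {n : ℕ} → Tup α n → List α → Tup α n
  | _, single v, s => single (v ++ s)
  | _, snoc t v, s => snoc t (v ++ s)

/-- Concatenation of the last component to the second last one. -/
def merge {n : ℕ} (t : Tup α (n + 1)) : Tup α n := t.front.concat t.last

/-- The product of all components. -/
def flatten : {n : ℕ} → Tup α n → List α
  | _, single v => v
  | _, snoc t v => t.flatten ++ v

theorem concat_concat {n : ℕ} (t : Tup α n) (s s' : List α) :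
    (t.concat s).concat s' = t.concat (s ++ s') := by
  cases t <;> simp [concat]

theorem concat_nil {n : ℕ} (t : Tup α n) : t.concat [] = t := by
  cases t <;> simp [concat]

theorem merge_concat {n : ℕ} (t : Tup α (n + 1)) (s : List α) :
    (t.concat s).merge = t.merge.concat s := by
  cases t with
  | snoc t v => exact (concat_concat t v s).symm

end Tup

/-- A predicate `bot` ("equivalent to bottom") and a relation `eqv` on a type of tuples. -/
structure Cong (T : Type u) where
  bot : T → Prop
  eqv : T → T → Prop

section Congruence

variable {α : Type u} (L : Set (Stream' α))

/-- The inductive step for `bot`, from tuples of length `n + 1` to tuples of length `n + 2`. -/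
def botStep {n : ℕ} (c : Cong (Tup α n)) (t : Tup α (n + 1)) : Prop :=
  c.bot t.merge ∨
    ∀ (s : List α) (hs : s ≠ []), c.eqv (t.front.concat (t.last ++ s)) t.front →
      (t.front.flatten ++ₛ
          Stream'.cycle (t.last ++ s) (List.append_ne_nil_of_right_ne_nil _ hs) ∈ L ↔
        Even (n + 1))

/-- The safe language of a tuple with respect to a predicate `bot`. -/
def tupleSafe {n : ℕ} (bot : Tup α n → Prop) (t : Tup α n) : Set (List α ⊕ Stream' α) :=
  withLimits {s | ¬ bot (t.concat s)}

/-- The congruence of `L` on tuples of length `n + 1`, by induction on the length. On tuples of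
length `1` it is residual equivalence. -/
def cong : (n : ℕ) → Cong (Tup α n)
  | 0 =>
    { bot := fun _ => False
      eqv := fun s t => ∀ x : Stream' α, s.flatten ++ₛ x ∈ L ↔ t.flatten ++ₛ x ∈ L }
  | n + 1 =>
    { bot := botStep L (cong n)
      eqv := fun s t => (cong n).eqv s.merge t.merge ∧
        tupleSafe (botStep L (cong n)) s = tupleSafe (botStep L (cong n)) t }

/-- The tuple is equivalent to bottom. -/
def Bot {n : ℕ} (t : Tup α n) : Prop := (cong L n).bot t

/-- The two tuples are equivalent. -/
def Eqv {n : ℕ} (s t : Tup α n) : Prop := (cong L n).eqv s t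

/-- Pointed tuples. All tuples of length `1` are pointed. -/
def Pointed : (n : ℕ) → Tup α n → Prop
  | 0, _ => True
  | n + 1, t => ¬ Bot L t ∧ Pointed n t.front ∧
      ∀ (s : Tup α n) (v : List α), Pointed n s → Eqv L (s.concat v) t.front →
        ¬ Bot L (s.snoc (v ++ t.last)) → Eqv L (s.snoc (v ++ t.last)) t

variable {L}

theorem bot_succ_iff {n : ℕ} {t : Tup α (n + 1)} : Bot L t ↔ Bot L t.merge ∨
    ∀ (s : List α) (hs : s ≠ []), Eqv L (t.front.concat (t.last ++ s)) t.front →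
      (t.front.flatten ++ₛ
          Stream'.cycle (t.last ++ s) (List.append_ne_nil_of_right_ne_nil _ hs) ∈ L ↔
        Even (n + 1)) := Iff.rfl

theorem tupleSafe_eq_iff {n : ℕ} {bot : Tup α n → Prop} {s t : Tup α n} :
    tupleSafe bot s = tupleSafe bot t ↔ ∀ r, bot (s.concat r) ↔ bot (t.concat r) := by
  constructor
  · intro h r
    have : ¬ bot (s.concat r) ↔ ¬ bot (t.concat r) := Set.ext_iff.mp h (Sum.inl r)
    exact not_iff_not.mp this
  · intro h
    unfold tupleSafe
    congr 1
    ext r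
    exact not_iff_not.mpr (h r)

theorem eqv_succ_iff {n : ℕ} {s t : Tup α (n + 1)} : Eqv L s t ↔
    Eqv L s.merge t.merge ∧ ∀ r, Bot L (s.concat r) ↔ Bot L (t.concat r) :=
  and_congr Iff.rfl tupleSafe_eq_iff

theorem Eqv.refl : ∀ {n : ℕ} (t : Tup α n), Eqv L t t
  | 0, _ => fun _ => Iff.rfl
  | _ + 1, t => ⟨Eqv.refl t.merge, rfl⟩

theorem Eqv.symm : ∀ {n : ℕ} {s t : Tup α n}, Eqv L s t → Eqv L t s
  | 0, _, _, h => fun x => (h x).symm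
  | _ + 1, _, _, h => ⟨Eqv.symm h.1, h.2.symm⟩

theorem Eqv.trans : ∀ {n : ℕ} {r s t : Tup α n}, Eqv L r s → Eqv L s t → Eqv L r t
  | 0, _, _, _, h, h' => fun x => (h x).trans (h' x)
  | _ + 1, _, _, _, h, h' => ⟨Eqv.trans h.1 h'.1, h.2.trans h'.2⟩

theorem Bot.concat {n : ℕ} {t : Tup α n} (s : List α) (h : Bot L t) : Bot L (t.concat s) := by
  induction n with
  | zero => exact h.elim
  | succ n ih =>
    rw [bot_succ_iff] at h ⊢
    rcases h with h | h
    · left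
      rw [Tup.merge_concat]
      exact ih h
    · right
      cases t with
      | snoc t v =>
        intro r hr he
        have key : ∀ (x y : List α) (hx : x ≠ []) (hy : y ≠ []), x = y →
            (t.flatten ++ₛ Stream'.cycle x hx ∈ L ↔ Even (n + 1)) →
              (t.flatten ++ₛ Stream'.cycle y hy ∈ L ↔ Even (n + 1)) := by
          rintro x _ hx hy rfl h
          exact h
        have he' : Eqv L (t.concat (v ++ (s ++ r))) t := by
          have : Eqv L (t.concat (v ++ s ++ r)) t := he
          rwa [List.append_assoc] at this
        exact key _ _ _ _ (List.append_assoc v s r).symm (h (s ++ r) (by simp [hr]) he')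

theorem Eqv.concat {n : ℕ} {s t : Tup α n} (r : List α) (h : Eqv L s t) :
    Eqv L (s.concat r) (t.concat r) := by
  induction n with
  | zero =>
    cases s with
    | single s =>
      cases t with
      | single t =>
        intro x
        have := h (r ++ₛ x)
        simpa only [Tup.concat, Tup.flatten, Stream'.append_append_stream] using this
  | succ n ih =>
    rw [eqv_succ_iff] at h ⊢
    refine ⟨?_, fun r' => ?_⟩
    · rw [Tup.merge_concat, Tup.merge_concat]
      exact ih h.1
    · rw [Tup.concat_concat, Tup.concat_concat]
      exact h.2 (r ++ r')

theorem Eqv.bot_iff {n : ℕ} {s t : Tup α n} (h : Eqv L s t) : Bot L s ↔ Bot L t := by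
  cases n with
  | zero => exact Iff.rfl
  | succ n => simpa only [Tup.concat_nil] using (eqv_succ_iff.mp h).2 []

theorem Pointed.not_bot {n : ℕ} {t : Tup α n} (h : Pointed L n t) : ¬ Bot L t := by
  cases n with
  | zero => exact fun h => h
  | succ n => exact h.1

theorem Pointed.concat {n : ℕ} {t : Tup α n} (r : List α) (h : Pointed L n t)
    (hb : ¬ Bot L (t.concat r)) : Pointed L n (t.concat r) := by
  cases t with
  | single t => trivial
  | snoc t v =>
    refine ⟨hb, h.2.1, fun s x hs he hn => ?_⟩
    have hc : s.snoc (x ++ (v ++ r)) = (s.snoc (x ++ v)).concat r := by simp [Tup.concat]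
    change ¬ Bot L (s.snoc (x ++ (v ++ r))) at hn
    change Eqv L (s.snoc (x ++ (v ++ r))) _
    rw [hc] at hn ⊢
    exact (h.2.2 s x hs he fun hbot => hn (hbot.concat r)).concat r

theorem Pointed.merge {n : ℕ} {t : Tup α (n + 1)} (h : Pointed L (n + 1) t) :
    Pointed L n t.merge :=
  Pointed.concat t.last h.2.1 fun hb => h.1 (Or.inl hb)

variable (L)

/-- Equivalence of tuples of length `n + 1`, as a setoid. -/
def tupSetoid (n : ℕ) : Setoid (Tup α n) where
  r := Eqv L
  iseqv := ⟨Eqv.refl, Eqv.symm, Eqv.trans⟩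

/-- The classes of tuples of length `n + 1`. -/
abbrev TupClass (n : ℕ) : Type u := Quotient (tupSetoid L n)

/-- The class of a tuple. -/
def cls {n : ℕ} (t : Tup α n) : TupClass L n := Quotient.mk (tupSetoid L n) t

/-- Concatenation, on classes. -/
def TupClass.concat {n : ℕ} (c : TupClass L n) (s : List α) : TupClass L n :=
  Quotient.lift (s := tupSetoid L n) (fun t => cls L (t.concat s))
    (fun _ _ h => Quotient.sound (s := tupSetoid L n) (Eqv.concat s h)) c

/-- Merging of the last two components, on classes. -/
def TupClass.merge {n : ℕ} (c : TupClass L (n + 1)) : TupClass L n :=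
  Quotient.lift (s := tupSetoid L (n + 1)) (fun t => cls L t.merge)
    (fun _ _ h => Quotient.sound (s := tupSetoid L n) (eqv_succ_iff.mp h).1) c

/-- The class consists of tuples equivalent to bottom. -/
def TupClass.IsBot {n : ℕ} (c : TupClass L n) : Prop :=
  Quotient.lift (s := tupSetoid L n) (fun t => Bot L t) (fun _ _ h => propext h.bot_iff) c

/-- The states of the congruence automaton: the state `⟨n, c, _⟩` is a class `c` of tuples of length
`n + 1` that contains a pointed tuple. -/
structure PointedClass where
  idx : ℕ
  tupClass : TupClass L idx
  pointed : ∃ t, Pointed L idx t ∧ cls L t = tupClass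

namespace PointedClass

variable {L}

/-- The class of a pointed tuple. -/
def mk' {n : ℕ} (t : Tup α n) (ht : Pointed L n t) : PointedClass L := ⟨n, cls L t, t, ht, rfl⟩

theorem exists_mk' (c : PointedClass L) :
    ∃ (t : Tup α c.idx) (ht : Pointed L c.idx t), c = mk' t ht := by
  obtain ⟨n, _, t, ht, rfl⟩ := c
  exact ⟨t, ht, rfl⟩

open Classical in
/-- Transitions: concatenation of a letter to the last component, unless the result is
bottom. -/
noncomputable def next (c : PointedClass L) (a : α) : Option (PointedClass L) :=
  if h : (TupClass.concat L c.tupClass [a]).IsBot then none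
  else some ⟨c.idx, TupClass.concat L c.tupClass [a], by
    obtain ⟨n, _, t, ht, rfl⟩ := c
    exact ⟨t.concat [a], ht.concat [a] h, rfl⟩⟩

/-- The parent map: merging of the last two components (and the identity on classes of tuples of
length `1`). -/
def parent : PointedClass L → PointedClass L
  | ⟨0, c, h⟩ => ⟨0, c, h⟩
  | ⟨n + 1, c, h⟩ => ⟨n, TupClass.merge L c, by
    obtain ⟨t, ht, rfl⟩ := h
    exact ⟨t.merge, ht.merge, rfl⟩⟩

theorem next_of_bot {n : ℕ} {t : Tup α n} (ht : Pointed L n t) (a : α)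
    (h : Bot L (t.concat [a])) : (mk' t ht).next a = none :=
  dif_pos h

theorem next_of_not_bot {n : ℕ} {t : Tup α n} (ht : Pointed L n t) (a : α)
    (h : ¬ Bot L (t.concat [a])) :
    (mk' t ht).next a = some (mk' (t.concat [a]) (ht.concat [a] h)) :=
  dif_neg h

theorem next_eq_some {n : ℕ} {t : Tup α n} {ht : Pointed L n t} {a : α} {c : PointedClass L}
    (h : (mk' t ht).next a = some c) :
    ∃ hb : ¬ Bot L (t.concat [a]), c = mk' (t.concat [a]) (ht.concat [a] hb) := by
  by_cases hb : Bot L (t.concat [a])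
  · rw [next_of_bot ht a hb] at h
    cases h
  · rw [next_of_not_bot ht a hb] at h
    exact ⟨hb, (Option.some.inj h).symm⟩

theorem next_single (s : List α) (a : α) :
    (mk' (L := L) (Tup.single s) trivial).next a = some (mk' (Tup.single (s ++ [a])) trivial) :=
  next_of_not_bot (t := Tup.single s) trivial a (Pointed.not_bot (n := 0) trivial)

theorem foldlM_next (s t : List α) :
    t.foldlM next (mk' (L := L) (Tup.single s) trivial) =
      some (mk' (Tup.single (s ++ t)) trivial) := by
  induction t generalizing s with
  | nil => simp
  | cons a t ih =>
    rw [List.foldlM_cons, next_single]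
    simpa using ih (s ++ [a])

theorem exists_single (c : PointedClass L) (h : c.idx = 0) :
    ∃ s, c = mk' (Tup.single s) trivial := by
  obtain ⟨n, _, t, ht, rfl⟩ := c
  cases t with
  | single s => exact ⟨s, rfl⟩
  | snoc t v => exact absurd h (Nat.succ_ne_zero _)

theorem next_parent (c : PointedClass L) (a : α) (c' : PointedClass L) (h : c.next a = some c') :
    c.parent.next a = some c'.parent := by
  obtain ⟨n, _, t, ht, rfl⟩ := c
  obtain ⟨hb, rfl⟩ := next_eq_some (ht := ht) h
  cases t with
  | single s => exact next_single s a
  | snoc t v =>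
    have hm := Tup.merge_concat (t.snoc v) [a]
    have hb' : ¬ Bot L ((t.snoc v).merge.concat [a]) := fun hx => hb (Or.inl (hm ▸ hx))
    refine (next_of_not_bot ht.merge a hb').trans ?_
    have key : ∀ (m : ℕ) (x y : Tup α m) (hx : Pointed L m x) (hy : Pointed L m y), x = y →
        mk' x hx = mk' y hy := by
      rintro m x _ hx hy rfl
      rfl
    exact congrArg some (key _ _ _ _ (Pointed.merge (ht.concat [a] hb)) hm.symm)

end PointedClass

/-- The lengths of the tuples that are not equivalent to bottom. -/
def tupleLengths : Set ℕ := {x | ∃ (n : ℕ) (t : Tup α n), x = n + 1 ∧ ¬ Bot L t}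

/-- The congruence automaton of `L`, when `d` is the greatest length of a tuple that is not
equivalent to bottom: the states on layer `x` are the classes of the pointed `x`-tuples,
transitions are given by concatenation, parents by merging, and the initial state is the class of
the empty word. -/
noncomputable def congruenceAutomaton (d : ℕ) (hd : IsGreatest (tupleLengths L) d) :
    LayeredAutomaton.{u, u} α where
  State := PointedClass L
  depth := d
  layer q := q.idx + 1
  one_le_layer q := Nat.le_add_left 1 q.idx
  layer_le_depth := by
    rintro ⟨n, _, t, ht, rfl⟩
    exact hd.2 ⟨n, t, rfl, ht.not_bot⟩
  δ := PointedClass.next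
  layer_δ := by
    rintro ⟨n, _, t, ht, rfl⟩ a q' h
    obtain ⟨_, rfl⟩ := PointedClass.next_eq_some (ht := ht) h
    rfl
  μ := PointedClass.parent
  layer_μ := by
    rintro ⟨n, c⟩ h
    cases n with
    | zero => simp at h
    | succ n => rfl
  μ_root := by
    rintro ⟨n, c⟩ h
    cases n with
    | zero => rfl
    | succ n => simp at h
  μ_δ := PointedClass.next_parent
  init := PointedClass.mk' (Tup.single []) trivial
  layer_init := rfl
  complete := by
    intro q h a
    obtain ⟨s, rfl⟩ := PointedClass.exists_single q (Nat.succ.inj h)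
    exact ⟨_, PointedClass.next_single s a⟩
  reachable := by
    intro q h
    obtain ⟨s, rfl⟩ := PointedClass.exists_single q (Nat.succ.inj h)
    exact ⟨s, by simpa using PointedClass.foldlM_next (L := L) [] s⟩

end Congruence

end LayeredAutomata

/-! Reading an infinite word in a layered automaton and descending to a child whenever one survives
the rest of the word, one ends in a state where the word stays exactly (`exists_settles`).
Consistency makes the parity of that layer independent of the choices (`Settles.even_iff`). In the
acceptance game, a player who always moves below a child that survives the rest of the word makes
this parity decide the winner (`mem_language_iff`). From there on, games are replaced by loops and
their infinite powers.

Minimality compares a canonical automaton `A` (finite, consistent, recognising `L`, safe minimal,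
normal, centralised) with any finite consistent `B` for `L`. A state `a` of `A` has loops that kill
its children (normality), kill its siblings or move them to `a` (centralisation with safe
minimality), and leave every surviving state of `B` with at least the safe words of `a`
(`IsCanonical.exists_loop`). The infinite power of such a loop stays exactly at `a`, so `L` sees the
parity of its layer. Hence matched states have layers of equal parity, and a child in `A` forces a
strict descent in `B`. Every state of `A` is therefore represented in `B` (`exists_represents`), and
comparable representatives represent comparable states (`Represents.above`). This gives the
injections, the subautomaton with its strong morphism, and the isomorphism of two canonical
automata.

It remains that the congruence automaton is canonical. A tuple `(t, v)` that is not bottom carries a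
loop on `t` beginning with `v` that is accepted iff the length of `t` is odd. Enclosing powers of
loops in loops of the opposite acceptance lowers the priorities that a deterministic parity
automaton for `L` must see (`Low.step`). This bounds the length of tuples and also yields N2
(`exists_kill`). Tuples whose last component is extended until its set of safe continuations is
minimal are pointed (`Pointed.exists_snoc`), and pointedness gives N1 and centralisation. A word
that stays exactly on a layer has the acceptance given by its parity (`mem_iff_of_staysExactly`),
for otherwise its factors would be loops that build a surviving child. Consistency and recognition
of `L` follow. -/

namespace LayeredAutomata

/-! ### Words -/

section Words

variable {α : Type u}

theorem append_stream_split {s x : List α} {w y : Stream' α} (h : s ++ₛ w = x ++ₛ y)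
    (hl : s.length ≤ x.length) : ∃ t, x = s ++ t ∧ w = t ++ₛ y := by
  induction s generalizing x with
  | nil => exact ⟨x, rfl, h⟩
  | cons a s ih =>
    cases x with
    | nil => simp at hl
    | cons b x =>
      rw [Stream'.cons_append_stream, Stream'.cons_append_stream] at h
      obtain ⟨rfl, h'⟩ := Stream'.cons_injective2 h
      obtain ⟨t, rfl, ht⟩ := ih h' (by simpa using hl)
      exact ⟨t, rfl, ht⟩

theorem take_append_length (s : List α) (w : Stream' α) : (s ++ₛ w).take s.length = s := by
  have h : s ++ₛ w = (s ++ₛ w).take s.length ++ₛ (s ++ₛ w).drop s.length :=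
    (Stream'.append_take_drop _ _).symm
  obtain ⟨t, ht, -⟩ := append_stream_split h (by simp)
  have h2 := congrArg List.length ht
  simp only [Stream'.length_take, List.length_append] at h2
  have h3 : t = [] := List.eq_nil_of_length_eq_zero (by omega)
  simpa [h3] using ht

/-- The `k`-th power of a word. -/
def rep (z : List α) : ℕ → List α
  | 0 => []
  | k + 1 => z ++ rep z k

theorem rep_add (z : List α) (j k : ℕ) : rep z (j + k) = rep z j ++ rep z k := by
  induction j with
  | zero => simp [rep]
  | succ j ih => rw [Nat.add_right_comm, rep, ih, rep, List.append_assoc]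

theorem rep_succ' (z : List α) (k : ℕ) : rep z (k + 1) = rep z k ++ z := by
  rw [rep_add]
  simp [rep]

theorem length_rep (z : List α) (k : ℕ) : (rep z k).length = k * z.length := by
  induction k with
  | zero => simp [rep]
  | succ k ih => rw [rep, List.length_append, ih, Nat.succ_mul, Nat.add_comm]

theorem le_length_rep {z : List α} (hz : z ≠ []) (k : ℕ) : k ≤ (rep z k).length := by
  rw [length_rep]
  exact Nat.le_mul_of_pos_right _ (List.length_pos_of_ne_nil hz)

theorem rep_ne_nil {z : List α} (hz : z ≠ []) {k : ℕ} (hk : 1 ≤ k) : rep z k ≠ [] :=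
  List.ne_nil_of_length_pos (hk.trans (le_length_rep hz k))

theorem cycle_eq_rep (z : List α) (h : z ≠ []) (k : ℕ) :
    Stream'.cycle z h = rep z k ++ₛ Stream'.cycle z h := by
  induction k with
  | zero => rfl
  | succ k ih => rw [rep, Stream'.append_append_stream, ← ih, ← Stream'.cycle_eq]

theorem eq_cycle {z : List α} (h : z ≠ []) {w : Stream' α} (hw : w = z ++ₛ w) :
    w = Stream'.cycle z h := by
  have hk : ∀ k, w = rep z k ++ₛ w := by
    intro k
    induction k with
    | zero => rfl
    | succ k ih => rw [rep, Stream'.append_append_stream, ← ih, ← hw]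
  apply Stream'.take_theorem
  intro n
  rw [hk n, cycle_eq_rep z h n, Stream'.take_append_of_le_length (h := le_length_rep h n),
    Stream'.take_append_of_le_length (h := le_length_rep h n)]

theorem cycle_split {z : List α} {h : z ≠ []} {s : List α} {w : Stream' α}
    (hs : Stream'.cycle z h = s ++ₛ w) :
    ∃ k t, rep z k = s ++ t ∧ w = t ++ₛ Stream'.cycle z h := by
  have h1 := hs.symm.trans (cycle_eq_rep z h s.length)
  obtain ⟨t, ht, hw⟩ := append_stream_split h1 (le_length_rep h _)
  exact ⟨_, t, ht, hw⟩

end Words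

/-- A sequence of bounded values has a least value that occurs infinitely often. -/
theorem exists_least_frequent {c : ℕ → ℕ} {d : ℕ} (hd : ∀ n, c n ≤ d) :
    ∃ y, (∀ᶠ n in atTop, y ≤ c n) ∧ ∃ᶠ n in atTop, c n = y := by
  classical
  have hex : ∃ y, ∃ᶠ n in atTop, c n = y := by
    by_contra hno
    push Not at hno
    have h1 : ∀ᶠ n in atTop, ∀ y ∈ Finset.range (d + 1), c n ≠ y :=
      (eventually_all_finset _).mpr fun y _ => by simpa using hno y
    obtain ⟨n, hn⟩ := h1.exists
    exact hn (c n) (Finset.mem_range.mpr (Nat.lt_succ_of_le (hd n))) rfl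
  refine ⟨Nat.find hex, ?_, Nat.find_spec hex⟩
  have h1 : ∀ᶠ n in atTop, ∀ y ∈ Finset.range (Nat.find hex), c n ≠ y :=
    (eventually_all_finset _).mpr fun y hy => by
      simpa using Nat.find_min hex (Finset.mem_range.mp hy)
  filter_upwards [h1] with n hn
  by_contra hlt
  exact hn _ (Finset.mem_range.mpr (not_le.mp hlt)) rfl

theorem parityCondition_iff {c : ℕ → ℕ} {y : ℕ} (h1 : ∀ᶠ n in atTop, y ≤ c n)
    (h2 : ∃ᶠ n in atTop, c n = y) : ParityCondition c ↔ Even y := by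
  constructor
  · rintro ⟨x, hx, h3, h4⟩
    obtain ⟨n, hn, hn'⟩ := (h4.and_eventually h1).exists
    obtain ⟨m, hm, hm'⟩ := (h2.and_eventually h3).exists
    have : x = y := by omega
    exact this ▸ hx
  · exact fun hy => ⟨y, hy, h1, h2⟩

namespace LayeredAutomaton

variable {α : Type u} (A : LayeredAutomaton.{u, v} α)

/-! ### Runs and ancestors -/

@[simp]
theorem run_nil (q : A.State) : A.run q [] = some q := rfl

theorem run_append (q : A.State) (s t : List α) :
    A.run q (s ++ t) = (A.run q s).bind fun q' => A.run q' t := by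
  unfold run
  rw [List.foldlM_append]
  rfl

theorem run_singleton (q : A.State) (a : α) : A.run q [a] = A.δ q a := by
  unfold run
  simp

variable {A}

theorem run_append_of {q q' : A.State} {s : List α} (h : A.run q s = some q') (t : List α) :
    A.run q (s ++ t) = A.run q' t := by
  rw [run_append, h, Option.bind_some]

theorem run_of_append {q r : A.State} {s t : List α} (h : A.run q (s ++ t) = some r) :
    ∃ q', A.run q s = some q' ∧ A.run q' t = some r := by
  rw [run_append] at h
  exact Option.bind_eq_some_iff.mp h

theorem run_ne_none_of_append {q : A.State} {s t : List α} (h : A.run q (s ++ t) ≠ none) :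
    A.run q s ≠ none := by
  obtain ⟨r, hr⟩ := Option.ne_none_iff_exists'.mp h
  obtain ⟨q', hq, -⟩ := run_of_append hr
  simp [hq]

theorem run_append_none {q : A.State} {s : List α} (h : A.run q s = none) (t : List α) :
    A.run q (s ++ t) = none := by
  rw [run_append, h, Option.bind_none]

theorem run_rep {q : A.State} {z : List α} (h : A.run q z = some q) (k : ℕ) :
    A.run q (rep z k) = some q := by
  induction k with
  | zero => rfl
  | succ k ih => rw [rep, run_append_of h, ih]

theorem layer_run {q q' : A.State} {s : List α} (h : A.run q s = some q') :
    A.layer q' = A.layer q := by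
  induction s generalizing q with
  | nil =>
    rw [run_nil] at h
    cases h
    rfl
  | cons a s ih =>
    rw [← List.singleton_append] at h
    obtain ⟨p, h1, h2⟩ := run_of_append h
    rw [run_singleton] at h1
    exact (ih h2).trans (A.layer_δ _ _ _ h1)

theorem run_μ {q q' : A.State} {s : List α} (h : A.run q s = some q') :
    A.run (A.μ q) s = some (A.μ q') := by
  induction s generalizing q with
  | nil =>
    rw [run_nil] at h
    cases h
    rfl
  | cons a s ih =>
    rw [← List.singleton_append] at h ⊢
    obtain ⟨p, h1, h2⟩ := run_of_append h
    rw [run_singleton] at h1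
    rw [run_append_of (q' := A.μ p), ih h2]
    rw [run_singleton]
    exact A.μ_δ _ _ _ h1

theorem run_iterate {q q' : A.State} {s : List α} (h : A.run q s = some q') (k : ℕ) :
    A.run (A.μ^[k] q) s = some (A.μ^[k] q') := by
  induction k with
  | zero => exact h
  | succ k ih =>
    rw [Function.iterate_succ_apply', Function.iterate_succ_apply']
    exact run_μ ih

theorem run_of_layer_one {q : A.State} (h : A.layer q = 1) (s : List α) :
    ∃ q', A.run q s = some q' := by
  induction s generalizing q with
  | nil => exact ⟨q, rfl⟩
  | cons a s ih =>
    obtain ⟨p, hp⟩ := A.complete q h a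
    obtain ⟨r, hr⟩ := ih ((A.layer_δ _ _ _ hp).trans h)
    refine ⟨r, ?_⟩
    rw [← List.singleton_append, run_append_of (q' := p), hr]
    rw [run_singleton, hp]

theorem layer_μ' (q : A.State) : A.layer (A.μ q) = max 1 (A.layer q - 1) := by
  have h1 := A.one_le_layer q
  by_cases h : A.layer q = 1
  · rw [A.μ_root q h, h]
    rfl
  · have := A.layer_μ q (by omega)
    omega

theorem layer_iterate' (q : A.State) (k : ℕ) : A.layer (A.μ^[k] q) = max 1 (A.layer q - k) := by
  induction k with
  | zero =>
    have := A.one_le_layer q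
    simp only [Function.iterate_zero, id_eq]
    omega
  | succ k ih =>
    rw [Function.iterate_succ_apply', layer_μ', ih]
    omega

theorem iterate_of_root {q : A.State} (h : A.layer q = 1) (k : ℕ) : A.μ^[k] q = q :=
  Function.iterate_fixed (A.μ_root q h) k

variable (A)

/-- `p` is obtained from `q` by iterating the parent map. -/
def Above (p q : A.State) : Prop := ∃ k, A.μ^[k] q = p

/-- The ancestor on layer `1`. -/
def root (q : A.State) : A.State := A.anc 1 q

variable {A}

theorem layer_root (q : A.State) : A.layer (A.root q) = 1 :=
  A.layer_anc 1 q le_rfl (A.one_le_layer q)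

theorem anc_iterate {q : A.State} {k : ℕ} : A.anc (A.layer (A.μ^[k] q)) q = A.μ^[k] q := by
  unfold anc
  rw [layer_iterate']
  have h1 := A.one_le_layer q
  by_cases h : k < A.layer q
  · congr 1
    omega
  -- More iterations than there are layers above: `μ` fixes layer `1`, so the surplus `j` has no
  -- effect.
  · obtain ⟨j, rfl⟩ : ∃ j, k = j + (A.layer q - 1) := ⟨k - (A.layer q - 1), by omega⟩
    rw [Function.iterate_add_apply, iterate_of_root (k := j)]
    · congr 1
      congr 1
      omega
    · rw [layer_iterate']
      omega

theorem Above.anc {p q : A.State} (h : A.Above p q) : A.anc (A.layer p) q = p := by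
  obtain ⟨k, rfl⟩ := h
  exact anc_iterate

theorem Above.layer_le {p q : A.State} (h : A.Above p q) : A.layer p ≤ A.layer q := by
  obtain ⟨k, rfl⟩ := h
  rw [layer_iterate']
  have := A.one_le_layer q
  omega

theorem isAncestor_iff {p q : A.State} : A.IsAncestor p q ↔ A.Above p q :=
  ⟨fun h => ⟨_, h.2⟩, fun h => ⟨h.layer_le, h.anc⟩⟩

theorem Above.refl (q : A.State) : A.Above q q := ⟨0, rfl⟩

theorem Above.trans {p q r : A.State} (h : A.Above p q) (h' : A.Above q r) : A.Above p r := by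
  obtain ⟨k, rfl⟩ := h
  obtain ⟨j, rfl⟩ := h'
  exact ⟨k + j, Function.iterate_add_apply _ _ _ _⟩

/-- In a forest the ancestors of one state form a chain. -/
theorem Above.of_layer_le {p p' q : A.State} (h : A.Above p q) (h' : A.Above p' q)
    (hl : A.layer p ≤ A.layer p') : A.Above p p' := by
  have h1 := h.anc
  have h2 := h'.anc
  have h3 := h'.layer_le
  have e : A.anc (A.layer p) q = A.μ^[A.layer p' - A.layer p] (A.anc (A.layer p') q) := by
    unfold LayeredAutomaton.anc
    rw [← Function.iterate_add_apply]
    congr 1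
    omega
  rw [h1, h2] at e
  exact ⟨_, e.symm⟩

theorem Above.eq_of_layer_le {p q : A.State} (h : A.Above p q) (hl : A.layer q ≤ A.layer p) :
    p = q := by
  have h2 := h.anc
  rw [← h2]
  unfold LayeredAutomaton.anc
  rw [Nat.sub_eq_zero_of_le hl]
  rfl

theorem above_μ (q : A.State) : A.Above (A.μ q) q := ⟨1, rfl⟩

theorem above_anc (x : ℕ) (q : A.State) : A.Above (A.anc x q) q := ⟨_, rfl⟩

theorem Above.run {p q q' : A.State} {s : List α} (h : A.Above p q) (hr : A.run q s = some q') :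
    ∃ p', A.run p s = some p' ∧ A.Above p' q' := by
  obtain ⟨k, rfl⟩ := h
  exact ⟨_, run_iterate hr k, k, rfl⟩

theorem root_eq_of_above {p q : A.State} (h : A.Above p q) : A.root p = A.root q := by
  have h1 : A.Above (A.root p) (A.root q) :=
    ((above_anc 1 p).trans h).of_layer_le (above_anc 1 q) (by
      exact (layer_root p).le.trans (layer_root q).ge)
  exact h1.eq_of_layer_le (by rw [layer_root, layer_root])

theorem root_of_layer_one {q : A.State} (h : A.layer q = 1) : A.root q = q :=
  (above_anc 1 q).eq_of_layer_le (by rw [h]; exact A.one_le_layer _)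

theorem run_root {q q' : A.State} {s : List α} (h : A.run q s = some q') :
    A.run (A.root q) s = some (A.root q') := by
  have := run_iterate h (A.layer q - 1)
  unfold root anc
  rwa [layer_run h]

/-! ### Safe infinite words -/

variable (A)

/-- The infinite word `w` has a run from `q` in the layer of `q`. -/
def Live (q : A.State) (w : Stream' α) : Prop := ∀ n, A.run q (w.take n) ≠ none

variable {A}

theorem Live.run_ne_none {q : A.State} {s : List α} {w : Stream' α} (h : A.Live q (s ++ₛ w)) :
    A.run q s ≠ none := by
  have := h s.length
  rwa [take_append_length] at this

theorem live_of_forall {q : A.State} {w : Stream' α}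
    (h : ∀ s w', w = s ++ₛ w' → A.run q s ≠ none) : A.Live q w :=
  fun n => h _ (w.drop n) (Stream'.append_take_drop _ _).symm

theorem Live.exists_run {q : A.State} {s : List α} {w : Stream' α} (h : A.Live q (s ++ₛ w)) :
    ∃ q', A.run q s = some q' ∧ A.Live q' w := by
  obtain ⟨q', hq⟩ := Option.ne_none_iff_exists'.mp h.run_ne_none
  refine ⟨q', hq, live_of_forall fun t w' ht => ?_⟩
  subst ht
  rw [← Stream'.append_append_stream] at h
  rw [← run_append_of hq]
  exact h.run_ne_none

theorem Live.above {p q : A.State} {w : Stream' α} (h : A.Live q w) (hp : A.Above p q) :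
    A.Live p w := by
  intro n
  obtain ⟨q', hq⟩ := Option.ne_none_iff_exists'.mp (h n)
  obtain ⟨p', hp', -⟩ := hp.run hq
  simp [hp']

theorem live_cycle {q : A.State} {z : List α} (hz : z ≠ []) (h : A.run q z = some q) :
    A.Live q (Stream'.cycle z hz) := by
  refine live_of_forall fun s w' hs => ?_
  obtain ⟨k, t, hk, -⟩ := cycle_split hs
  apply run_ne_none_of_append (t := t)
  rw [← hk, run_rep h]
  simp

theorem anc_self (q : A.State) : A.anc (A.layer q) q = q := (Above.refl q).anc

theorem inr_mem_safe {q : A.State} {w : Stream' α} :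
    Sum.inr w ∈ A.safe (A.layer q) q ↔ A.Live q w := by
  change (∀ n, A.run (A.anc (A.layer q) q) (w.take n) ≠ none) ↔ _
  rw [anc_self]
  rfl

theorem inl_mem_safe {x : ℕ} {q : A.State} {s : List α} :
    Sum.inl s ∈ A.safe x q ↔ A.run (A.anc x q) s ≠ none := Iff.rfl

theorem safe_subset_iff {x y : ℕ} {p q : A.State} : A.safe x p ⊆ A.safe y q ↔
    ∀ s, A.run (A.anc x p) s ≠ none → A.run (A.anc y q) s ≠ none := by
  constructor
  · intro h s hs
    exact h (a := Sum.inl s) hs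
  · rintro h (s | w) hs
    · exact h s hs
    · exact fun n => h _ (hs n)

theorem staysExactly_iff {p : A.State} {w : Stream' α} : A.StaysExactly p w ↔ A.Live p w ∧
    ∀ s w' p', w = s ++ₛ w' → A.layer p' = A.layer p + 1 → A.run p s = some (A.μ p') →
      ¬ A.Live p' w' := by
  unfold StaysExactly
  rw [inr_mem_safe]
  refine and_congr_right fun _ => ?_
  constructor
  · intro h s w' p' hw hl hr hlive
    refine h s w' hw p' hl hr ?_
    rw [← hl]
    exact inr_mem_safe.mpr hlive
  · intro h s w' hw p' hl hr hmem
    refine h s w' p' hw hl hr ?_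
    rw [← hl] at hmem
    exact inr_mem_safe.mp hmem

theorem StaysExactly.live {p : A.State} {w : Stream' α} (h : A.StaysExactly p w) : A.Live p w :=
  (staysExactly_iff.mp h).1

theorem StaysExactly.suffix {p q : A.State} {s : List α} {w : Stream' α}
    (h : A.StaysExactly p (s ++ₛ w)) (hr : A.run p s = some q) : A.StaysExactly q w := by
  rw [staysExactly_iff] at h ⊢
  obtain ⟨q', hq', hl⟩ := h.1.exists_run
  rw [hr] at hq'
  cases hq'
  refine ⟨hl, fun t w' p' hw hlay hrun => ?_⟩
  subst hw
  refine h.2 (s ++ t) w' p' (Stream'.append_append_stream _ _ _).symm ?_ ?_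
  · rw [hlay, layer_run hr]
  · rw [run_append_of hr, hrun]

/-- A loop that no child survives. -/
theorem staysExactly_cycle {q : A.State} {z : List α} (hz : z ≠ []) (h : A.run q z = some q)
    (hc : ∀ p, A.layer p = A.layer q + 1 → A.μ p = q → A.run p z = none) :
    A.StaysExactly q (Stream'.cycle z hz) := by
  rw [staysExactly_iff]
  refine ⟨live_cycle hz h, fun s w' p' hs hl hr hlive => ?_⟩
  -- The prefix `s` need not end at a multiple of `z`. The word `t` completes it, and the run of
  -- `p'` along `t` ends in a child of `q` that still has to survive `z`.
  obtain ⟨k, t, hk, rfl⟩ := cycle_split hs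
  obtain ⟨p'', hp, hlive'⟩ := hlive.exists_run
  have h1 := run_μ hp
  have h2 := run_append_of hr t
  rw [← hk, run_rep h, h1] at h2
  rw [Stream'.cycle_eq] at hlive'
  exact hlive'.run_ne_none (hc p'' ((layer_run hp).trans hl) (Option.some.inj h2).symm)

/-- A safe word eventually stays exactly on some layer. -/
theorem Live.exists_staysExactly {q : A.State} {w : Stream' α} (h : A.Live q w) :
    ∃ s w' q' p, w = s ++ₛ w' ∧ A.run q s = some q' ∧ A.Above q' p ∧ A.StaysExactly p w' := by
  obtain ⟨k, hk⟩ : ∃ k, k = A.depth - A.layer q := ⟨_, rfl⟩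
  induction k using Nat.strong_induction_on generalizing q w with
  | _ k ih =>
    by_cases hs : A.StaysExactly q w
    · exact ⟨[], w, q, q, rfl, rfl, Above.refl q, hs⟩
    · rw [staysExactly_iff] at hs
      push Not at hs
      obtain ⟨s, w', p', rfl, hl, hr, hlive⟩ := hs h
      have := A.layer_le_depth p'
      obtain ⟨t, w'', q', p, rfl, hr', hab, hst⟩ :=
        ih (A.depth - A.layer p') (by omega) hlive rfl
      refine ⟨s ++ t, w'', A.μ q', p, (Stream'.append_append_stream _ _ _).symm, ?_,
        (above_μ q').trans hab, hst⟩
      rw [run_append_of hr, run_μ hr']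

/-! ### Consistency and the semantics -/

variable (A)

/-- From `q`, on layer `1`, the word `w` eventually stays exactly on the layer of `p`. -/
def Settles (q : A.State) (w : Stream' α) (p : A.State) : Prop :=
  ∃ s w', w = s ++ₛ w' ∧ A.run q s = some (A.root p) ∧ A.StaysExactly p w'

variable {A}

/-- Layer `1` is complete, so every word is safe there, and the descent to surviving children stops
because the depth is bounded. -/
theorem exists_settles {q : A.State} (hq : A.layer q = 1) (w : Stream' α) :
    ∃ p, A.Settles q w p := by
  have hlive : A.Live q w := fun n => by
    obtain ⟨q', hq'⟩ := run_of_layer_one hq (w.take n)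
    simp [hq']
  obtain ⟨s, w', q', p, hw, hr, hab, hst⟩ := hlive.exists_staysExactly
  refine ⟨p, s, w', hw, ?_, hst⟩
  rw [← root_eq_of_above hab, root_of_layer_one ((layer_run hr).trans hq), hr]

/-- Staying exactly is inherited by suffixes, so the two witnesses can be compared at the later of
their positions. There they have the same root, and consistency applies. -/
theorem Settles.even_iff (hA : A.Consistent) {q : A.State} {w : Stream' α} {p p' : A.State}
    (h : A.Settles q w p) (h' : A.Settles q w p') : Even (A.layer p) ↔ Even (A.layer p') := by
  have key : ∀ p p' : A.State, ∀ w, A.root p = A.root p' → A.StaysExactly p w →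
      A.StaysExactly p' w → (Even (A.layer p) ↔ Even (A.layer p')) := by
    intro p p' w hr h1 h2
    constructor
    · intro he
      by_contra ho
      exact hA ⟨p, p', hr, w, ⟨he, h1⟩, Nat.not_even_iff_odd.mp ho, h2⟩
    · intro he
      by_contra ho
      exact hA ⟨p', p, hr.symm, w, ⟨he, h2⟩, Nat.not_even_iff_odd.mp ho, h1⟩
  have key2 : ∀ p p' : A.State, ∀ s t w', A.run q s = some (A.root p) →
      A.StaysExactly p (t ++ₛ w') → A.run q (s ++ t) = some (A.root p') →
      A.StaysExactly p' w' → (Even (A.layer p) ↔ Even (A.layer p')) := by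
    intro p p' s t w' h1 h2 h3 h4
    obtain ⟨r, hr, -⟩ := h2.live.exists_run
    rw [← layer_run hr]
    refine key r p' w' ?_ (h2.suffix hr) h4
    rw [run_append_of h1, run_root hr] at h3
    exact Option.some.inj h3
  obtain ⟨s, w1, hw1, hr1, hs1⟩ := h
  obtain ⟨t, w2, hw2, hr2, hs2⟩ := h'
  rcases le_total s.length t.length with hl | hl
  · obtain ⟨r, rfl, rfl⟩ := append_stream_split (hw1.symm.trans hw2) hl
    exact key2 p p' s r w2 hr1 hs1 hr2 hs2
  · obtain ⟨r, rfl, rfl⟩ := append_stream_split (hw2.symm.trans hw1) hl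
    exact (key2 p' p t r w1 hr2 hs2 hr1 hs1).symm

/-- A choice of a successor leaf that goes below a child from which the remaining word is safe,
if there is one. -/
def GreedyStep (w : Stream' α) (n : ℕ) (p q : A.semantics.State) : Prop :=
  A.semantics.step p (w.get n) q ∧ ∀ p' : A.State,
    A.layer p' = A.semantics.prio p (w.get n) + 1 →
    A.δ (A.anc (A.semantics.prio p (w.get n)) p.1) (w.get n) = some (A.μ p') →
    A.Live p' (w.drop (n + 1)) →
      A.semantics.prio p (w.get n) + 1 ≤ A.layer q.1 ∧
        A.Live (A.anc (A.semantics.prio p (w.get n) + 1) q.1) (w.drop (n + 1))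

theorem exists_greedyStep (w : Stream' α) (n : ℕ) (p : A.semantics.State) :
    ∃ q, GreedyStep w n p q := by
  by_cases h : ∃ p' : A.State, A.layer p' = A.semantics.prio p (w.get n) + 1 ∧
    A.δ (A.anc (A.semantics.prio p (w.get n)) p.1) (w.get n) = some (A.μ p') ∧
    A.Live p' (w.drop (n + 1))
  · obtain ⟨p', h1, h2, h3⟩ := h
    obtain ⟨q, hq, hab⟩ := A.exists_leaf p'
    have hanc := hab.2
    rw [h1] at hanc
    have hle : A.semantics.prio p (w.get n) + 1 ≤ A.layer q := h1 ▸ hab.1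
    have h1' := (A.actionLayer_spec p.1 (w.get n)).1
    refine ⟨⟨q, hq⟩, ⟨Nat.le_of_succ_le hle, ?_⟩, fun _ _ _ _ => ⟨hle, ?_⟩⟩
    · refine h2.trans (congrArg some ?_)
      have hab2 : A.Above (A.μ p') q := (above_μ p').trans (isAncestor_iff.mp hab)
      have h4 := hab2.anc
      rw [layer_μ', h1] at h4
      have h5 : max 1 (A.semantics.prio p (w.get n) + 1 - 1) = A.actionLayer p.1 (w.get n) := by
        change max 1 (A.actionLayer p.1 (w.get n) + 1 - 1) = _
        omega
      rw [h5] at h4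
      exact h4.symm
    · exact hanc.symm ▸ h3
  · obtain ⟨q, hq⟩ := A.semantics.complete p (w.get n)
    exact ⟨q, hq, fun p' h1 h2 h3 => absurd ⟨p', h1, h2, h3⟩ h⟩

theorem prio_spec (q : A.semantics.State) (a : α) : 1 ≤ A.semantics.prio q a ∧
    A.semantics.prio q a ≤ A.layer q.1 :=
  ⟨(A.actionLayer_spec q.1 a).1, (A.actionLayer_spec q.1 a).2.1⟩

theorem anc_anc {x y : ℕ} (q : A.State) (h1 : 1 ≤ x) (hxy : x ≤ y) (hy : y ≤ A.layer q) :
    A.anc x (A.anc y q) = A.anc x q := by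
  have h := (above_anc x q).of_layer_le (above_anc y q) (by
    rw [A.layer_anc x q h1 (hxy.trans hy), A.layer_anc y q (h1.trans hxy) hy]
    exact hxy)
  have := h.anc
  rwa [A.layer_anc x q h1 (hxy.trans hy)] at this

/-- A step of priority at least `x` follows the transition on layer `x`. -/
theorem step_anc {p q : A.semantics.State} {a : α} (h : A.semantics.step p a q) {x : ℕ}
    (h1 : 1 ≤ x) (hx : x ≤ A.semantics.prio p a) :
    x ≤ A.layer q.1 ∧ A.δ (A.anc x p.1) a = some (A.anc x q.1) := by
  obtain ⟨hl, hd⟩ := h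
  have hs := (prio_spec p a).2
  change _ ≤ A.layer q.1 at hl
  refine ⟨hx.trans hl, ?_⟩
  have h2 := run_iterate ((A.run_singleton _ _).trans hd) (A.semantics.prio p a - x)
  rw [run_singleton] at h2
  have key : ∀ r : A.State, A.semantics.prio p a ≤ A.layer r →
      A.μ^[A.semantics.prio p a - x] (A.anc (A.actionLayer p.1 a) r) = A.anc x r := by
    intro r hr
    rw [← anc_anc r h1 hx hr]
    have := A.layer_anc (A.semantics.prio p a) r (h1.trans hx) hr
    rw [anc.eq_1 A x, this]
    rfl
  rwa [key _ hs, key _ hl] at h2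

variable {w : Stream' α} {ρ : Stream' A.semantics.State} {ℓ : A.semantics.State}

theorem run_anc_of_run (hρ : A.semantics.IsRun w ℓ ρ) {x N : ℕ} (h1 : 1 ≤ x)
    (hN : ∀ n, N ≤ n → x ≤ A.semantics.prio (ρ.get n) (w.get n)) (k : ℕ) :
    A.run (A.anc x (ρ.get N).1) ((w.drop N).take k) = some (A.anc x (ρ.get (N + k)).1) := by
  induction k with
  | zero => rfl
  | succ k ih =>
    rw [Stream'.take_succ', run_append_of ih, run_singleton, Stream'.get_drop]
    exact (step_anc (hρ.2 (N + k)) h1 (hN _ (Nat.le_add_right _ _))).2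

/-- If all the steps of the least priority `y` occurring infinitely often are greedy, then the
word eventually stays exactly on layer `y`. -/
theorem exists_settles_of_run (hρ : A.semantics.IsRun w ℓ ρ) {y : ℕ}
    (h1 : ∀ᶠ n in atTop, y ≤ A.semantics.prio (ρ.get n) (w.get n))
    (h2 : ∃ᶠ n in atTop, A.semantics.prio (ρ.get n) (w.get n) = y)
    (hg : ∀ n, A.semantics.prio (ρ.get n) (w.get n) = y →
      GreedyStep w n (ρ.get n) (ρ.get (n + 1))) :
    ∃ p, A.Settles (A.root ℓ.1) w p ∧ A.layer p = y := by
  obtain ⟨N, hN⟩ := eventually_atTop.mp h1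
  have hy1 : 1 ≤ y := by
    obtain ⟨n, rfl⟩ := h2.exists
    exact (prio_spec _ _).1
  have hle : ∀ n, N ≤ n → y ≤ A.layer (ρ.get n).1 := fun n hn => (hN n hn).trans (prio_spec _ _).2
  have hrun := run_anc_of_run hρ hy1 hN
  refine ⟨A.anc y (ρ.get N).1, ⟨w.take N, w.drop N, (Stream'.append_take_drop _ _).symm, ?_, ?_⟩,
    A.layer_anc _ _ hy1 (hle N le_rfl)⟩
  · have h3 := run_anc_of_run hρ (x := 1) (N := 0) le_rfl (fun n _ => (prio_spec _ _).1) N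
    rw [hρ.1, Nat.zero_add] at h3
    rw [root_eq_of_above (above_anc _ _)]
    exact h3
  · rw [staysExactly_iff]
    refine ⟨fun n => by simp [hrun n], fun s w' p' hw hl hr hlive => ?_⟩
    rw [A.layer_anc _ _ hy1 (hle N le_rfl)] at hl
    obtain ⟨m, hm⟩ : ∃ m, m = s.length := ⟨_, rfl⟩
    have hs : s = (w.drop N).take m := by rw [hw, hm, take_append_length]
    have hw' : w' = (w.drop N).drop m := by rw [hw, hm, Stream'.drop_append_stream]
    rw [hs, hrun] at hr
    have hr' := Option.some.inj hr
    rw [hw', Stream'.drop_drop] at hlive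
    -- at any later time there is a child from which the remaining word is safe
    have hlater : ∀ k, ∃ p'' : A.State, A.layer p'' = y + 1 ∧
        A.μ p'' = A.anc y (ρ.get (N + m + k)).1 ∧ A.Live p'' (w.drop (N + m + k)) := by
      intro k
      have h4 : w.drop (N + m) = (w.drop (N + m)).take k ++ₛ (w.drop (N + m + k)) := by
        conv_lhs => rw [← Stream'.append_take_drop k (w.drop (N + m)), Stream'.drop_drop]
      rw [h4] at hlive
      obtain ⟨p'', h5, h6⟩ := hlive.exists_run
      refine ⟨p'', (layer_run h5).trans hl, ?_, h6⟩
      have h7 := run_μ h5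
      have h8 := hrun (m + k)
      have h9 : (w.drop N).take (m + k) = (w.drop N).take m ++ (w.drop (N + m)).take k := by
        conv_lhs => rw [← Stream'.append_take_drop m (w.drop N), Stream'.drop_drop,
          ← Stream'.append_take_drop k (w.drop (N + m)), ← Stream'.append_append_stream]
        have := take_append_length (Stream'.take m (Stream'.drop N w) ++
          Stream'.take k (Stream'.drop (N + m) w)) (Stream'.drop k (Stream'.drop (N + m) w))
        simpa using this
      rw [h9, run_append_of (hrun m), hr', h7] at h8
      rw [Nat.add_assoc]
      exact Option.some.inj h8
    -- the next greedy step moves below such a child for good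
    obtain ⟨n, hn, hny⟩ := frequently_atTop.mp h2 (N + m)
    obtain ⟨k, rfl⟩ := Nat.exists_eq_add_of_le hn
    obtain ⟨p'', h3, h4, h5⟩ := hlater (k + 1)
    have hstep := hg _ hny
    have h6 := hstep.2 p'' (by rw [hny, h3]) (by
      rw [hny, h4]
      exact (step_anc hstep.1 hy1 hny.ge).2) h5
    rw [hny] at h6
    -- As long as the ancestor on layer `y + 1` has a transition, the priority is at least `y + 1`.
    -- So priority `y` cannot recur.
    have hind : ∀ j, y + 1 ≤ A.layer (ρ.get (N + m + k + 1 + j)).1 ∧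
        A.run (A.anc (y + 1) (ρ.get (N + m + k + 1)).1) ((w.drop (N + m + k + 1)).take j) =
          some (A.anc (y + 1) (ρ.get (N + m + k + 1 + j)).1) := by
      intro j
      induction j with
      | zero => exact ⟨h6.1, rfl⟩
      | succ j ih =>
        have h7 := h6.2 (j + 1)
        rw [Stream'.take_succ', run_append_of ih.2, run_singleton, Stream'.get_drop] at h7
        have h8 : y + 1 ≤ A.semantics.prio (ρ.get (N + m + k + 1 + j))
            (w.get (N + m + k + 1 + j)) := by
          classical
          exact Nat.le_findGreatest ih.1 h7
        have h9 := step_anc (hρ.2 _) (Nat.le_add_left 1 y) h8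
        refine ⟨h9.1, ?_⟩
        rw [Stream'.take_succ', run_append_of ih.2, run_singleton, Stream'.get_drop]
        exact h9.2
    obtain ⟨n', hn', hny'⟩ := frequently_atTop.mp h2 (N + m + k + 1)
    obtain ⟨j, rfl⟩ := Nat.exists_eq_add_of_le hn'
    have h7 := h6.2 (j + 1)
    rw [Stream'.take_succ', run_append_of (hind j).2, run_singleton, Stream'.get_drop] at h7
    have h8 : y + 1 ≤ A.semantics.prio (ρ.get (N + m + k + 1 + j))
        (w.get (N + m + k + 1 + j)) := by
      classical
      exact Nat.le_findGreatest (hind j).1 h7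
    omega

theorem prio_le_depth (q : A.semantics.State) (a : α) : A.semantics.prio q a ≤ A.depth :=
  (prio_spec q a).2.trans (A.layer_le_depth _)

/-- The language of a leaf of a consistent layered automaton. -/
theorem mem_language_iff (hA : A.Consistent) {w : Stream' α} {ℓ : A.semantics.State} {p : A.State}
    (hp : A.Settles (A.root ℓ.1) w p) :
    w ∈ A.semantics.language ℓ ↔ Even (A.layer p) := by
  classical
  choose greedy hgreedy using fun n (q : A.semantics.State) => exists_greedyStep w n q
  constructor
  · rintro ⟨σ, hσ, hwin⟩
    -- The play of `σ` against a greedy Adam. The first component is the history that `σ` takes as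
    -- input.
    let nxt : List A.semantics.State × A.semantics.State →
        List A.semantics.State × A.semantics.State := fun x =>
      (x.1 ++ [x.2], if Odd (A.semantics.prio x.2 (w.get x.1.length)) then σ x.1 x.2
        else greedy x.1.length x.2)
    let sq : ℕ → List A.semantics.State × A.semantics.State := fun n => nxt^[n] ([], ℓ)
    have hsucc : ∀ n, sq (n + 1) = nxt (sq n) := fun n => Function.iterate_succ_apply' _ _ _
    let ρ : Stream' A.semantics.State := fun n => (sq n).2
    have hget : ∀ n, ρ.get n = (sq n).2 := fun _ => rfl
    have htake : ∀ n, (sq n).1 = ρ.take n := by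
      intro n
      induction n with
      | zero => rfl
      | succ n ih => rw [hsucc, Stream'.take_succ', ← ih]; rfl
    have hlen : ∀ n, (sq n).1.length = n := fun n => by rw [htake, Stream'.length_take]
    have hodd : ∀ n, Odd (A.semantics.prio (ρ.get n) (w.get n)) →
        ρ.get (n + 1) = σ (ρ.take n) (ρ.get n) := by
      intro n hn
      rw [hget (n + 1), hsucc, ← htake]
      change (if Odd (A.semantics.prio (sq n).2 (w.get (sq n).1.length)) then _ else _) = _
      rw [hlen]
      exact if_pos hn
    have heven : ∀ n, ¬ Odd (A.semantics.prio (ρ.get n) (w.get n)) →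
        GreedyStep w n (ρ.get n) (ρ.get (n + 1)) := by
      intro n hn
      rw [hget (n + 1), hsucc]
      change GreedyStep w n _
        (if Odd (A.semantics.prio (sq n).2 (w.get (sq n).1.length)) then _ else _)
      rw [hlen, show (if Odd (A.semantics.prio (sq n).2 (w.get n)) then σ (sq n).1 (sq n).2
        else greedy n (sq n).2) = greedy n (ρ.get n) from if_neg hn]
      exact hgreedy _ _
    have hρ : A.semantics.IsRun w ℓ ρ := by
      refine ⟨rfl, fun n => ?_⟩
      by_cases hn : Odd (A.semantics.prio (ρ.get n) (w.get n))
      · rw [hodd n hn]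
        have := hσ (ρ.take n) (ρ.get n)
        rw [Stream'.length_take] at this
        exact this hn
      · exact (heven n hn).1
    obtain ⟨y, hy1, hy2⟩ := exists_least_frequent
      (c := fun n => A.semantics.prio (ρ.get n) (w.get n)) (d := A.depth)
      (fun n => prio_le_depth _ _)
    have hye : Even y := (parityCondition_iff hy1 hy2).mp (hwin ρ hρ hodd)
    -- As `y` is even, all the steps of priority `y` were made by Adam, hence greedily.
    obtain ⟨p', hp', rfl⟩ := exists_settles_of_run hρ hy1 hy2
      fun n hn => heven n (by rw [hn]; exact Nat.not_odd_iff_even.mpr hye)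
    exact (hp.even_iff hA hp').mpr hye
  · intro hpe
    -- Eve plays greedily. If the least recurring priority were odd, its steps would be hers, and
    -- the word would settle on an odd layer.
    refine ⟨fun h q => greedy h.length q, fun h q _ => (hgreedy _ _).1, fun ρ hρ hodd => ?_⟩
    obtain ⟨y, hy1, hy2⟩ := exists_least_frequent
      (c := fun n => A.semantics.prio (ρ.get n) (w.get n)) (d := A.depth)
      (fun n => prio_le_depth _ _)
    rw [parityCondition_iff hy1 hy2]
    by_contra hyo
    obtain ⟨p', hp', rfl⟩ := exists_settles_of_run hρ hy1 hy2 fun n hn => by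
      have hstep := hodd n (by rw [hn]; exact Nat.not_even_iff_odd.mp hyo)
      simp only [Stream'.length_take] at hstep
      rw [hstep]
      exact hgreedy _ _
    exact hyo ((hp.even_iff hA hp').mp hpe)

theorem exists_semantics_leaf (q : A.State) : ∃ ℓ : A.semantics.State, A.Above q ℓ.1 := by
  obtain ⟨q', hq', hab⟩ := A.exists_leaf q
  exact ⟨⟨q', hq'⟩, isAncestor_iff.mp hab⟩

theorem mem_stateLanguage_iff (hA : A.Consistent) {w : Stream' α} {q p : A.State}
    (hp : A.Settles (A.root q) w p) : w ∈ A.stateLanguage q ↔ Even (A.layer p) := by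
  constructor
  · rintro ⟨ℓ, hab, hw⟩
    rw [root_eq_of_above (isAncestor_iff.mp hab)] at hp
    exact (mem_language_iff hA hp).mp hw
  · intro he
    obtain ⟨ℓ, hab⟩ := exists_semantics_leaf q
    rw [root_eq_of_above hab] at hp
    exact ⟨ℓ, isAncestor_iff.mpr hab, (mem_language_iff hA hp).mpr he⟩

theorem Settles.append {q q' p : A.State} {s : List α} {w : Stream' α} (h : A.Settles q' w p)
    (hr : A.run q s = some q') : A.Settles q (s ++ₛ w) p := by
  obtain ⟨t, w', rfl, h1, h2⟩ := h
  exact ⟨s ++ t, w', (Stream'.append_append_stream _ _ _).symm, by rw [run_append_of hr, h1], h2⟩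

theorem StaysExactly.settles {p : A.State} {w : Stream' α} (h : A.StaysExactly p w) :
    A.Settles (A.root p) w p := ⟨[], w, rfl, rfl, h⟩

theorem mem_iff_of_settles (hA : A.Consistent) {L : Set (Stream' α)} (hL : A.Recognizes L)
    {w : Stream' α} {p : A.State} (hp : A.Settles A.init w p) :
    w ∈ L ↔ Even (A.layer p) := by
  obtain ⟨ℓ, hab⟩ := exists_semantics_leaf A.init
  have hroot := root_eq_of_above hab
  rw [root_of_layer_one A.layer_init] at hroot
  rw [← hL ℓ hroot.symm]
  exact mem_language_iff hA (hroot ▸ hp)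

/-- The form in which `L` enters the comparison of two automata: words that stay exactly somewhere
reveal the parity of the layer. -/
theorem StaysExactly.even_layer_iff (hA : A.Consistent) {L : Set (Stream' α)}
    (hL : A.Recognizes L) {u : List α} {w : Stream' α} {p : A.State}
    (hu : A.run A.init u = some (A.root p)) (h : A.StaysExactly p w) :
    Even (A.layer p) ↔ u ++ₛ w ∈ L :=
  (mem_iff_of_settles hA hL (h.settles.append hu)).symm

theorem mem_stateLanguage_iff_mem (hA : A.Consistent) {L : Set (Stream' α)}
    (hL : A.Recognizes L) {u : List α} {q : A.State} (hu : A.run A.init u = some (A.root q))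
    (w : Stream' α) : w ∈ A.stateLanguage q ↔ u ++ₛ w ∈ L := by
  obtain ⟨p, hp⟩ := exists_settles (layer_root q) w
  rw [mem_stateLanguage_iff hA hp, mem_iff_of_settles hA hL (hp.append hu)]

end LayeredAutomaton

end LayeredAutomata

/-! ### Synchronising loops in canonical automata. -/

namespace LayeredAutomata

/-- Finitely many goals, each of which can be reached by extending a loop and is stable under
further extension, can be reached together. -/
theorem exists_forall_append {α : Type u} {ι : Type*} [Finite ι] {S : Set (List α)}
    (happ : ∀ x ∈ S, ∀ y ∈ S, x ++ y ∈ S) {P : ι → List α → Prop}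
    (hstab : ∀ i, ∀ x ∈ S, ∀ y ∈ S, P i x → P i (x ++ y))
    (hext : ∀ i, ∀ x ∈ S, ∃ y ∈ S, P i (x ++ y)) {x : List α} (hx : x ∈ S) :
    ∃ y ∈ S, ∀ i, P i (x ++ y) := by
  classical
  cases nonempty_fintype ι
  have key : ∀ I : Finset ι, ∃ y ∈ S, ∀ i ∈ I, P i (x ++ y) := by
    intro I
    induction I using Finset.induction_on with
    | empty => exact ⟨x, hx, by simp⟩
    | insert i I _ ih =>
      obtain ⟨y, hy, hP⟩ := ih
      obtain ⟨z, hz, hPi⟩ := hext i _ (happ x hx y hy)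
      refine ⟨y ++ z, happ y hy z hz, fun j hj => ?_⟩
      rw [← List.append_assoc]
      rcases Finset.mem_insert.mp hj with rfl | hj
      · exact hPi
      · exact hstab j _ (happ x hx y hy) z hz (hP j hj)
  obtain ⟨y, hy, hP⟩ := key Finset.univ
  exact ⟨y, hy, fun i => hP i (Finset.mem_univ i)⟩

namespace LayeredAutomaton

variable {α : Type u}

section

variable {A : LayeredAutomaton.{u, v} α}

theorem anc_μ {q : A.State} {y : ℕ} (hy : 1 ≤ y) (h : y < A.layer q) :
    A.anc y (A.μ q) = A.anc y q := by
  have h1 := A.layer_μ q (by omega)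
  unfold anc
  rw [← Function.iterate_succ_apply]
  congr 1
  omega

theorem stateLanguage_eq_of_root (hA : A.Consistent) {p q : A.State} (h : A.root p = A.root q) :
    A.stateLanguage p = A.stateLanguage q := by
  ext w
  obtain ⟨r, hr⟩ := exists_settles (layer_root q) w
  rw [mem_stateLanguage_iff hA hr, mem_stateLanguage_iff hA (h ▸ hr)]

/-- In a safe minimal automaton, siblings are determined by the safe words of their layer. -/
theorem eq_of_siblings (hA : A.Consistent) (hm : A.SafeMinimal) {p q : A.State}
    (hl : A.layer p = A.layer q) (hμ : A.μ p = A.μ q)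
    (h : ∀ s, A.run p s ≠ none ↔ A.run q s ≠ none) : p = q := by
  have hroot : A.root p = A.root q := by
    rw [← root_eq_of_above (above_μ p), ← root_eq_of_above (above_μ q), hμ]
  refine hm p q hl ⟨stateLanguage_eq_of_root hA hroot, fun y h1 h2 => ?_⟩
  rcases h2.eq_or_lt with rfl | h2
  · have h3 := anc_self p
    have h4 := anc_self q
    rw [← hl] at h4
    apply Set.Subset.antisymm <;> rw [safe_subset_iff, h3, h4]
    · exact fun s => (h s).mp
    · exact fun s => (h s).mpr
  · unfold safe
    rw [← anc_μ (q := p) (by omega) h2, ← anc_μ (q := q) (by omega) (by omega), hμ]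

end

/-- Every word that is safe from `a` is safe from `b`. -/
def Dominates (A : LayeredAutomaton.{u, v} α) (B : LayeredAutomaton.{u, w} α) (a : A.State)
    (b : B.State) : Prop :=
  ∀ s, A.run a s ≠ none → B.run b s ≠ none

variable {A : LayeredAutomaton.{u, v} α} {B : LayeredAutomaton.{u, w} α}

theorem Dominates.run {a a' : A.State} {b b' : B.State} {s : List α} (h : Dominates A B a b)
    (ha : A.run a s = some a') (hb : B.run b s = some b') : Dominates A B a' b' := by
  intro t ht
  rw [← run_append_of ha] at ht
  rw [← run_append_of hb]
  exact h _ ht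

theorem Dominates.exists_run {a a' : A.State} {b : B.State} {s : List α} (h : Dominates A B a b)
    (ha : A.run a s = some a') : ∃ b', B.run b s = some b' ∧ Dominates A B a' b' := by
  obtain ⟨b', hb⟩ := Option.ne_none_iff_exists'.mp (h s (by simp [ha]))
  exact ⟨b', hb, h.run ha hb⟩

theorem Dominates.live {a : A.State} {b : B.State} {w : Stream' α} (h : Dominates A B a b)
    (hw : A.Live a w) : B.Live b w := fun n => h _ (hw n)

/-- A finite consistent automaton for `L` with all the normalisation properties. -/
structure IsCanonical (A : LayeredAutomaton.{u, v} α) (L : Set (Stream' α)) : Prop where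
  finite : Finite A.State
  consistent : A.Consistent
  recognizes : A.Recognizes L
  safeMinimal : A.SafeMinimal
  normal : A.Normal
  centralised : A.Centralised

variable {L : Set (Stream' α)}

/-- A loop on `a` can be extended such that any sibling of `a` dies or moves to `a`. -/
theorem IsCanonical.exists_sync (hA : A.IsCanonical L) {a : A.State} (ha : 2 ≤ A.layer a)
    {S : Set (List α)} (hloop : ∀ x ∈ S, A.run a x = some a)
    (hret : ∀ s, A.run a s ≠ none → ∃ r, s ++ r ∈ S) {p : A.State}
    (hl : A.layer p = A.layer a) (hμ : A.μ p = A.μ a) {x : List α} (hx : x ∈ S) :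
    ∃ y ∈ S, A.run p (x ++ y) = none ∨ A.run p (x ++ y) = some a := by
  have := hA.finite
  cases hp : A.run p x with
  | none => exact ⟨x, hx, Or.inl (run_append_none hp x)⟩
  | some p' =>
    have hl' : A.layer p' = A.layer a := (layer_run hp).trans hl
    have hμ' : A.μ p' = A.μ a := by
      have h1 := run_μ hp
      rw [hμ, run_μ (hloop x hx)] at h1
      exact (Option.some.inj h1).symm
    by_cases hd : Dominates A A a p'
    -- Centralisation gives a word `z` from `a` to `p'`. Along its powers the safe sets of the
    -- states `f i` reached from `a` increase. By finiteness two consecutive ones agree, and safe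
    -- minimality gives `f i = f (i + 1)`. As `rep z i` leads from `a` to `f i` and from `p'` to `f
    -- (i + 1)`, it merges the two.
    · have hscc := hA.centralised a p' ha hl' hμ'.symm (by
        rw [safe_subset_iff, anc_self, ← hl', anc_self]
        exact hd)
      obtain ⟨⟨z, hz⟩, -⟩ := hscc
      have hdef : ∀ i, ∃ b, A.run a (rep z i) = some b := by
        intro i
        induction i with
        | zero => exact ⟨a, rfl⟩
        | succ i ih =>
          obtain ⟨b, hb⟩ := ih
          obtain ⟨b', hb', -⟩ := hd.exists_run hb
          exact ⟨b', by rw [rep, run_append_of hz, hb']⟩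
      choose f hf using hdef
      have hf' : ∀ i, A.run p' (rep z i) = some (f (i + 1)) := by
        intro i
        rw [← hf (i + 1), rep, run_append_of hz]
      have hdom : ∀ i j, Dominates A A (f i) (f (i + j)) := by
        intro i j
        induction j with
        | zero => exact fun s hs => hs
        | succ j ih => exact fun s hs => hd.run (hf (i + j)) (hf' (i + j)) s (ih s hs)
      have hpar : ∀ i, A.μ (f i) = A.μ a := by
        intro i
        have h1 := run_μ hz
        rw [hμ'] at h1
        have h2 := run_μ (hf i)
        rw [run_rep h1] at h2
        exact (Option.some.inj h2).symm
      have hstable : ∃ i, f i = f (i + 1) := by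
        obtain ⟨i, j, hij, he⟩ := Finite.exists_ne_map_eq_of_infinite f
        wlog hlt : i < j generalizing i j
        · exact this j i hij.symm he.symm (lt_of_le_of_ne (not_lt.mp hlt) hij.symm)
        refine ⟨i, eq_of_siblings hA.consistent hA.safeMinimal ?_ ?_ fun s => ⟨?_, ?_⟩⟩
        · rw [layer_run (hf i), layer_run (hf (i + 1))]
        · rw [hpar, hpar]
        · exact hdom i 1 s
        · intro hs
          rw [he]
          obtain ⟨k, rfl⟩ := Nat.exists_eq_add_of_le (Nat.succ_le_of_lt hlt)
          exact hdom (i + 1) k s hs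
      obtain ⟨i, hi⟩ := hstable
      obtain ⟨r, hr⟩ := hret (rep z i) (by simp [hf i])
      refine ⟨_, hr, Or.inr ?_⟩
      have h1 := hloop _ hr
      rw [run_append_of (hf i), hi] at h1
      rw [run_append_of hp, run_append_of (hf' i), h1]
    · unfold Dominates at hd
      push Not at hd
      obtain ⟨s, hs, hn⟩ := hd
      obtain ⟨r, hr⟩ := hret s hs
      refine ⟨_, hr, Or.inl ?_⟩
      rw [run_append_of hp, run_append_none hn]

/-- A loop on `a` with all the useful properties. -/
theorem IsCanonical.exists_loop (hA : A.IsCanonical L) [Finite B.State] {a : A.State}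
    (ha : 2 ≤ A.layer a) {S : Set (List α)} (happ : ∀ x ∈ S, ∀ y ∈ S, x ++ y ∈ S)
    (hloop : ∀ x ∈ S, A.run a x = some a) (hret : ∀ s, A.run a s ≠ none → ∃ r, s ++ r ∈ S)
    {s : List α} (hs : A.run a s ≠ none) :
    ∃ r, s ++ r ∈ S ∧ s ++ r ≠ [] ∧
      (∀ p, A.layer p = A.layer a + 1 → A.μ p = a → A.run p (s ++ r) = none) ∧
      (∀ p, A.layer p = A.layer a → A.μ p = A.μ a →
        A.run p (s ++ r) = none ∨ A.run p (s ++ r) = some a) ∧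
      ∀ b b' : B.State, B.run b (s ++ r) = some b' → Dominates A B a b' := by
  have := hA.finite
  obtain ⟨r₁, hr₁⟩ := hret s hs
  -- Only needed to make the final word nonempty.
  obtain ⟨t, ht, hta⟩ := (hA.normal a ha).1 [] a rfl
  obtain ⟨r₂, hr₂⟩ := hret t (by simp [hta])
  -- The goals for the children of `a`, its siblings and the states of `B`. The set `S` will be
  -- either all loops on `a` or the common loops on a pair of states, so only its closure and return
  -- properties are used.
  let P : A.State ⊕ A.State ⊕ B.State → List α → Prop := fun i x =>
    match i with
    | Sum.inl p => A.layer p = A.layer a + 1 → A.μ p = a → A.run p x = none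
    | Sum.inr (Sum.inl p) => A.layer p = A.layer a → A.μ p = A.μ a →
        A.run p x = none ∨ A.run p x = some a
    | Sum.inr (Sum.inr b) => ∀ b' : B.State, B.run b x = some b' → Dominates A B a b'
  have hstab : ∀ i, ∀ x ∈ S, ∀ y ∈ S, P i x → P i (x ++ y) := by
    rintro (p | p | b) x hx y hy h
    · exact fun h1 h2 => run_append_none (h h1 h2) y
    · intro h1 h2
      rcases h h1 h2 with h3 | h3
      · exact Or.inl (run_append_none h3 y)
      · exact Or.inr (by rw [run_append_of h3, hloop y hy])
    · intro b' hb'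
      obtain ⟨b₁, h1, h2⟩ := run_of_append hb'
      exact (h b₁ h1).run (hloop y hy) h2
  have hext : ∀ i, ∀ x ∈ S, ∃ y ∈ S, P i (x ++ y) := by
    rintro (p | p | b) x hx
    · by_cases h1 : A.layer p = A.layer a + 1 ∧ A.μ p = a
      · cases hp : A.run p x with
        | none => exact ⟨x, hx, fun _ _ => run_append_none hp x⟩
        | some p' =>
          have hμ := run_μ hp
          rw [h1.2, hloop x hx] at hμ
          obtain ⟨z, hz1, hz2⟩ := (hA.normal a ha).2 p' ((layer_run hp).trans h1.1)
            (Option.some.inj hμ).symm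
          obtain ⟨r, hr⟩ := hret z hz1
          refine ⟨_, hr, fun _ _ => ?_⟩
          rw [run_append_of hp, run_append_none hz2]
      · exact ⟨x, hx, fun h2 h3 => absurd ⟨h2, h3⟩ h1⟩
    · by_cases h1 : A.layer p = A.layer a ∧ A.μ p = A.μ a
      · obtain ⟨y, hy, h⟩ := hA.exists_sync ha hloop hret h1.1 h1.2 hx
        exact ⟨y, hy, fun _ _ => h⟩
      · exact ⟨x, hx, fun h2 h3 => absurd ⟨h2, h3⟩ h1⟩
    · cases hb : B.run b x with
      | none =>
        refine ⟨x, hx, fun b' hb' => ?_⟩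
        rw [run_append_none hb] at hb'
        cases hb'
      | some b₁ =>
        by_cases hd : Dominates A B a b₁
        · refine ⟨x, hx, fun b' hb' => ?_⟩
          rw [run_append_of hb] at hb'
          exact hd.run (hloop x hx) hb'
        · unfold Dominates at hd
          push Not at hd
          obtain ⟨z, hz1, hz2⟩ := hd
          obtain ⟨r, hr⟩ := hret z hz1
          refine ⟨_, hr, fun b' hb' => ?_⟩
          rw [run_append_of hb, run_append_none hz2] at hb'
          cases hb'
  obtain ⟨y, hy, hP⟩ := exists_forall_append happ hstab hext (happ _ hr₁ _ hr₂)
  have he : s ++ (r₁ ++ (t ++ r₂) ++ y) = s ++ r₁ ++ (t ++ r₂) ++ y := by simp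
  refine ⟨r₁ ++ (t ++ r₂) ++ y, ?_, by simp [ht], ?_⟩
  · rw [he]
    exact happ _ (happ _ hr₁ _ hr₂) _ hy
  · rw [he]
    exact ⟨fun p => hP (Sum.inl p), fun p => hP (Sum.inr (Sum.inl p)),
      fun b => hP (Sum.inr (Sum.inr b))⟩

/-! ### Matching the states of two automata -/

variable (A B)

/-- The state `b` represents the state `a`: on layer `1` they are reached by the same word;
otherwise `b` is below a state that represents the parent of `a`, it is recurrent, all the words
safe from `a` are safe from `b`, and `b` is a deepest such state. -/
inductive Represents : A.State → B.State → Prop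
  | root (u : List α) (a : A.State) (b : B.State) (ha : A.run A.init u = some a)
      (hb : B.run B.init u = some b) : Represents a b
  | child (a : A.State) (b b₀ : B.State) (ha : 2 ≤ A.layer a) (h₀ : Represents (A.μ a) b₀)
      (hab : B.Above b₀ b) (hlt : B.layer b₀ < B.layer b) (hdom : Dominates A B a b)
      (hrec : ∀ s, A.run a s ≠ none →
        ∃ r, A.run a (s ++ r) = some a ∧ B.run b (s ++ r) = some b)
      (hmax : ∀ s a' b' b'', A.run a s = some a' → B.run b s = some b' → B.Above b' b'' →
        B.layer b' < B.layer b'' → ¬ Dominates A B a' b'') : Represents a b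

variable {A B}

namespace Represents

variable {a : A.State} {b : B.State}

theorem child_data (h : Represents A B a b) (ha : 2 ≤ A.layer a) :
    (∃ b₀, Represents A B (A.μ a) b₀ ∧ B.Above b₀ b ∧ B.layer b₀ < B.layer b) ∧
    (∀ s, A.run a s ≠ none → ∃ r, A.run a (s ++ r) = some a ∧ B.run b (s ++ r) = some b) ∧
    (∀ s a' b' b'', A.run a s = some a' → B.run b s = some b' → B.Above b' b'' →
        B.layer b' < B.layer b'' → ¬ Dominates A B a' b'') := by
  cases h with
  | root u _ _ h1 h2 =>
    rw [layer_run h1, A.layer_init] at ha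
    omega
  | child _ _ b₀ ha h₀ hab hlt hdom hrec hmax => exact ⟨⟨b₀, h₀, hab, hlt⟩, hrec, hmax⟩

theorem root_data (h : Represents A B a b) (ha : A.layer a = 1) :
    B.layer b = 1 ∧ ∃ u, A.run A.init u = some a ∧ B.run B.init u = some b := by
  cases h with
  | root u _ _ h1 h2 => exact ⟨(layer_run h2).trans B.layer_init, u, h1, h2⟩
  | child _ _ b₀ ha' h₀ hab hlt hdom hrec hmax => omega

theorem dominates (h : Represents A B a b) : Dominates A B a b := by
  cases h with
  | root u _ _ h1 h2 =>
    intro s _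
    obtain ⟨b', hb'⟩ := run_of_layer_one ((layer_run h2).trans B.layer_init) s
    simp [hb']
  | child _ _ b₀ ha' h₀ hab hlt hdom hrec hmax => exact hdom

theorem exists_word (h : Represents A B a b) :
    ∃ u, A.run A.init u = some (A.root a) ∧ B.run B.init u = some (B.root b) := by
  induction h with
  | root u a b h1 h2 =>
    refine ⟨u, ?_, ?_⟩
    · rw [root_of_layer_one ((layer_run h1).trans A.layer_init), h1]
    · rw [root_of_layer_one ((layer_run h2).trans B.layer_init), h2]
  | child a b b₀ ha h₀ hab hlt hdom hrec hmax ih =>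
    rwa [← root_eq_of_above hab, ← root_eq_of_above (above_μ a)]

/-- Domination and maximality pass to successors. So does recurrence, since a loop on the old pair
followed by `s` ends in the new pair. Hence the representatives are closed under the transitions of
`A`. -/
theorem run (h : Represents A B a b) {s : List α} {a' : A.State} (hs : A.run a s = some a') :
    ∃ b', B.run b s = some b' ∧ Represents A B a' b' := by
  induction h generalizing a' with
  | root u a b h1 h2 =>
    obtain ⟨b', hb'⟩ := run_of_layer_one ((layer_run h2).trans B.layer_init) s
    exact ⟨b', hb', root (u ++ s) _ _ (by rw [run_append_of h1, hs])
      (by rw [run_append_of h2, hb'])⟩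
  | child a b b₀ ha h₀ hab hlt hdom hrec hmax ih =>
    obtain ⟨b₀', hb₀', hrep⟩ := ih (run_μ hs)
    obtain ⟨b', hb', hdom'⟩ := hdom.exists_run hs
    obtain ⟨b₁, hb₁, hab'⟩ := hab.run hb'
    rw [hb₀'] at hb₁
    cases hb₁
    refine ⟨b', hb', child a' b' b₀' ?_ hrep hab' ?_ hdom' ?_ ?_⟩
    · rw [layer_run hs]
      exact ha
    · rw [layer_run hb₀', layer_run hb']
      exact hlt
    · intro t ht
      rw [← run_append_of hs] at ht
      obtain ⟨r, h1, h2⟩ := hrec _ ht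
      refine ⟨r ++ s, ?_, ?_⟩
      · rw [← run_append_of hs, ← List.append_assoc, ← List.append_assoc, run_append_of h1, hs]
      · rw [← run_append_of hb', ← List.append_assoc, ← List.append_assoc, run_append_of h2, hb']
    · intro t a'' b'' b''' h1 h2
      exact hmax (s ++ t) a'' b'' b''' (by rw [run_append_of hs, h1])
        (by rw [run_append_of hb', h2])

theorem exists_iterate (h : Represents A B a b) (k : ℕ) : ∃ b', B.Above b' b ∧
    Represents A B (A.μ^[k] a) b' ∧ (1 ≤ k → 2 ≤ A.layer a → B.layer b' < B.layer b) := by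
  induction k generalizing a b with
  | zero => exact ⟨b, Above.refl b, h, by omega⟩
  | succ k ih =>
    rw [Function.iterate_succ_apply]
    by_cases ha : A.layer a = 1
    · rw [A.μ_root a ha]
      obtain ⟨b', h1, h2, -⟩ := ih h
      exact ⟨b', h1, h2, by omega⟩
    · obtain ⟨⟨b₀, h₀, hab, hlt⟩, -⟩ := h.child_data (by have := A.one_le_layer a; omega)
      obtain ⟨b', h1, h2, -⟩ := ih h₀
      exact ⟨b', h1.trans hab, h2, fun _ _ => h1.layer_le.trans_lt hlt⟩

/-- This uses the common loops on `a` and `b`. A child of `b` that survived would dominate `a`,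
against the maximality of `b`. -/
theorem exists_loop (hA : A.IsCanonical L) [Finite B.State] (h : Represents A B a b)
    (ha : 2 ≤ A.layer a) {s : List α} (hs : A.run a s ≠ none) :
    ∃ r, A.run a (s ++ r) = some a ∧ B.run b (s ++ r) = some b ∧ s ++ r ≠ [] ∧
      (∀ p, A.layer p = A.layer a + 1 → A.μ p = a → A.run p (s ++ r) = none) ∧
      (∀ p, A.layer p = A.layer a → A.μ p = A.μ a →
        A.run p (s ++ r) = none ∨ A.run p (s ++ r) = some a) ∧
      ∀ p, B.layer p = B.layer b + 1 → B.μ p = b → B.run p (s ++ r) = none := by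
  obtain ⟨-, hrec, hmax⟩ := h.child_data ha
  obtain ⟨r, h1, h2, h3, h4, h5⟩ := hA.exists_loop (B := B) ha
    (S := {x | A.run a x = some a ∧ B.run b x = some b})
    (fun x hx y hy => ⟨by rw [run_append_of hx.1, hy.1], by rw [run_append_of hx.2, hy.2]⟩)
    (fun x hx => hx.1) hrec hs
  refine ⟨r, h1.1, h1.2, h2, h3, h4, fun p hl hμ => ?_⟩
  cases hp : B.run p (s ++ r) with
  | none => rfl
  | some p' =>
    have h6 := run_μ hp
    rw [hμ, h1.2] at h6
    exact absurd (h5 p p' hp) (hmax [] a b p' rfl rfl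
      (Option.some.inj h6 ▸ above_μ p') (by rw [layer_run hp]; omega))

theorem even_layer_iff_of_exact (hA : A.IsCanonical L) (hB : B.Consistent) (hBL : B.Recognizes L)
    (h : Represents A B a b) {p : A.State} {q : B.State} (hp : A.root p = A.root a)
    (hq : B.root q = B.root b) {w : Stream' α} (h1 : A.StaysExactly p w)
    (h2 : B.StaysExactly q w) : Even (A.layer p) ↔ Even (B.layer q) := by
  obtain ⟨u, hu1, hu2⟩ := h.exists_word
  rw [h1.even_layer_iff hA.consistent hA.recognizes (hp ▸ hu1),
    h2.even_layer_iff hB hBL (hq ▸ hu2)]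

/-- Below layer `1`, the infinite power of a common loop that kills the children on both sides stays
exactly at `a` and at `b`. The roots are reached by a common word, so `L` decides both parities
alike. -/
theorem even_layer_iff (hA : A.IsCanonical L) [Finite B.State] (hB : B.Consistent)
    (hBL : B.Recognizes L) (h : Represents A B a b) : Even (A.layer a) ↔ Even (B.layer b) := by
  by_cases ha : A.layer a = 1
  · rw [ha, (h.root_data ha).1]
  · obtain ⟨r, h1, h2, h3, h4, -, h6⟩ := h.exists_loop hA
      (by have := A.one_le_layer a; omega) (s := []) (by simp)
    exact h.even_layer_iff_of_exact hA hB hBL rfl rfl (staysExactly_cycle h3 h1 h4)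
      (staysExactly_cycle h3 h2 h6)

/-- Distinct siblings are separated by a word safe from just one of them. A loop that kills the
siblings or moves them to the other one, followed by this word, kills all the children of `A.μ a`.
As loops on `b'` are loops on `b`, it can be arranged to be a loop on `b` killing the children of
`b`. Its infinite power would give the layers of `A.μ a` and `b` equal parity, but `b` has the
parity of `a`. -/
theorem not_above_of_siblings (hA : A.IsCanonical L) [Finite B.State] (hB : B.Consistent)
    (hBL : B.Recognizes L) {a' : A.State} {b' : B.State} (h : Represents A B a b)
    (h' : Represents A B a' b') (ha : 2 ≤ A.layer a) (hl : A.layer a = A.layer a')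
    (hμ : A.μ a = A.μ a') (hne : a ≠ a') : ¬ B.Above b b' := by
  intro hab
  have hlμ := A.layer_μ a ha
  have hstay : ∀ z, B.run b' z = some b' → B.run b z = some b := by
    intro z hz
    obtain ⟨p, hp, hp'⟩ := hab.run hz
    rw [hp, (hp'.of_layer_le hab (layer_run hp).le).eq_of_layer_le (layer_run hp).ge]
  -- a word that is a loop on all the relevant states and that kills all the children
  have hfin : ∀ z, z ≠ [] → A.run (A.μ a) z = some (A.μ a) → B.run b z = some b →
      (∀ p, A.layer p = A.layer a → A.μ p = A.μ a → A.run p z = none) →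
      (∀ p, B.layer p = B.layer b + 1 → B.μ p = b → B.run p z = none) → False := by
    intro z hz h1 h2 h3 h4
    have h5 := staysExactly_cycle hz h1 fun p hp => h3 p (by omega)
    have h6 := staysExactly_cycle hz h2 h4
    have h7 := h.even_layer_iff_of_exact hA hB hBL (root_eq_of_above (above_μ a)) rfl h5 h6
    have h8 := h.even_layer_iff hA hB hBL
    rw [← h7, ← hlμ, Nat.even_add_one] at h8
    exact (not_iff_self) h8
  obtain ⟨s, hs⟩ : ∃ s, ¬ (A.run a s ≠ none ↔ A.run a' s ≠ none) := by
    by_contra hno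
    push Not at hno
    exact hne (eq_of_siblings hA.consistent hA.safeMinimal hl hμ fun s => by
      have := hno s
      tauto)
  by_cases hsa : A.run a s = none
  · have hsa' : A.run a' s ≠ none := by tauto
    obtain ⟨r, h1, h2, h3, -, h5, h6⟩ := h.exists_loop hA ha (s := []) (by simp)
    obtain ⟨r', h1', h2', -⟩ := h'.exists_loop hA (hl ▸ ha) hsa'
    refine hfin ([] ++ r ++ (s ++ r')) (by simp_all) ?_ ?_ ?_ ?_
    · rw [run_append_of (run_μ h1), hμ, run_μ h1']
    · rw [run_append_of h2, hstay _ h2']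
    · intro p hp hp'
      rcases h5 p hp hp' with h7 | h7
      · exact run_append_none h7 _
      · rw [run_append_of h7, run_append_none hsa]
    · exact fun p hp hp' => run_append_none (h6 p hp hp') _
  · have hsa' : A.run a' s = none := by tauto
    obtain ⟨r, h1, h2, h3, -, h5, h6⟩ := h.exists_loop hA ha hsa
    obtain ⟨r', h1', h2', -, -, h5', -⟩ := h'.exists_loop hA (hl ▸ ha) (s := []) (by simp)
    refine hfin ([] ++ r' ++ (s ++ r)) (by simp_all) ?_ ?_ ?_ ?_
    · rw [hμ, run_append_of (run_μ h1'), ← hμ, run_μ h1]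
    · rw [run_append_of (hstay _ h2'), h2]
    · intro p hp hp'
      rcases h5' p (hp.trans hl) (hp'.trans hμ) with h7 | h7
      · exact run_append_none h7 _
      · rw [run_append_of h7, run_append_none hsa']
    · intro p hp hp'
      cases h7 : B.run p ([] ++ r') with
      | none => exact run_append_none h7 _
      | some q =>
        have h8 := run_μ h7
        rw [hp', hstay _ h2'] at h8
        rw [run_append_of h7]
        exact h6 q ((layer_run h7).trans hp) (Option.some.inj h8).symm

/-- Comparable representatives of states on the same layer are equal. -/
theorem eq_of_above (hA : A.IsCanonical L) [Finite B.State] (hB : B.Consistent)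
    (hBL : B.Recognizes L) {a' : A.State} {b' : B.State} (h : Represents A B a b)
    (h' : Represents A B a' b') (hl : A.layer a = A.layer a') (hab : B.Above b b') :
    a = a' ∧ b = b' := by
  obtain ⟨x, hx⟩ : ∃ x, x = A.layer a := ⟨_, rfl⟩
  induction x using Nat.strong_induction_on generalizing a a' b b' with
  | _ x ih =>
    by_cases ha : A.layer a = 1
    · obtain ⟨hb, u, h1, h2⟩ := h.root_data ha
      obtain ⟨hb', u', h1', h2'⟩ := h'.root_data (hl ▸ ha)
      have hbb : b = b' := hab.eq_of_layer_le (by omega)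
      subst hbb
      refine ⟨hA.safeMinimal a a' hl ⟨?_, by omega⟩, rfl⟩
      ext w
      rw [← root_of_layer_one ha] at h1
      rw [← root_of_layer_one (hl.symm.trans ha)] at h1'
      rw [← root_of_layer_one hb] at h2 h2'
      rw [mem_stateLanguage_iff_mem hA.consistent hA.recognizes h1,
        mem_stateLanguage_iff_mem hA.consistent hA.recognizes h1',
        ← mem_stateLanguage_iff_mem hB hBL h2, ← mem_stateLanguage_iff_mem hB hBL h2']
    · have ha2 : 2 ≤ A.layer a := by
        have := A.one_le_layer a
        omega
      obtain ⟨⟨b₀, h₀, hab₀, hlt₀⟩, -, hmax⟩ := h.child_data ha2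
      obtain ⟨⟨b₀', h₀', hab₀', hlt₀'⟩, -, -⟩ := h'.child_data (hl ▸ ha2)
      have h1 := A.layer_μ a ha2
      have h2 := A.layer_μ a' (hl ▸ ha2)
      -- The representatives of the two parents are both ancestors of `b'`, hence comparable, and
      -- the induction hypothesis applies to them.
      have hμ : A.μ a = A.μ a' := by
        rcases le_total (B.layer b₀) (B.layer b₀') with hle | hle
        · exact (ih (A.layer (A.μ a)) (by omega) h₀ h₀' (by omega)
            ((hab₀.trans hab).of_layer_le hab₀' hle) rfl).1
        · exact (ih (A.layer (A.μ a')) (by omega) h₀' h₀ (by omega)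
            (hab₀'.of_layer_le (hab₀.trans hab) hle) rfl).1.symm
      by_cases hne : a = a'
      · subst hne
        refine ⟨rfl, ?_⟩
        by_contra hbb
        have hlt : B.layer b < B.layer b' := by
          by_contra hle
          exact hbb (hab.eq_of_layer_le (not_lt.mp hle))
        exact hmax [] a b b' rfl rfl hab hlt h'.dominates
      · exact absurd hab (h.not_above_of_siblings hA hB hBL h' ha2 hl hμ hne)

/-- Comparable representatives represent comparable states. -/
theorem above (hA : A.IsCanonical L) [Finite B.State] (hB : B.Consistent)
    (hBL : B.Recognizes L) {a' : A.State} {b' : B.State} (h : Represents A B a b)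
    (h' : Represents A B a' b') (hab : B.Above b b') : A.Above a a' := by
  have h1 := A.one_le_layer a
  have h2 := A.one_le_layer a'
  rcases le_or_gt (A.layer a) (A.layer a') with hl | hl
  · obtain ⟨c, hc, hrep, -⟩ := h'.exists_iterate (A.layer a' - A.layer a)
    have hlay : A.layer (A.μ^[A.layer a' - A.layer a] a') = A.layer a := by
      rw [layer_iterate']
      omega
    rcases le_total (B.layer b) (B.layer c) with hle | hle
    · rw [(h.eq_of_above hA hB hBL hrep hlay.symm (hab.of_layer_le hc hle)).1]
      exact ⟨_, rfl⟩
    · rw [← (hrep.eq_of_above hA hB hBL h hlay (hc.of_layer_le hab hle)).1]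
      exact ⟨_, rfl⟩
  · obtain ⟨c, hc, hrep, hlt⟩ := h.exists_iterate (A.layer a - A.layer a')
    have hlay : A.layer (A.μ^[A.layer a - A.layer a'] a) = A.layer a' := by
      rw [layer_iterate']
      omega
    have heq := (hrep.eq_of_above hA hB hBL h' hlay (hc.trans hab)).2
    have h3 := hlt (by omega) (by omega)
    have h4 := hab.layer_le
    rw [heq] at h3
    omega

theorem left_unique (hA : A.IsCanonical L) [Finite B.State] (hB : B.Consistent)
    (hBL : B.Recognizes L) {a' : A.State} (h : Represents A B a b) (h' : Represents A B a' b) :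
    a = a' := by
  have h1 := h.above hA hB hBL h' (Above.refl b)
  have h2 := h'.above hA hB hBL h (Above.refl b)
  exact h1.eq_of_layer_le h2.layer_le

end Represents

/-! ### Existence of representatives and the cardinality bounds. -/

/-- Every pair of states with comparable safe words leads to a recurrent pair. -/
theorem exists_recurrent [Finite A.State] [Finite B.State] {a : A.State} {b : B.State}
    (h : Dominates A B a b) : ∃ s a' b', A.run a s = some a' ∧ B.run b s = some b' ∧
      ∀ t, A.run a' t ≠ none →
        ∃ r, A.run a' (t ++ r) = some a' ∧ B.run b' (t ++ r) = some b' := by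
  -- The pairs reachable from a pair. If this set is minimal for inclusion, the pair can be reached
  -- again from all its successors.
  let R : A.State × B.State → Set (A.State × B.State) := fun x =>
    {y | ∃ s, A.run x.1 s = some y.1 ∧ B.run x.2 s = some y.2}
  obtain ⟨_, ⟨y, ⟨s, hs1, hs2⟩, rfl⟩, hmin⟩ :=
    (wellFounded_lt : WellFounded ((· < ·) : Set (A.State × B.State) → _ → Prop)).has_min
      (R '' R (a, b)) ⟨_, (a, b), ⟨[], rfl, rfl⟩, rfl⟩
  refine ⟨s, y.1, y.2, hs1, hs2, fun t ht => ?_⟩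
  obtain ⟨a', ha'⟩ := Option.ne_none_iff_exists'.mp ht
  obtain ⟨b', hb', -⟩ := (h.run hs1 hs2).exists_run ha'
  have hsub : R (a', b') ⊆ R y := by
    rintro z ⟨r, hr1, hr2⟩
    exact ⟨t ++ r, by rw [run_append_of ha', hr1], by rw [run_append_of hb', hr2]⟩
  have hmem : y ∈ R (a', b') := by
    by_contra hy
    refine hmin (R (a', b')) ⟨(a', b'), ⟨s ++ t, ?_, ?_⟩, rfl⟩ ⟨hsub, fun hle => hy (hle ?_)⟩
    · rw [run_append_of hs1, ha']
    · rw [run_append_of hs2, hb']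
    · exact ⟨[], rfl, rfl⟩
  obtain ⟨r, hr1, hr2⟩ := hmem
  exact ⟨r, by rw [run_append_of ha', hr1], by rw [run_append_of hb', hr2]⟩

/-- The infinite power of a loop `z` on `a` that kills the children of `a` stays exactly at `a`. The
parity of this layer differs from that of `A.μ a`, hence from that of `b`, so the word does not stay
exactly at `b`. Some state strictly below a successor of `b` thus survives the rest of it and, after
reading `z`, dominates `a`. Choosing such a state as deep as possible and continuing to a recurrent
pair gives a representative of a successor of `a`. -/
theorem Represents.exists_child (hA : A.IsCanonical L) [Finite B.State] (hB : B.Consistent)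
    (hBL : B.Recognizes L) {a : A.State} {b : B.State} (ha : 2 ≤ A.layer a)
    (h : Represents A B (A.μ a) b) :
    ∃ s a' b', A.run a s = some a' ∧ Represents A B a' b' := by
  have := hA.finite
  have hlμ := A.layer_μ a ha
  obtain ⟨z, hz, hz0, hkill, -, hdom⟩ := hA.exists_loop (B := B) ha
    (S := {x | A.run a x = some a})
    (fun x hx y hy => by
      change A.run a (x ++ y) = some a
      rw [run_append_of hx]
      exact hy)
    (fun x hx => hx)
    (fun s hs => by
      obtain ⟨q, hq⟩ := Option.ne_none_iff_exists'.mp hs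
      obtain ⟨t, -, ht⟩ := (hA.normal a ha).1 s q hq
      exact ⟨t, by rw [Set.mem_ofPred_eq, run_append_of hq, ht]⟩)
    (s := []) (by simp)
  rw [List.nil_append] at hz hz0 hkill hdom
  have hexA := staysExactly_cycle hz0 hz hkill
  have hlive : B.Live b (Stream'.cycle z hz0) :=
    h.dominates.live (hexA.live.above (above_μ a))
  have hnot : ¬ B.StaysExactly b (Stream'.cycle z hz0) := by
    intro hex
    have h1 := h.even_layer_iff_of_exact hA hB hBL
      (root_eq_of_above (above_μ a)).symm rfl hexA hex
    rw [← h.even_layer_iff hA hB hBL, ← hlμ, Nat.even_add_one] at h1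
    exact not_iff_self h1
  let X : B.State → Prop := fun b' => ∃ s a' b₁, A.run a s = some a' ∧ B.run b s = some b₁ ∧
    B.Above b₁ b' ∧ B.layer b₁ < B.layer b' ∧ Dominates A B a' b'
  have hX : ∃ b', X b' := by
    rw [staysExactly_iff] at hnot
    push Not at hnot
    obtain ⟨s, w', p, hs, hl, hr, hp⟩ := hnot hlive
    obtain ⟨k, t, hk, rfl⟩ := cycle_split hs
    rw [Stream'.cycle_eq, ← Stream'.append_append_stream] at hp
    obtain ⟨p', hp', -⟩ := hp.exists_run
    have h1 : B.run b (rep z k ++ z) = some (B.μ p') := by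
      rw [hk, List.append_assoc, run_append_of hr, run_μ hp']
    refine ⟨p', rep z k ++ z, a, B.μ p', ?_, h1, above_μ p', ?_, ?_⟩
    · rw [run_append_of (run_rep hz k), hz]
    · rw [layer_run h1, layer_run hp', hl]
      exact Nat.lt_succ_self _
    · obtain ⟨p₁, -, hp₁⟩ := run_of_append hp'
      exact hdom p₁ p' hp₁
  obtain ⟨c, ⟨s, a', b₁, h1, h2, h3, h4, h5⟩, hmax⟩ :
      ∃ c, X c ∧ ∀ c', X c' → B.layer c' ≤ B.layer c := by
    obtain ⟨c, hc, hm⟩ := Set.exists_max_image {c | X c} B.layer (Set.toFinite _) hX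
    exact ⟨c, hc, hm⟩
  obtain ⟨t, a'', c', h6, h7, hrec⟩ := exists_recurrent h5
  obtain ⟨b₂, h8, h9⟩ := h3.run h7
  have h10 : A.run a (s ++ t) = some a'' := by rw [run_append_of h1, h6]
  have h11 : B.run b (s ++ t) = some b₂ := by rw [run_append_of h2, h8]
  obtain ⟨b₃, h12, h13⟩ := h.run (run_μ h10)
  rw [h11] at h12
  cases h12
  refine ⟨s ++ t, a'', c', h10, .child a'' c' b₂ ?_ h13 h9 ?_ (h5.run h6 h7) hrec ?_⟩
  · rw [layer_run h10]
    exact ha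
  · rw [layer_run h8, layer_run h7]
    exact h4
  · intro r a₃ c₁ c₂ h14 h15 h16 h17 h18
    obtain ⟨b₄, h19, h20⟩ := h9.run h15
    have h21 := hmax c₂ ⟨s ++ t ++ r, a₃, b₄, by rw [run_append_of h10, h14],
      by rw [run_append_of h11, h19], h20.trans h16, h20.layer_le.trans_lt h17, h18⟩
    have h22 := layer_run h15
    have h23 := layer_run h7
    omega

/-- Induction on the layer. N1 leads from the represented successor given by
`Represents.exists_child` back to `a`. -/
theorem exists_represents (hA : A.IsCanonical L) [Finite B.State] (hB : B.Consistent)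
    (hBL : B.Recognizes L) (a : A.State) : ∃ b, Represents A B a b := by
  obtain ⟨x, hx⟩ : ∃ x, x = A.layer a := ⟨_, rfl⟩
  induction x generalizing a with
  | zero =>
    have := A.one_le_layer a
    omega
  | succ x ih =>
    by_cases ha : A.layer a = 1
    · obtain ⟨u, hu⟩ := A.reachable a ha
      obtain ⟨b, hb⟩ := run_of_layer_one B.layer_init u
      exact ⟨b, .root u a b hu hb⟩
    · have ha2 : 2 ≤ A.layer a := by
        have := A.one_le_layer a
        omega
      obtain ⟨b, hb⟩ := ih (A.μ a) (by have := A.layer_μ a ha2; omega)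
      obtain ⟨s, a', b', h1, h2⟩ := hb.exists_child hA hB hBL ha2
      obtain ⟨t, -, ht⟩ := (hA.normal a ha2).1 s a' h1
      obtain ⟨b'', -, h3⟩ := h2.run ht
      exact ⟨b'', h3⟩

theorem IsCanonical.card_le (hA : A.IsCanonical L) [Finite B.State] (hB : B.Consistent)
    (hBL : B.Recognizes L) : Nat.card A.State ≤ Nat.card B.State := by
  choose g hg using exists_represents hA hB hBL
  exact Nat.card_le_card_of_injective g fun a a' h =>
    (hg a).left_unique hA hB hBL (h ▸ hg a')

theorem IsLeaf.eq_of_above {p q : A.State} (hp : A.IsLeaf p) (h : A.Above p q) : p = q := by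
  obtain ⟨k, rfl⟩ := h
  induction k with
  | zero => rfl
  | succ k ih =>
    rw [Function.iterate_succ_apply'] at hp ⊢
    by_cases hl : A.layer (A.μ^[k] q) = 1
    · rw [A.μ_root _ hl] at hp ⊢
      exact ih hp
    · have := A.one_le_layer (A.μ^[k] q)
      exact absurd rfl (hp _ (by omega))

/-- Two representatives above a common leaf are comparable, hence so are the leaves they represent,
and comparable leaves are equal. -/
theorem IsCanonical.card_semantics_le (hA : A.IsCanonical L) [Finite B.State]
    (hB : B.Consistent) (hBL : B.Recognizes L) :
    Nat.card A.semantics.State ≤ Nat.card B.semantics.State := by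
  choose g hg using exists_represents hA hB hBL
  choose leaf hleaf using exists_semantics_leaf (A := B)
  have : Finite B.semantics.State := inferInstanceAs (Finite {q : B.State // B.IsLeaf q})
  refine Nat.card_le_card_of_injective (fun ℓ => leaf (g ℓ.1)) fun ℓ ℓ' h => Subtype.ext ?_
  have h1 := hleaf (g ℓ.1)
  have h2 := hleaf (g ℓ'.1)
  change leaf (g ℓ.1) = leaf (g ℓ'.1) at h
  rw [← h] at h2
  rcases le_total (B.layer (g ℓ.1)) (B.layer (g ℓ'.1)) with hle | hle
  · exact ℓ.2.eq_of_above ((hg _).above hA hB hBL (hg _) (h1.of_layer_le h2 hle))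
  · exact (ℓ'.2.eq_of_above ((hg _).above hA hB hBL (hg _) (h2.of_layer_le h1 hle))).symm

end LayeredAutomaton

end LayeredAutomata

/-! ### The subautomaton of representatives and the isomorphism of canonical automata. -/

namespace LayeredAutomata

/-- The two sums bound each other, so no termwise inequality is strict. This turns inequalities
obtained in both directions into equalities, for layers and for numbers of transitions. -/
theorem eq_of_le_of_le_equiv {X Y : Type*} [Finite X] [Finite Y] {f : X → ℕ} {f' : Y → ℕ}
    (g : X ≃ Y) (h : Y ≃ X) (hg : ∀ x, f x ≤ f' (g x)) (hh : ∀ y, f' y ≤ f (h y)) (x : X) :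
    f x = f' (g x) := by
  cases nonempty_fintype X
  cases nonempty_fintype Y
  have h1 : ∑ x, f x = ∑ x, f' (g x) := by
    apply le_antisymm (Finset.sum_le_sum fun x _ => hg x)
    rw [Equiv.sum_comp g f', ← Equiv.sum_comp h f]
    exact Finset.sum_le_sum fun y _ => hh y
  exact (Finset.sum_eq_sum_iff_of_le fun x _ => hg x).mp h1 x (Finset.mem_univ x)

namespace LayeredAutomaton

variable {α : Type u} {A : LayeredAutomaton.{u, v} α} {B : LayeredAutomaton.{u, w} α}
  {L : Set (Stream' α)}

/-- The states of `B` that represent a state of the canonical automaton `A` form a subautomaton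
of `B`, with a surjective strong morphism to `A`. -/
theorem IsCanonical.exists_subautomaton (hA : A.IsCanonical L) [Finite B.State]
    (hB : B.Consistent) (hBL : B.Recognizes L) :
    ∃ C : LayeredAutomaton.{u, w} α, C.IsSubautomaton B ∧
      ∃ φ : C.State → A.State, Function.Surjective φ ∧ C.IsStrongMorphism A φ := by
  let S := {b : B.State // ∃ a, Represents A B a b}
  let φ : S → A.State := fun b => b.2.choose
  have hφ : ∀ b : S, Represents A B (φ b) b.1 := fun b => b.2.choose_spec
  have huniq : ∀ (b : S) (a : A.State), Represents A B a b.1 → φ b = a :=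
    fun b a h => (hφ b).left_unique hA hB hBL h
  have hpar : ∀ b : S, ∃ b₀ : S, B.Above b₀.1 b.1 ∧ φ b₀ = A.μ (φ b) := by
    intro b
    obtain ⟨b', h1, h2, -⟩ := (hφ b).exists_iterate 1
    exact ⟨⟨b', _, h2⟩, h1, huniq _ _ h2⟩
  choose π hπ1 hπ2 using hpar
  have hπ : ∀ b b₀ : S, B.Above b₀.1 b.1 → φ b₀ = A.μ (φ b) → π b = b₀ := by
    intro b b₀ h1 h2
    have hl : A.layer (φ (π b)) = A.layer (φ b₀) := by rw [hπ2, h2]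
    apply Subtype.ext
    rcases le_total (B.layer (π b).1) (B.layer b₀.1) with hle | hle
    · exact ((hφ _).eq_of_above hA hB hBL (hφ _) hl ((hπ1 b).of_layer_le h1 hle)).2
    · exact ((hφ _).eq_of_above hA hB hBL (hφ _) hl.symm (h1.of_layer_le (hπ1 b) hle)).2.symm
  -- A transition of `B` is kept only where the represented state has one. This is what makes `φ`
  -- strong.
  have hδ : ∀ (b : S) (a : α), ∃ o : Option S, (A.δ (φ b) a = none → o = none) ∧
      ∀ p, A.δ (φ b) a = some p → ∃ s : S, o = some s ∧ B.δ b.1 a = some s.1 ∧ φ s = p := by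
    intro b a
    cases h : A.δ (φ b) a with
    | none => exact ⟨none, fun _ => rfl, fun p hp => by cases hp⟩
    | some p =>
      rw [← run_singleton] at h
      obtain ⟨b', h1, h2⟩ := (hφ b).run h
      refine ⟨some ⟨b', p, h2⟩, nofun, fun p' hp' => ?_⟩
      cases hp'
      exact ⟨_, rfl, by rw [← run_singleton, h1], huniq _ _ h2⟩
  choose δ hδn hδs using hδ
  have hδ' : ∀ b a b', δ b a = some b' → A.δ (φ b) a = some (φ b') ∧ B.δ b.1 a = some b'.1 := by
    intro b a b' h
    cases hp : A.δ (φ b) a with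
    | none =>
      rw [hδn b a hp] at h
      cases h
    | some p =>
      obtain ⟨s, h1, h2, h3⟩ := hδs b a p hp
      rw [h1] at h
      cases h
      exact ⟨by rw [h3], h2⟩
  let i : S := ⟨B.init, A.init, .root [] _ _ rfl rfl⟩
  have hi : φ i = A.init := huniq _ _ (.root [] _ _ rfl rfl)
  have hreach : ∀ (s : List α) (b : S) (b' : B.State), A.layer (φ b) = 1 →
      B.run b.1 s = some b' → ∃ r : S, r.1 = b' ∧ s.foldlM δ b = some r := by
    intro s
    induction s with
    | nil =>
      intro b b' _ h
      exact ⟨b, Option.some.inj h, rfl⟩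
    | cons a s ih =>
      intro b b' hl h
      obtain ⟨p, hp⟩ := A.complete (φ b) hl a
      obtain ⟨r, h1, h2, h3⟩ := hδs b a p hp
      rw [← List.singleton_append, run_append_of (q' := r.1) (by rw [run_singleton, h2])] at h
      obtain ⟨r', h4, h5⟩ := ih r b' (by rw [h3, A.layer_δ _ _ _ hp, hl]) h
      refine ⟨r', h4, ?_⟩
      rw [List.foldlM_cons, h1]
      exact h5
  -- The layers are those of `A`: a parent in `C` may lie several layers up in `B`, so the inclusion
  -- into `B` may change layers.
  let C : LayeredAutomaton.{u, w} α :=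
    { State := S
      depth := A.depth
      layer := fun b => A.layer (φ b)
      one_le_layer := fun b => A.one_le_layer _
      layer_le_depth := fun b => A.layer_le_depth _
      δ := δ
      layer_δ := fun b a b' h => A.layer_δ _ _ _ (hδ' b a b' h).1
      μ := π
      layer_μ := fun b h => by rw [hπ2, A.layer_μ _ h]
      μ_root := fun b h => hπ b b (Above.refl _) (A.μ_root _ h).symm
      μ_δ := fun b a b' h => by
        obtain ⟨h1, h2⟩ := hδ' b a b' h
        have h3 := A.μ_δ _ _ _ h1
        rw [← hπ2] at h3
        obtain ⟨s, h4, h5, h6⟩ := hδs _ a _ h3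
        rw [← run_singleton] at h2 h5
        obtain ⟨p, h7, h8⟩ := (hπ1 b).run h2
        rw [h5] at h7
        cases h7
        rw [h4, hπ b' s h8 h6]
      init := i
      layer_init := by rw [hi, A.layer_init]
      complete := fun b h a => by
        obtain ⟨p, hp⟩ := A.complete _ h a
        obtain ⟨s, hs, -⟩ := hδs b a p hp
        exact ⟨s, hs⟩
      reachable := fun b h => by
        obtain ⟨-, u, -, hu⟩ := (hφ b).root_data h
        obtain ⟨r, h1, h2⟩ := hreach u i b.1 (by rw [hi, A.layer_init]) hu
        exact ⟨u, by rw [h2, Subtype.ext h1]⟩ }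
  refine ⟨C, ⟨fun b => b.1, Subtype.val_injective, rfl, fun b a b' h => (hδ' b a b' h).2,
    fun p q h => ?_⟩, φ, fun a => ?_, ⟨hi, fun b a b' h => (hδ' b a b' h).1, fun p q h => ?_⟩,
    fun b a h => ?_⟩
  · rw [isAncestor_iff] at h ⊢
    obtain ⟨k, rfl⟩ := h
    induction k with
    | zero => exact Above.refl _
    | succ k ih =>
      rw [Function.iterate_succ_apply']
      exact (hπ1 _).trans ih
  · obtain ⟨b, hb⟩ := exists_represents hA hB hBL a
    exact ⟨⟨b, a, hb⟩, huniq _ _ hb⟩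
  · rw [isAncestor_iff] at h ⊢
    obtain ⟨k, rfl⟩ := h
    induction k with
    | zero => exact Above.refl _
    | succ k ih =>
      rw [Function.iterate_succ_apply']
      have h1 : φ (C.μ (C.μ^[k] q)) = A.μ (φ (C.μ^[k] q)) := hπ2 _
      rw [h1]
      exact (above_μ _).trans ih
  · cases hp : A.δ (φ b) a with
    | none => rfl
    | some p =>
      obtain ⟨s, hs, -⟩ := hδs b a p hp
      change δ b a = none at h
      rw [h] at hs
      cases hs

/-- Under the bound on the cardinality the injective choice of representatives is bijective, so each
state has just one representative. Layers can only increase, because the representative of the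
parent lies strictly above. -/
theorem IsCanonical.exists_equiv (hA : A.IsCanonical L) [Finite B.State] (hB : B.Consistent)
    (hBL : B.Recognizes L) (hcard : Nat.card B.State ≤ Nat.card A.State) :
    ∃ g : A.State ≃ B.State, g A.init = B.init ∧ (∀ a, A.layer a ≤ B.layer (g a)) ∧
      (∀ a x a', A.δ a x = some a' → B.δ (g a) x = some (g a')) ∧
      ∀ a, B.Above (g (A.μ a)) (g a) := by
  have := hA.finite
  choose g hg using exists_represents hA hB hBL
  have hinj : Function.Injective g := fun a a' h =>
    (hg a).left_unique hA hB hBL (h ▸ hg a')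
  have hbij : Function.Bijective g :=
    hinj.bijective_of_nat_card_le hcard
  have huniq : ∀ a b, Represents A B a b → b = g a := by
    intro a b h
    obtain ⟨a', rfl⟩ := hbij.2 b
    rw [h.left_unique hA hB hBL (hg a')]
  refine ⟨Equiv.ofBijective g hbij, (huniq _ _ (.root [] _ _ rfl rfl)).symm, fun a => ?_,
    fun a x a' h => ?_, fun a => ?_⟩
  · change A.layer a ≤ B.layer (g a)
    obtain ⟨x, hx⟩ : ∃ x, x = A.layer a := ⟨_, rfl⟩
    induction x generalizing a with
    | zero => omega
    | succ x ih =>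
      by_cases ha : A.layer a = 1
      · rw [ha]
        exact B.one_le_layer _
      · have h2 : 2 ≤ A.layer a := by
          have := A.one_le_layer a
          omega
        obtain ⟨⟨b₀, h₀, -, hlt⟩, -⟩ := (hg a).child_data h2
        have h3 := A.layer_μ a h2
        have h4 := ih (A.μ a) (by omega)
        rw [← huniq _ _ h₀] at h4
        omega
  · rw [← run_singleton] at h ⊢
    obtain ⟨b', h1, h2⟩ := (hg a).run h
    rw [huniq _ _ h2] at h1
    exact h1
  · obtain ⟨b', h1, h2, -⟩ := (hg a).exists_iterate 1
    rw [huniq _ _ h2] at h1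
    exact h1

/-- Finite consistent automata for the same language with all the normalisation properties are
isomorphic. -/
theorem IsCanonical.isomorphic (hA : A.IsCanonical L) (hB : B.IsCanonical L) :
    A.Isomorphic B := by
  have := hA.finite
  have := hB.finite
  obtain ⟨g, hg1, hg2, hg3, hg4⟩ := hA.exists_equiv hB.consistent hB.recognizes
    (hB.card_le hA.consistent hA.recognizes)
  obtain ⟨h, -, hh2, hh3, -⟩ := hB.exists_equiv hA.consistent hA.recognizes
    (hA.card_le hB.consistent hB.recognizes)
  have hlayer : ∀ a, A.layer a = B.layer (g a) := eq_of_le_of_le_equiv g h hg2 hh2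
  refine ⟨g, hg1, fun a => (hlayer a).symm, fun a x => ?_, fun a => ?_⟩
  · classical
    cases ha : A.δ a x with
    | some a' => exact hg3 a x a' ha
    | none =>
      -- Indicators of a defined `x`-transition. Neither bijection loses transitions, so none is
      -- gained either.
      have key := eq_of_le_of_le_equiv (f := fun a => if A.δ a x = none then 0 else 1)
        (f' := fun b => if B.δ b x = none then 0 else 1) g h (fun a => by
          cases h1 : A.δ a x with
          | none => simp
          | some a' => simp [hg3 a x a' h1]) (fun b => by
          cases h1 : B.δ b x with
          | none => simp
          | some b' => simp [hh3 b x b' h1]) a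
      by_contra hb
      have hb' : B.δ (g a) x ≠ none := hb
      simp [ha, hb'] at key
  · by_cases ha : A.layer a = 1
    · rw [A.μ_root a ha, B.μ_root _ ((hlayer a).symm.trans ha)]
    · have h2 : 2 ≤ A.layer a := by
        have := A.one_le_layer a
        omega
      have h3 := A.layer_μ a h2
      have h4 := B.layer_μ (g a) (hlayer a ▸ h2)
      have h5 := hlayer a
      have h6 := hlayer (A.μ a)
      exact (((above_μ _).of_layer_le (hg4 a) (by omega)).eq_of_layer_le (by omega))

end LayeredAutomaton

end LayeredAutomata

/-! ### Ultimately periodic words and the priorities of a deterministic parity automaton. -/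

namespace LayeredAutomata

theorem exists_frequently_eq {K : Type*} [Finite K] (κ : ℕ → K) : ∃ v, ∃ᶠ n in atTop, κ n = v := by
  by_contra hno
  push Not at hno
  have h : ∀ᶠ n in atTop, ∀ v, κ n ≠ v := eventually_all.mpr fun v => by simpa using hno v
  obtain ⟨n, hn⟩ := h.exists
  exact hn _ rfl

theorem parityCondition_shift (c : ℕ → ℕ) (k : ℕ) :
    ParityCondition (fun n => c (k + n)) ↔ ParityCondition c := by
  have h : ∀ P : ℕ → Prop, (∀ᶠ n in atTop, P (c (k + n))) ↔ ∀ᶠ n in atTop, P (c n) := by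
    intro P
    conv_rhs => rw [← map_add_atTop_eq_nat k, eventually_map]
    simp only [Nat.add_comm]
  have h' : ∀ P : ℕ → Prop, (∃ᶠ n in atTop, P (c (k + n))) ↔ ∃ᶠ n in atTop, P (c n) :=
    fun P => not_congr (h fun y => ¬ P y)
  exact exists_congr fun x => and_congr_right fun _ => and_congr (h (x ≤ ·)) (h' (· = x))

section Loops

variable {α : Type u} (L : Set (Stream' α))

/-- The two words have the same residual language. -/
def ResEq (x y : List α) : Prop := ∀ w : Stream' α, x ++ₛ w ∈ L ↔ y ++ₛ w ∈ L

/-- The ultimately periodic word `x z z z …` is in `L`. -/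
def LoopIn (x z : List α) : Prop := ∃ h : z ≠ [], x ++ₛ Stream'.cycle z h ∈ L

variable {L}

theorem loopIn_iff {x z : List α} (h : z ≠ []) : LoopIn L x z ↔ x ++ₛ Stream'.cycle z h ∈ L :=
  ⟨fun h' => h'.2, fun h' => ⟨h, h'⟩⟩

theorem ResEq.refl (x : List α) : ResEq L x x := fun _ => Iff.rfl

theorem ResEq.trans {x y z : List α} (h : ResEq L x y) (h' : ResEq L y z) : ResEq L x z :=
  fun w => (h w).trans (h' w)

theorem ResEq.append {x y : List α} (h : ResEq L x y) (s : List α) :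
    ResEq L (x ++ s) (y ++ s) := fun w => by
  rw [Stream'.append_append_stream, Stream'.append_append_stream]
  exact h _

theorem ResEq.rep {x z : List α} (h : ResEq L (x ++ z) x) (k : ℕ) :
    ResEq L (x ++ rep z k) x := by
  induction k with
  | zero => simpa [LayeredAutomata.rep] using ResEq.refl x
  | succ k ih =>
    rw [LayeredAutomata.rep, ← List.append_assoc]
    exact (h.append _).trans ih

theorem ResEq.loopIn_iff {x y : List α} (h : ResEq L x y) (z : List α) :
    LoopIn L x z ↔ LoopIn L y z :=
  exists_congr fun _ => h _

theorem loopIn_rep {x z : List α} {k : ℕ} (hk : 1 ≤ k) : LoopIn L x (rep z k) ↔ LoopIn L x z := by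
  by_cases hz : z = []
  · subst hz
    have : rep ([] : List α) k = [] := by
      apply List.eq_nil_of_length_eq_zero
      simp [length_rep]
    rw [this]
  · rw [loopIn_iff hz, loopIn_iff (rep_ne_nil hz hk),
      eq_cycle (rep_ne_nil hz hk) (cycle_eq_rep z hz k)]

/-- Conjugation of a loop. -/
theorem loopIn_append_comm {x y z : List α} : LoopIn L x (y ++ z) ↔ LoopIn L (x ++ y) (z ++ y) := by
  by_cases hz : y ++ z = []
  · simp at hz
    simp [hz]
  · have hz' : z ++ y ≠ [] := by
      intro h
      simp at h hz
      exact hz h.2 h.1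
    rw [loopIn_iff hz, loopIn_iff hz', Stream'.append_append_stream]
    have : y ++ₛ Stream'.cycle (z ++ y) hz' = Stream'.cycle (y ++ z) hz := by
      apply eq_cycle
      conv_lhs => rw [Stream'.cycle_eq]
      simp only [Stream'.append_append_stream]
    rw [this]

end Loops

namespace DetParityAutomaton

variable {α : Type u} {Q : Type v} (D : DetParityAutomaton α Q)

/-- The state reached from `e` by a finite word. -/
def goes (e : Q) (s : List α) : Q := s.foldl D.next e

/-- The sequence of priorities on an infinite word. -/
def pr (e : Q) (w : Stream' α) (n : ℕ) : ℕ := D.prio (D.goes e (w.take n)) (w.get n)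

/-- The language accepted from the state `e`. -/
def langFrom (e : Q) : Set (Stream' α) := {w | ParityCondition (D.pr e w)}

/-- The priority `c` occurs on a finite word. -/
def Sees (e : Q) : List α → ℕ → Prop
  | [], _ => False
  | a :: s, c => D.prio e a = c ∨ Sees (D.next e a) s c

variable {D}

theorem goes_append (e : Q) (s t : List α) : D.goes e (s ++ t) = D.goes (D.goes e s) t :=
  List.foldl_append

theorem pr_append (e : Q) (s : List α) (w : Stream' α) (n : ℕ) :
    D.pr e (s ++ₛ w) (s.length + n) = D.pr (D.goes e s) w n := by
  unfold pr
  rw [← Stream'.append_take, goes_append, Stream'.get_append_right]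

theorem append_mem_langFrom {e : Q} {s : List α} {w : Stream' α} :
    s ++ₛ w ∈ D.langFrom e ↔ w ∈ D.langFrom (D.goes e s) := by
  change ParityCondition _ ↔ ParityCondition _
  rw [← parityCondition_shift _ s.length]
  simp only [pr_append]

theorem sees_append {e : Q} {s t : List α} {c : ℕ} :
    D.Sees e (s ++ t) c ↔ D.Sees e s c ∨ D.Sees (D.goes e s) t c := by
  induction s generalizing e with
  | nil => simp [Sees, goes]
  | cons a s ih =>
    change _ ∨ D.Sees (D.next e a) (s ++ t) c ↔ (_ ∨ _) ∨ _
    rw [ih, or_assoc]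
    rfl

theorem sees_iff {e : Q} {s : List α} {w : Stream' α} {c : ℕ} :
    D.Sees e s c ↔ ∃ i < s.length, D.pr e (s ++ₛ w) i = c := by
  induction s generalizing e with
  | nil => simp [Sees]
  | cons a s ih =>
    have hsucc : ∀ i, D.pr e ((a :: s) ++ₛ w) (i + 1) = D.pr (D.next e a) (s ++ₛ w) i := by
      intro i
      have := pr_append (D := D) e [a] (s ++ₛ w) i
      rw [← Stream'.append_append_stream] at this
      rw [Nat.add_comm]
      exact this
    change _ ∨ _ ↔ _
    rw [ih]
    constructor
    · rintro (h | ⟨i, hi, h⟩)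
      · exact ⟨0, by simp, h⟩
      · exact ⟨i + 1, by simpa using hi, by rw [hsucc, h]⟩
    · rintro ⟨i | i, hi, h⟩
      · exact Or.inl h
      · exact Or.inr ⟨i, by simpa using hi, by rw [← hsucc, h]⟩

theorem Sees.le {e : Q} {s : List α} {c : ℕ} (h : D.Sees e s c) : 1 ≤ c ∧ c ≤ D.d := by
  induction s generalizing e with
  | nil => exact h.elim
  | cons a s ih =>
    rcases h with rfl | h
    · exact ⟨D.one_le_prio _ _, D.prio_le _ _⟩
    · exact ih h

theorem exists_sees (e : Q) {s : List α} (hs : s ≠ []) : ∃ c, D.Sees e s c := by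
  cases s with
  | nil => exact absurd rfl hs
  | cons a s => exact ⟨_, Or.inl rfl⟩

theorem pr_le (e : Q) (w : Stream' α) (n : ℕ) : D.pr e w n ≤ D.d := D.prio_le _ _

section Cycle

variable {e : Q} {z : List α} (hz : z ≠ [])

theorem pr_cycle (k i : ℕ) : D.pr e (Stream'.cycle z hz) (k * z.length + i) =
    D.pr (D.goes e (rep z k)) (z ++ₛ Stream'.cycle z hz) i := by
  rw [← Stream'.cycle_eq, ← pr_append, ← cycle_eq_rep, length_rep]

theorem sees_pr_cycle (n : ℕ) :
    D.Sees (D.goes e (rep z (n / z.length))) z (D.pr e (Stream'.cycle z hz) n) := by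
  rw [sees_iff (w := Stream'.cycle z hz)]
  refine ⟨n % z.length, Nat.mod_lt _ (List.length_pos_of_ne_nil hz), ?_⟩
  rw [← pr_cycle, Nat.mul_comm, Nat.div_add_mod]

theorem exists_pr_cycle {k c : ℕ} (h : D.Sees (D.goes e (rep z k)) z c) :
    ∃ n, k ≤ n ∧ D.pr e (Stream'.cycle z hz) n = c := by
  rw [sees_iff (w := Stream'.cycle z hz)] at h
  obtain ⟨i, -, rfl⟩ := h
  exact ⟨_, Nat.le_add_right_of_le (Nat.le_mul_of_pos_right _ (List.length_pos_of_ne_nil hz)),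
    pr_cycle hz k i⟩

/-- Counting by blocks `z` instead of letters shows that the recurring priorities depend only on the
profile of `z`. -/
theorem frequently_pr_cycle {c : ℕ} : (∃ᶠ n in atTop, D.pr e (Stream'.cycle z hz) n = c) ↔
    ∃ᶠ k in atTop, D.Sees (D.goes e (rep z k)) z c := by
  rw [frequently_atTop, frequently_atTop]
  constructor
  · intro h k
    obtain ⟨n, hn, rfl⟩ := h (k * z.length)
    exact ⟨n / z.length, (Nat.le_div_iff_mul_le (List.length_pos_of_ne_nil hz)).mpr hn,
      sees_pr_cycle hz n⟩
  · intro h N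
    obtain ⟨k, hk, hs⟩ := h N
    obtain ⟨n, hn, hc⟩ := exists_pr_cycle hz hs
    exact ⟨n, hk.trans hn, hc⟩

end Cycle

theorem parityCondition_congr {c c' : ℕ → ℕ} {d : ℕ} (hc : ∀ n, c n ≤ d) (hc' : ∀ n, c' n ≤ d)
    (h : ∀ y, (∃ᶠ n in atTop, c n = y) ↔ ∃ᶠ n in atTop, c' n = y) :
    ParityCondition c ↔ ParityCondition c' := by
  obtain ⟨y, h1, h2⟩ := exists_least_frequent hc
  obtain ⟨y', h1', h2'⟩ := exists_least_frequent hc'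
  obtain ⟨n, hn, hn'⟩ := (((h y).mp h2).and_eventually h1').exists
  obtain ⟨m, hm, hm'⟩ := (((h y').mpr h2').and_eventually h1).exists
  rw [parityCondition_iff h1 h2, parityCondition_iff h1' h2', show y = y' by omega]

/-! ### Profiles -/

variable (D) in
/-- The two words act in the same way on the states and see the same priorities. -/
def SameProfile (s t : List α) : Prop :=
  ∀ e, D.goes e s = D.goes e t ∧ ∀ c, D.Sees e s c ↔ D.Sees e t c

theorem SameProfile.refl (s : List α) : D.SameProfile s s := fun _ => ⟨rfl, fun _ => Iff.rfl⟩

theorem SameProfile.append {s s' t t' : List α} (h : D.SameProfile s s')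
    (h' : D.SameProfile t t') : D.SameProfile (s ++ t) (s' ++ t') := by
  intro e
  refine ⟨by rw [goes_append, goes_append, (h e).1, (h' _).1], fun c => ?_⟩
  rw [sees_append, sees_append, (h e).2, (h e).1, (h' _).2]

theorem SameProfile.goes_rep {s t : List α} (h : D.SameProfile s t) (e : Q) (k : ℕ) :
    D.goes e (rep s k) = D.goes e (rep t k) := by
  induction k generalizing e with
  | zero => rfl
  | succ k ih => rw [rep, rep, goes_append, goes_append, (h e).1, ih]

theorem SameProfile.cycle_mem_iff {s t : List α} (h : D.SameProfile s t) (hs : s ≠ [])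
    (ht : t ≠ []) (e : Q) :
    Stream'.cycle s hs ∈ D.langFrom e ↔ Stream'.cycle t ht ∈ D.langFrom e := by
  refine parityCondition_congr (pr_le _ _) (pr_le _ _) fun y => ?_
  rw [frequently_pr_cycle, frequently_pr_cycle]
  simp only [h.goes_rep, (h _).2]

theorem exists_finite_profile [Finite Q] : ∃ (K : Type v) (_ : Finite K) (f : List α → K),
    ∀ s t, f s = f t → D.SameProfile s t := by
  -- Priorities never exceed `D.d`, so `Fin (D.d + 1)` records all of them.
  refine ⟨Q → Q × Set (Fin (D.d + 1)), inferInstance,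
    fun s e => (D.goes e s, {c | D.Sees e s c}), fun s t h e => ?_⟩
  have h1 := Prod.ext_iff.mp (congrFun h e)
  refine ⟨h1.1, fun c => ?_⟩
  by_cases hc : c < D.d + 1
  · exact Set.ext_iff.mp h1.2 ⟨c, hc⟩
  · exact ⟨fun h => absurd h.le.2 (by omega), fun h => absurd h.le.2 (by omega)⟩

/-! ### Loops -/

/-- If all the states of `E`, closed under `z`, see some priority with property `P` on `z`, then
they see on a power of `z` the priority that decides the acceptance of `z z z …`. -/
theorem exists_rep_sees [Finite Q] {E : Set Q} {z : List α} (hz : z ≠ [])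
    (hE : ∀ e ∈ E, D.goes e z ∈ E) {P : ℕ → Prop} (hP : ∀ e ∈ E, ∃ c, D.Sees e z c ∧ P c) :
    ∃ K₀, ∀ K, K₀ ≤ K → ∀ e ∈ E, ∃ y c, D.Sees e (rep z K) y ∧ y ≤ c ∧ P c ∧
      (Even y ↔ Stream'.cycle z hz ∈ D.langFrom e) := by
  have hErep : ∀ k, ∀ e ∈ E, D.goes e (rep z k) ∈ E := by
    intro k
    induction k with
    | zero => exact fun e he => he
    | succ k ih =>
      intro e he
      rw [rep, goes_append]
      exact ih _ (hE e he)
  have key : ∀ e : Q, ∃ K₀, e ∈ E → ∀ K, K₀ ≤ K → ∃ y c, D.Sees e (rep z K) y ∧ y ≤ c ∧ P c ∧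
      (Even y ↔ Stream'.cycle z hz ∈ D.langFrom e) := by
    intro e
    obtain ⟨y, h1, h2⟩ := exists_least_frequent (pr_le (D := D) e (Stream'.cycle z hz))
    obtain ⟨n, hn⟩ := h2.exists
    refine ⟨n + 1, fun he K hK => ?_⟩
    -- The deciding priority `y` occurs within the first `K` blocks. The priority `c` is taken from
    -- a block so late that `y` is already a lower bound; it need not occur on `rep z K`.
    obtain ⟨N, hN⟩ := eventually_atTop.mp h1
    obtain ⟨c, hc, hPc⟩ := hP _ (hErep N e he)
    obtain ⟨m, hm, hmc⟩ := exists_pr_cycle hz hc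
    refine ⟨y, c, ?_, hmc ▸ hN m hm, hPc, (parityCondition_iff h1 h2).symm⟩
    rw [sees_iff (w := Stream'.cycle z hz), ← cycle_eq_rep]
    exact ⟨n, (Nat.lt_of_succ_le hK).trans_le (le_length_rep hz K), hn⟩
  choose f hf using key
  obtain ⟨K₀, hK₀⟩ := (Set.finite_range f).bddAbove
  exact ⟨K₀, fun K hK e he => hf e he K ((hK₀ ⟨e, rfl⟩).trans hK)⟩

variable (D) in
/-- The states that accept the residual of the language of `D` by `x`. -/
def Residual (x : List α) : Set Q := {e | ∀ w, w ∈ D.langFrom e ↔ x ++ₛ w ∈ D.language}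

theorem goes_mem_residual {e : Q} {x : List α} (h : e ∈ D.Residual x) (s : List α) :
    D.goes e s ∈ D.Residual (x ++ s) := by
  intro w
  rw [← append_mem_langFrom, h, Stream'.append_append_stream]

theorem residual_congr {x y : List α} (h : ResEq D.language x y) {e : Q} (he : e ∈ D.Residual x) :
    e ∈ D.Residual y := fun w => (he w).trans (h w)

theorem goes_init_mem_residual (x : List α) : D.goes D.init x ∈ D.Residual x :=
  fun _ => append_mem_langFrom.symm

variable (D) in
/-- The word `z` is a loop on the residual of `x`, the word `x z z z …` is accepted iff `b`, and
all the states for this residual see a priority `≤ M` on `z`. -/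
def Low (M : ℕ) (x z : List α) (b : Prop) : Prop :=
  z ≠ [] ∧ ResEq D.language (x ++ z) x ∧ (LoopIn D.language x z ↔ b) ∧
    ∀ e ∈ D.Residual x, ∃ c ≤ M, D.Sees e z c

theorem low_of_loop {x z : List α} {b : Prop} (hz : z ≠ []) (hx : ResEq D.language (x ++ z) x)
    (hb : LoopIn D.language x z ↔ b) : D.Low D.d x z b := by
  refine ⟨hz, hx, hb, fun e _ => ?_⟩
  obtain ⟨c, hc⟩ := exists_sees (D := D) e hz
  exact ⟨c, hc.le.2, hc⟩

theorem Low.pos {M : ℕ} {x z : List α} {b : Prop} (h : D.Low M x z b) : 1 ≤ M := by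
  obtain ⟨c, hc, hs⟩ := h.2.2.2 _ (goes_init_mem_residual x)
  exact hs.le.1.trans hc

/-- A loop of the other kind that contains a large power of `z` sees a smaller priority. -/
theorem Low.step [Finite Q] {M : ℕ} {x z : List α} {b : Prop} (h : D.Low M x z b) :
    ∃ K, ∀ x' a s, ResEq D.language (x' ++ a) x → a ++ rep z K ++ s ≠ [] →
      ResEq D.language (x' ++ (a ++ rep z K ++ s)) x' →
      (LoopIn D.language x' (a ++ rep z K ++ s) ↔ ¬ b) →
      ∃ K', 1 ≤ K' ∧ D.Low (M - 1) x' (rep (a ++ rep z K ++ s) K') (¬ b) := by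
  obtain ⟨hz, hx, hb, hs⟩ := h
  obtain ⟨K, hK⟩ := exists_rep_sees (E := D.Residual x) (P := fun c => c ≤ M) hz
    (fun e he => residual_congr hx (goes_mem_residual he z))
    (fun e he => by
      obtain ⟨c, h1, h2⟩ := hs e he
      exact ⟨c, h2, h1⟩)
  refine ⟨K, fun x' a s hx' hy hyx hyb => ?_⟩
  -- Whatever state for the residual is entered, `rep z K` shows a priority `≤ M` that is even iff
  -- `b`. The deciding priority of the new loop has the other parity, so it is strictly smaller than
  -- some priority of this kind.
  obtain ⟨K', hK'⟩ := exists_rep_sees (E := D.Residual x') (P := fun c => c ≤ M ∧ (Even c ↔ b)) hy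
    (fun e he => residual_congr hyx (goes_mem_residual he _))
    (fun e he => by
      have h1 := residual_congr hx' (goes_mem_residual he a)
      obtain ⟨y, c, h2, h3, h4, h5⟩ := hK K le_rfl _ h1
      refine ⟨y, ?_, h3.trans h4, ?_⟩
      · rw [sees_append, sees_append]
        exact Or.inl (Or.inr h2)
      · rw [h5, h1, ← loopIn_iff, hb])
  refine ⟨K' + 1, Nat.le_add_left _ _, rep_ne_nil hy (Nat.le_add_left _ _), hyx.rep _,
    (loopIn_rep (Nat.le_add_left _ _)).trans hyb, fun e he => ?_⟩
  obtain ⟨y, c, h1, h2, ⟨h3, h4⟩, h5⟩ := hK' (K' + 1) (Nat.le_succ _) e he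
  rw [he, ← loopIn_iff, hyb, ← h4] at h5
  refine ⟨y, ?_, h1⟩
  have : y ≠ c := by
    rintro rfl
    exact iff_not_self h5
  omega

/-- Infinitely many positions of a word `w` can be joined by loops that are accepted iff `w`
is. -/
theorem exists_loops [Finite Q] (w : Stream' α) {K : Type*} [Finite K] (κ : ℕ → K) (N₀ : ℕ) :
    ∃ n, N₀ ≤ n ∧ ∀ N, ∃ j, N ≤ j ∧ 1 ≤ j ∧ κ (n + j) = κ n ∧
      (LoopIn D.language (w.take n) ((w.drop n).take j) ↔ w ∈ D.language) := by
  obtain ⟨y, h1, h2⟩ := exists_least_frequent (pr_le (D := D) D.init w)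
  obtain ⟨N₁, hN₁⟩ := eventually_atTop.mp h1
  -- Between two positions with the same value of `κ` and the same state, the factor is a loop of
  -- `D`. Taken beyond `N₁` and across an occurrence of `y`, its least priority is `y`.
  obtain ⟨v, hv⟩ := exists_frequently_eq fun n => (κ n, D.goes D.init (w.take n))
  rw [frequently_atTop] at h2 hv
  obtain ⟨n, hn, hnv⟩ := hv (max N₀ N₁)
  refine ⟨n, (le_max_left _ _).trans hn, fun N => ?_⟩
  obtain ⟨m, hm, hmy⟩ := h2 n
  obtain ⟨n', hn', hnv'⟩ := hv (max (m + 1) (n + N + 1))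
  obtain ⟨j, rfl⟩ : ∃ j, n' = n + j := ⟨n' - n, by omega⟩
  have heq := Prod.ext_iff.mp (hnv'.trans hnv.symm)
  refine ⟨j, by omega, by omega, heq.1, ?_⟩
  set e := D.goes D.init (w.take n) with he
  set z := (w.drop n).take j with hzdef
  have hlen : z.length = j := Stream'.length_take _ _
  have hz : z ≠ [] := List.ne_nil_of_length_pos (by omega)
  have hez : D.goes e z = e := by
    rw [he, ← goes_append, hzdef, ← Stream'.take_add]
    exact heq.2
  have hrep : ∀ k, D.goes e (rep z k) = e := by
    intro k
    induction k with
    | zero => rfl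
    | succ k ih => rw [rep, goes_append, hez, ih]
  have hpr : ∀ i, D.pr e (w.drop n) i = D.pr D.init w (n + i) := by
    intro i
    have := pr_append (D := D) D.init (w.take n) (w.drop n) i
    rw [Stream'.append_take_drop, Stream'.length_take] at this
    exact this.symm
  have hsees : ∀ c, D.Sees e z c ↔ ∃ i < j, D.pr D.init w (n + i) = c := by
    intro c
    rw [sees_iff (w := (w.drop n).drop j), hzdef, Stream'.append_take_drop, Stream'.length_take]
    simp only [hpr]
  rw [loopIn_iff hz]
  change _ ↔ ParityCondition (D.pr D.init w)
  rw [parityCondition_iff h1 (frequently_atTop.mpr h2)]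
  refine (append_mem_langFrom (e := D.init)).trans (parityCondition_iff ?_ ?_)
  · refine Eventually.of_forall fun k => ?_
    have h3 := sees_pr_cycle (D := D) (e := e) hz k
    rw [hrep, hsees] at h3
    obtain ⟨i, -, hi⟩ := h3
    rw [← hi]
    exact hN₁ _ (by omega)
  · rw [frequently_pr_cycle]
    refine Frequently.of_forall fun k => ?_
    rw [hrep, hsees]
    exact ⟨m - n, by omega, by rw [← hmy]; congr 1; omega⟩

end DetParityAutomaton

end LayeredAutomata

namespace LayeredAutomata

variable {α : Type u} {L : Set (Stream' α)}

/-! ### Basic properties of the congruences -/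

namespace Tup

theorem flatten_concat {n : ℕ} (t : Tup α n) (s : List α) :
    (t.concat s).flatten = t.flatten ++ s := by
  cases t <;> simp [concat, flatten]

theorem flatten_merge {n : ℕ} (t : Tup α (n + 1)) : t.merge.flatten = t.flatten := by
  cases t with
  | snoc t v => exact flatten_concat t v

end Tup

theorem Eqv.resEq {n : ℕ} {s t : Tup α n} (h : Eqv L s t) : ResEq L s.flatten t.flatten := by
  induction n with
  | zero => exact h
  | succ n ih =>
    have := ih h.1
    rwa [Tup.flatten_merge, Tup.flatten_merge] at this

theorem Eqv.concat_rep {n : ℕ} {t : Tup α n} {z : List α} (h : Eqv L (t.concat z) t) (k : ℕ) :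
    Eqv L (t.concat (rep z k)) t := by
  induction k with
  | zero => rw [rep, Tup.concat_nil]; exact Eqv.refl t
  | succ k ih =>
    rw [rep, ← Tup.concat_concat]
    exact (h.concat _).trans ih

theorem Bot.of_append {n : ℕ} {t : Tup α n} {s r : List α} (h : Bot L (t.concat s)) :
    Bot L (t.concat (s ++ r)) := by
  rw [← Tup.concat_concat]
  exact h.concat r

theorem not_bot_of_concat {n : ℕ} {t : Tup α n} {s : List α} (h : ¬ Bot L (t.concat s)) :
    ¬ Bot L t := fun hb => h (hb.concat s)

/-- The working form of the definition. Besides the condition on `t.concat v`, a single loop on `t`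
that begins with `v` and has the acceptance opposite to the parity of the length `n + 1` of `t` is
enough. -/
theorem not_bot_snoc_iff {n : ℕ} {t : Tup α n} {v : List α} : ¬ Bot L (t.snoc v) ↔
    ¬ Bot L (t.concat v) ∧ ∃ s, s ≠ [] ∧ Eqv L (t.concat (v ++ s)) t ∧
      (LoopIn L t.flatten (v ++ s) ↔ ¬ Even (n + 1)) := by
  have h : Bot L (t.snoc v) ↔ Bot L (t.concat v) ∨ ∀ s, s ≠ [] → Eqv L (t.concat (v ++ s)) t →
      (LoopIn L t.flatten (v ++ s) ↔ Even (n + 1)) :=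
    bot_succ_iff.trans (or_congr Iff.rfl (forall_congr' fun _ => forall_congr' fun _ =>
      imp_congr Iff.rfl (iff_congr (loopIn_iff _).symm Iff.rfl)))
  rw [h, not_or]
  refine and_congr Iff.rfl ?_
  push Not
  refine exists_congr fun s => and_congr_right fun _ => and_congr_right fun _ => ?_
  tauto

/-- Prefixes of loops of the right kind are not equivalent to bottom. -/
theorem not_bot_snoc_of_loop {n : ℕ} {t : Tup α n} (ht : ¬ Bot L t) {z : List α} (hz : z ≠ [])
    (he : Eqv L (t.concat z) t) (hl : LoopIn L t.flatten z ↔ ¬ Even (n + 1)) {k : ℕ}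
    {p q : List α} (hpq : rep z k = p ++ q) : ¬ Bot L (t.snoc p) := by
  have h1 : p ++ (q ++ z) = rep z (k + 1) := by rw [rep_succ', hpq, List.append_assoc]
  rw [not_bot_snoc_iff]
  refine ⟨fun hb => ht ?_, q ++ z, by simp [hz], ?_, ?_⟩
  · have h2 : Bot L (t.concat (rep z k)) := hpq ▸ hb.of_append
    exact ((he.concat_rep k).bot_iff).mp h2
  · rw [h1]
    exact he.concat_rep _
  · rw [h1, loopIn_rep (Nat.le_add_left _ _), hl]

/-- Tuples that are not equivalent to bottom have a loop. -/
theorem exists_loop_of_not_bot {n : ℕ} {t : Tup α n} {v : List α} (h : ¬ Bot L (t.snoc v)) :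
    ∃ s, s ≠ [] ∧ v ++ s ≠ [] ∧ Eqv L (t.concat (v ++ s)) t ∧
      (LoopIn L t.flatten (v ++ s) ↔ ¬ Even (n + 1)) ∧
      ∀ k p q, rep (v ++ s) k = p ++ q → ¬ Bot L (t.snoc p) := by
  obtain ⟨h1, s, hs, he, hl⟩ := not_bot_snoc_iff.mp h
  exact ⟨s, hs, by simp [hs], he, hl, fun k p q hpq =>
    not_bot_snoc_of_loop (not_bot_of_concat h1) (by simp [hs]) he hl hpq⟩

theorem Eqv.not_bot_snoc {n : ℕ} {t t' : Tup α n} {v : List α} (h : Eqv L t t')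
    (hb : ¬ Bot L (t.snoc v)) : ¬ Bot L (t'.snoc v) := by
  rw [not_bot_snoc_iff] at hb ⊢
  obtain ⟨h1, s, hs, he, hl⟩ := hb
  exact ⟨fun hb => h1 ((h.concat v).bot_iff.mpr hb), s, hs,
    ((h.concat _).symm.trans he).trans h, (h.resEq.loopIn_iff _).symm.trans hl⟩

theorem Eqv.snoc {n : ℕ} {t t' : Tup α n} (h : Eqv L t t') (v : List α) :
    Eqv L (t.snoc v) (t'.snoc v) :=
  eqv_succ_iff.mpr ⟨h.concat v, fun _ =>
    not_iff_not.mp ⟨fun hb => h.not_bot_snoc hb, fun hb => h.symm.not_bot_snoc hb⟩⟩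

/-- Rotation of the witness: the loop `y z s` on `t` becomes the loop `z s y` on `t.concat y`. -/
theorem not_bot_snoc_concat {n : ℕ} {t : Tup α n} {y z : List α}
    (h : ¬ Bot L (t.snoc (y ++ z))) : ¬ Bot L ((t.concat y).snoc z) := by
  rw [not_bot_snoc_iff] at h ⊢
  obtain ⟨h1, s, hs, he, hl⟩ := h
  refine ⟨by rwa [Tup.concat_concat], s ++ y, by simp [hs], ?_, ?_⟩
  · have h2 := he.concat y
    rw [Tup.concat_concat] at h2 ⊢
    simpa using h2
  · rw [Tup.flatten_concat, ← List.append_assoc, ← loopIn_append_comm, ← hl, List.append_assoc]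

theorem cls_eq_iff {n : ℕ} {s t : Tup α n} : cls L s = cls L t ↔ Eqv L s t :=
  Quotient.eq (r := tupSetoid L n)

theorem cls_out {n : ℕ} (c : TupClass L n) : cls L (Quotient.out c) = c := Quotient.out_eq c

/-! ### Finiteness -/

section Finiteness

variable {Q : Type v} {D : DetParityAutomaton α Q}

theorem DetParityAutomaton.SameProfile.loopIn_iff {s t : List α} (h : D.SameProfile s t)
    (hs : s ≠ []) (ht : t ≠ []) (x : List α) :
    LoopIn D.language x s ↔ LoopIn D.language x t := by
  rw [LayeredAutomata.loopIn_iff hs, LayeredAutomata.loopIn_iff ht]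
  exact append_mem_langFrom.trans ((h.cycle_mem_iff hs ht _).trans append_mem_langFrom.symm)

/-- The congruence tests words only through residuals and loops. Profiles determine both and are
compatible with concatenation. -/
theorem DetParityAutomaton.SameProfile.eqv {s t : List α} (h : D.SameProfile s t) {n : ℕ}
    (x : Tup α n) : Eqv D.language (x.concat s) (x.concat t) := by
  induction n generalizing s t with
  | zero =>
    cases x with
    | single v =>
      intro w
      have h1 := ((SameProfile.refl v).append h D.init).1
      refine (append_mem_langFrom (e := D.init)).trans ?_
      change w ∈ D.langFrom (D.goes D.init (v ++ s)) ↔ _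
      rw [h1]
      exact (append_mem_langFrom (e := D.init)).symm
  | succ n ih =>
    cases x with
    | snoc x v =>
      have key : ∀ s t : List α, D.SameProfile s t → ¬ Bot D.language (x.snoc s) →
          ¬ Bot D.language (x.snoc t) := by
        intro s t h hb
        rw [not_bot_snoc_iff] at hb ⊢
        obtain ⟨h1, r, hr, he, hl⟩ := hb
        refine ⟨fun hb => h1 ((ih h x).bot_iff.mpr hb), r, hr, ?_, ?_⟩
        · exact (ih (h.append (SameProfile.refl r)) x).symm.trans he
        · rw [← hl]
          exact ((h.append (SameProfile.refl r)).loopIn_iff (by simp [hr]) (by simp [hr]) _).symm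
      refine eqv_succ_iff.mpr ⟨ih ((SameProfile.refl v).append h) x, fun r => not_iff_not.mp ?_⟩
      have h2 := ((SameProfile.refl v).append h).append (SameProfile.refl r)
      have h3 : D.SameProfile (v ++ t ++ r) (v ++ s ++ r) :=
        fun e => ⟨(h2 e).1.symm, fun c => ((h2 e).2 c).symm⟩
      exact ⟨key _ _ h2, key _ _ h3⟩

theorem finite_tupClass [Finite Q] (D : DetParityAutomaton α Q) (n : ℕ) :
    Finite (TupClass D.language n) := by
  obtain ⟨K, hK, f, hf⟩ := D.exists_finite_profile
  induction n with
  | zero =>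
    refine Finite.of_injective (fun c => f (Quotient.out c).flatten) fun c c' h => ?_
    rw [← cls_out c, ← cls_out c', cls_eq_iff]
    exact (hf _ _ h).eqv (Tup.single [])
  | succ n ih =>
    refine Finite.of_injective (fun c => (cls D.language (Quotient.out c).front,
      f (Quotient.out c).last)) fun c c' h => ?_
    rw [← cls_out c, ← cls_out c', cls_eq_iff]
    have h1 := Prod.ext_iff.mp h
    have h2 := cls_eq_iff.mp h1.1
    have h3 := hf _ _ h1.2
    generalize Quotient.out c = t at h2 h3
    generalize Quotient.out c' = t' at h2 h3
    cases t with
    | snoc t v =>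
      cases t' with
      | snoc t' v' => exact (h2.snoc v).trans (h3.eqv (t'.snoc []))

/-- Descent on the length: a power of the loop on `t` is enclosed in a loop on the tuple without its
last component, of the opposite acceptance, and `Low.step` lowers `M` by one. -/
theorem length_le_of_low [Finite Q] {n : ℕ} {t : Tup α n} {M : ℕ} {z : List α}
    (ht : ¬ Bot D.language t) (he : Eqv D.language (t.concat z) t)
    (hl : D.Low M t.flatten z (¬ Even (n + 1))) : n + 1 ≤ M := by
  induction n generalizing M z with
  | zero => exact hl.pos
  | succ n ih =>
    cases t with
    | snoc t u =>
      obtain ⟨K, hK⟩ := hl.step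
      have h1 : ¬ Bot D.language (t.snoc (u ++ rep z K)) := fun hb =>
        ht ((he.concat_rep K).bot_iff.mp hb)
      obtain ⟨s, -, hs, he', hl', -⟩ := exists_loop_of_not_bot h1
      obtain ⟨K', -, hlow⟩ := hK t.flatten u s (ResEq.refl _) hs
        (by rw [← Tup.flatten_concat]; exact he'.resEq) (by
          rw [hl', Nat.even_add_one (n := n + 1)]; tauto)
      have h2 : (¬ ¬ Even (n + 1 + 1)) = ¬ Even (n + 1) := by
        rw [Nat.even_add_one (n := n + 1)]
        exact propext not_not
      rw [h2] at hlow
      have h3 := ih (not_bot_of_concat (not_bot_snoc_iff.mp ht).1) (he'.concat_rep K') hlow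
      have := hl.pos
      omega

theorem length_le_of_not_bot [Finite Q] {n : ℕ} {t : Tup α n} (ht : ¬ Bot D.language t) :
    n ≤ D.d := by
  cases t with
  | single v => exact Nat.zero_le _
  | snoc t v =>
    obtain ⟨s, -, hs, he, hl, -⟩ := exists_loop_of_not_bot ht
    exact length_le_of_low (not_bot_of_concat (not_bot_snoc_iff.mp ht).1) he
      (DetParityAutomaton.low_of_loop hs (by rw [← Tup.flatten_concat]; exact he.resEq) hl)

theorem exists_isGreatest_tupleLengths [Finite Q] (D : DetParityAutomaton α Q) :
    ∃ d, IsGreatest (tupleLengths D.language) d := by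
  have h1 : (tupleLengths D.language).Nonempty := ⟨1, 0, Tup.single [], rfl, fun h => h⟩
  have h2 : BddAbove (tupleLengths D.language) := by
    refine ⟨D.d + 1, ?_⟩
    rintro _ ⟨n, t, rfl, ht⟩
    exact Nat.succ_le_succ (length_le_of_not_bot ht)
  exact ⟨_, Nat.sSup_mem h1 h2, fun _ h => le_csSup h2 h⟩

end Finiteness

/-! ### Pointed tuples -/

/-- Every tuple that extends a pointed one and is not equivalent to bottom can be continued to a
pointed tuple. -/
theorem Pointed.exists_snoc {n : ℕ} [Finite (TupClass L (n + 1))] {t : Tup α n}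
    (ht : Pointed L n t) {s : List α} (hs : ¬ Bot L (t.snoc s)) :
    ∃ y, Pointed L (n + 1) (t.snoc (s ++ y)) := by
  let N : Tup α (n + 1) → Set (List α) := fun x => {r | ¬ Bot L (x.concat r)}
  have hN : ∀ x y, Eqv L x y → N x = N y := fun x y h =>
    Set.ext fun r => not_congr ((eqv_succ_iff.mp h).2 r)
  let F : Set (Set (List α)) := {X | ∃ y, ¬ Bot L (t.snoc (s ++ y)) ∧ N (t.snoc (s ++ y)) = X}
  have hF : F.Finite := by
    refine (Set.finite_range fun c : TupClass L (n + 1) => N (Quotient.out c)).subset ?_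
    rintro _ ⟨y, -, rfl⟩
    exact ⟨cls L (t.snoc (s ++ y)), hN _ _ (cls_eq_iff.mp (cls_out _))⟩
  -- An extension with a minimal set of safe continuations turns out to be pointed.
  obtain ⟨_, ⟨y, hy, rfl⟩, hmin⟩ := hF.exists_minimal ⟨_, [], by simpa using hs, rfl⟩
  refine ⟨y, hy, ht, fun r v hr he hn => ?_⟩
  change Eqv L (r.concat v) t at he
  change ¬ Bot L (r.snoc (v ++ (s ++ y))) at hn
  change Eqv L (r.snoc (v ++ (s ++ y))) _
  generalize hx : s ++ y = x at *
  obtain ⟨z, hz, -, hez, hlz, hbz⟩ := exists_loop_of_not_bot hn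
  have h1 : ¬ Bot L (t.snoc (s ++ (y ++ z ++ v ++ x))) := by
    have h2 := hbz 2 (v ++ (x ++ z ++ v ++ x)) z (by simp [rep])
    have h3 := he.not_bot_snoc (not_bot_snoc_concat h2)
    rw [← hx] at h3 ⊢
    simpa using h3
  -- With `x = s ++ y` and the loop `v x z` on `r`, the safe sets of `(t, x z v x)`, `(r, v x)` and
  -- `(t, x)` are nested in this order. By minimality they coincide.
  have h2 : N (t.snoc (s ++ (y ++ z ++ v ++ x))) ⊆ N (r.snoc (v ++ x)) := by
    intro k hk
    have h3 : ¬ Bot L (t.snoc (x ++ z ++ (v ++ x ++ k))) := by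
      change ¬ Bot L (t.snoc (s ++ (y ++ z ++ v ++ x) ++ k)) at hk
      rw [← hx] at hk ⊢
      simpa using hk
    have h4 := not_bot_snoc_concat (he.symm.not_bot_snoc h3)
    rw [Tup.concat_concat] at h4
    have h5 : Eqv L (r.concat (v ++ (x ++ z))) r := by simpa using hez
    exact h5.not_bot_snoc h4
  have h3 : N (r.snoc (v ++ x)) ⊆ N (t.snoc x) := by
    intro k hk
    change ¬ Bot L (r.snoc (v ++ x ++ k)) at hk
    rw [List.append_assoc] at hk
    exact he.not_bot_snoc (not_bot_snoc_concat hk)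
  have h4 := hmin ⟨_, h1, rfl⟩ (h2.trans h3)
  refine eqv_succ_iff.mpr ⟨?_, fun k => not_iff_not.mp ⟨fun h => h3 h, fun h => h2 (h4 h)⟩⟩
  have h5 := he.concat x
  rwa [Tup.concat_concat] at h5

/-- If an infinite word can be read in the last component, then it is safe from a pointed
tuple. -/
theorem Pointed.exists_live {n : ℕ} [Finite (TupClass L (n + 1))] {t : Tup α n}
    (ht : Pointed L n t) {w : Stream' α} (hw : ∀ k, ¬ Bot L (t.snoc (w.take k))) :
    ∃ t', Pointed L (n + 1) t' ∧ Eqv L t'.merge t ∧ ∀ k, ¬ Bot L (t'.concat (w.take k)) := by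
  have key : ∀ k, ∃ t', Pointed L (n + 1) t' ∧ Eqv L t'.merge t ∧
      ¬ Bot L (t'.concat (w.take k)) := by
    intro k
    obtain ⟨y, hy⟩ := ht.exists_snoc (hw k)
    obtain ⟨z, hz, -, hez, -, hbz⟩ := exists_loop_of_not_bot hy.not_bot
    refine ⟨(t.snoc (w.take k ++ y)).concat z, hy.concat z (hbz 1 _ [] (by simp [rep])), ?_, ?_⟩
    · exact hez
    · rw [Tup.concat_concat]
      exact hbz 2 (w.take k ++ y ++ (z ++ w.take k)) (y ++ z) (by simp [rep])
  choose τ h1 h2 h3 using key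
  -- A class that serves arbitrarily long prefixes serves all of them.
  obtain ⟨c, hc⟩ := exists_frequently_eq fun k => cls L (τ k)
  obtain ⟨k₀, hk₀⟩ := hc.exists
  refine ⟨τ k₀, h1 k₀, h2 k₀, fun k => ?_⟩
  obtain ⟨m, hm, hmc⟩ := frequently_atTop.mp hc k
  have h4 := cls_eq_iff.mp (hmc.trans hk₀.symm)
  obtain ⟨j, rfl⟩ := Nat.exists_eq_add_of_le hm
  intro hb
  refine h3 (k + j) (((h4.concat _).bot_iff).mpr ?_)
  rw [Stream'.take_add]
  exact hb.of_append

/-! ### The congruence automaton -/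

namespace congruenceAutomaton

open LayeredAutomaton PointedClass

variable {d : ℕ} {hd : IsGreatest (tupleLengths L) d}

/-- The state given by a pointed tuple. -/
def state {n : ℕ} (t : Tup α n) (ht : Pointed L n t) : (congruenceAutomaton L d hd).State :=
  mk' t ht

theorem state_eq_iff {n : ℕ} {s t : Tup α n} {hs : Pointed L n s} {ht : Pointed L n t} :
    state (hd := hd) s hs = state t ht ↔ Eqv L s t := by
  rw [← cls_eq_iff]
  refine ⟨fun h => ?_, fun h => ?_⟩
  · exact eq_of_heq (PointedClass.mk.inj h).2
  · unfold state mk'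
    congr 1

theorem exists_eq_state (c : (congruenceAutomaton L d hd).State) :
    ∃ (n : ℕ) (t : Tup α n) (ht : Pointed L n t), c = state t ht :=
  ⟨_, PointedClass.exists_mk' c⟩

theorem μ_state {n : ℕ} {t : Tup α (n + 1)} (ht : Pointed L (n + 1) t) :
    (congruenceAutomaton L d hd).μ (state t ht) = state t.merge ht.merge := rfl

theorem run_state {n : ℕ} {t : Tup α n} (ht : Pointed L n t) {s : List α}
    (hb : ¬ Bot L (t.concat s)) :
    (congruenceAutomaton L d hd).run (state t ht) s =
      some (state (t.concat s) (ht.concat s hb)) := by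
  induction s generalizing t with
  | nil =>
    refine congrArg some (state_eq_iff.mpr ?_)
    rw [Tup.concat_nil]
    exact Eqv.refl t
  | cons a s ih =>
    have h1 : (t.concat [a]).concat s = t.concat (a :: s) := Tup.concat_concat t [a] s
    have h2 : ¬ Bot L (t.concat [a]) := fun h => hb (h1 ▸ h.concat s)
    have h3 : (congruenceAutomaton L d hd).run (state t ht) [a] =
        some (state (t.concat [a]) (ht.concat [a] h2)) := by
      rw [run_singleton]
      exact next_of_not_bot ht a h2
    refine (run_append_of h3 s).trans ((ih (ht.concat [a] h2) (h1.symm ▸ hb)).trans ?_)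
    refine congrArg some (state_eq_iff.mpr ?_)
    rw [Tup.concat_concat]
    exact Eqv.refl _

theorem run_eq_none {n : ℕ} {t : Tup α n} (ht : Pointed L n t) {s : List α}
    (hb : Bot L (t.concat s)) : (congruenceAutomaton L d hd).run (state t ht) s = none := by
  induction s generalizing t with
  | nil =>
    rw [Tup.concat_nil] at hb
    exact absurd hb ht.not_bot
  | cons a s ih =>
    have h1 : (t.concat [a]).concat s = t.concat (a :: s) := Tup.concat_concat t [a] s
    rw [← List.singleton_append]
    by_cases h2 : Bot L (t.concat [a])
    · apply run_append_none
      rw [run_singleton]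
      exact next_of_bot ht a h2
    · rw [run_append_of (q' := state (t.concat [a]) (ht.concat [a] h2)),
        ih (ht.concat [a] h2) (h1.symm ▸ hb)]
      rw [run_singleton]
      exact next_of_not_bot ht a h2

theorem run_ne_none_iff {n : ℕ} {t : Tup α n} (ht : Pointed L n t) {s : List α} :
    (congruenceAutomaton L d hd).run (state t ht) s ≠ none ↔ ¬ Bot L (t.concat s) := by
  constructor
  · exact fun h hb => h (run_eq_none ht hb)
  · intro hb
    rw [run_state ht hb]
    simp

theorem root_state {n : ℕ} {t : Tup α n} (ht : Pointed L n t) :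
    (congruenceAutomaton L d hd).root (state t ht) = state (Tup.single t.flatten) trivial := by
  induction n with
  | zero =>
    cases t with
    | single s => exact root_of_layer_one rfl
  | succ n ih =>
    have h := root_eq_of_above (above_μ (A := congruenceAutomaton L d hd) (state t ht))
    have h2 := ih ht.merge
    rw [Tup.flatten_merge] at h2
    exact h.symm.trans h2

theorem run_init (u : List α) : (congruenceAutomaton L d hd).run
    (congruenceAutomaton L d hd).init u = some (state (Tup.single u) trivial) :=
  run_state (t := Tup.single []) trivial fun h => h

theorem resEq_of_root_eq {n m : ℕ} {t : Tup α n} {t' : Tup α m} {ht : Pointed L n t}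
    {ht' : Pointed L m t'} (h : (congruenceAutomaton L d hd).root (state t ht) =
      (congruenceAutomaton L d hd).root (state t' ht')) : ResEq L t.flatten t'.flatten := by
  rw [root_state, root_state] at h
  exact state_eq_iff.mp h

/-! ### The congruence automaton of an ω-regular language is canonical. -/

section Properties

variable {Q : Type v} [Finite Q] {D : DetParityAutomaton α Q}
  {hd : IsGreatest (tupleLengths D.language) d}

/-- Otherwise, from some position on, arbitrarily long factors of `w` are loops of the kind that
keeps the longer tuples from being bottom. By `Pointed.exists_live` a child then survives the rest
of `w`. -/
theorem mem_iff_of_staysExactly {n : ℕ} {t : Tup α n} (ht : Pointed D.language n t)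
    {w : Stream' α} (h : (congruenceAutomaton D.language d hd).StaysExactly (state t ht) w) :
    t.flatten ++ₛ w ∈ D.language ↔ Even (n + 1) := by
  by_contra hno
  have := fun n => finite_tupClass D n
  rw [staysExactly_iff] at h
  obtain ⟨hlive, hchild⟩ := h
  -- Positions are counted in the whole word, hence the shift by the length of `t.flatten`.
  obtain ⟨i, hi, hloop⟩ := D.exists_loops (t.flatten ++ₛ w)
    (fun m => cls D.language (t.concat (w.take (m - t.flatten.length)))) t.flatten.length
  obtain ⟨k, rfl⟩ := Nat.exists_eq_add_of_le hi
  rw [← Stream'.append_take, ← Stream'.drop_drop, Stream'.drop_append_stream,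
    ← Tup.flatten_concat] at hloop
  have hb : ¬ Bot D.language (t.concat (w.take k)) := (run_ne_none_iff ht).mp (hlive k)
  have hp := ht.concat _ hb
  have hall : ∀ m, ¬ Bot D.language ((t.concat (w.take k)).snoc ((w.drop k).take m)) := by
    intro m
    obtain ⟨j, hj, hj1, hκ, hl⟩ := hloop m
    rw [cls_eq_iff] at hκ
    have e1 : t.flatten.length + k + j - t.flatten.length = k + j := by omega
    have e2 : t.flatten.length + k - t.flatten.length = k := by omega
    rw [e1, e2, Stream'.take_add, ← Tup.concat_concat] at hκ
    obtain ⟨r, rfl⟩ := Nat.exists_eq_add_of_le hj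
    refine not_bot_snoc_of_loop hb ?_ hκ (hl.trans ?_) (k := 1)
      (q := ((w.drop k).drop m).take r) ?_
    · exact List.ne_nil_of_length_pos (by rw [Stream'.length_take]; omega)
    · tauto
    · rw [rep, rep, List.append_nil, Stream'.take_add]
  obtain ⟨t', ht', hm, hlive'⟩ := hp.exists_live hall
  refine hchild (w.take k) (w.drop k) (state t' ht') (Stream'.append_take_drop _ _).symm rfl ?_
    fun m => (run_ne_none_iff ht').mpr (hlive' m)
  rw [run_state ht hb, μ_state]
  exact congrArg some (state_eq_iff.mpr hm.symm)

theorem consistent : (congruenceAutomaton D.language d hd).Consistent := by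
  rintro ⟨p, p', hr, w, ⟨h1, h2⟩, h3, h4⟩
  obtain ⟨n, t, ht, rfl⟩ := exists_eq_state p
  obtain ⟨m, t', ht', rfl⟩ := exists_eq_state p'
  have h5 := resEq_of_root_eq hr w
  rw [mem_iff_of_staysExactly ht h2, mem_iff_of_staysExactly ht' h4] at h5
  exact Nat.not_even_iff_odd.mpr h3 (h5.mp h1)

theorem recognizes : (congruenceAutomaton D.language d hd).Recognizes D.language := by
  intro ℓ hℓ
  ext w
  obtain ⟨p, hp⟩ := exists_settles (A := congruenceAutomaton D.language d hd)
    (layer_root ℓ.1) w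
  rw [mem_language_iff consistent hp]
  obtain ⟨s, w', rfl, hr, hst⟩ := hp
  obtain ⟨n, t, ht, rfl⟩ := exists_eq_state p
  have h1 : (congruenceAutomaton D.language d hd).root ℓ.1 = _ := hℓ
  rw [h1, run_init, root_state] at hr
  have h2 : ResEq D.language s t.flatten := state_eq_iff.mp (Option.some.inj hr)
  rw [h2, mem_iff_of_staysExactly ht hst]
  exact Iff.rfl

theorem mem_stateLanguage_state {n : ℕ} {t : Tup α n} (ht : Pointed D.language n t)
    (w : Stream' α) :
    w ∈ (congruenceAutomaton D.language d hd).stateLanguage (state t ht) ↔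
      t.flatten ++ₛ w ∈ D.language :=
  mem_stateLanguage_iff_mem consistent recognizes (by rw [run_init, root_state]) w

/-- The language fixes the residual, that is, the class at length one, and each safe language fixes
one further level of the congruence. -/
theorem safeMinimal : (congruenceAutomaton D.language d hd).SafeMinimal := by
  intro p q hl hpq
  obtain ⟨n, t, ht, rfl⟩ := exists_eq_state p
  obtain ⟨m, t', ht', rfl⟩ := exists_eq_state q
  obtain rfl : n = m := Nat.succ.inj hl
  obtain ⟨h1, h2⟩ := hpq
  rw [state_eq_iff]
  have h3 : ResEq D.language t.flatten t'.flatten := fun w => by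
    rw [← mem_stateLanguage_state (hd := hd) ht, ← mem_stateLanguage_state (hd := hd) ht', h1]
  replace h2 : ∀ y, 2 ≤ y → y ≤ n + 1 →
    (congruenceAutomaton D.language d hd).safe y (state t ht) =
      (congruenceAutomaton D.language d hd).safe y (state t' ht') := h2
  clear h1 hl
  induction n with
  | zero => exact h3
  | succ n ih =>
    refine eqv_succ_iff.mpr ⟨ih _ ht.merge _ ht'.merge
      (by rwa [Tup.flatten_merge, Tup.flatten_merge]) (fun y hy hyn => ?_),
    fun r => not_iff_not.mp ?_⟩
    · have h4 := h2 y hy (by omega)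
      unfold safe at h4 ⊢
      rw [← anc_μ (q := state t ht) (A := congruenceAutomaton D.language d hd) (by omega)
          (Nat.lt_succ_of_le hyn),
        ← anc_μ (q := state t' ht') (A := congruenceAutomaton D.language d hd) (by omega)
          (Nat.lt_succ_of_le hyn)] at h4
      exact h4
    · have h4 := h2 (n + 1 + 1) (by omega) le_rfl
      have h5 := Set.ext_iff.mp h4 (Sum.inl r)
      rw [inl_mem_safe, inl_mem_safe] at h5
      have h6 := anc_self (A := congruenceAutomaton D.language d hd) (state t ht)
      have h7 := anc_self (A := congruenceAutomaton D.language d hd) (state t' ht')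
      change (congruenceAutomaton D.language d hd).anc (n + 1 + 1) _ = _ at h6 h7
      rw [h6, h7] at h5
      exact (run_ne_none_iff ht).symm.trans (h5.trans (run_ne_none_iff ht'))

/-- Some `u s r` is a loop on the front tuple. Reading `u` once more gives `(t, u s r u)`, which
pointedness identifies with `(t, u)`. -/
theorem exists_return {n : ℕ} {t : Tup α (n + 1)} (ht : Pointed L (n + 1) t) {s : List α}
    (hb : ¬ Bot L (t.concat s)) : ∃ r, r ≠ [] ∧ Eqv L (t.concat (s ++ r)) t := by
  cases t with
  | snoc t u =>
    obtain ⟨r, hr, -, he, -, hbz⟩ := exists_loop_of_not_bot hb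
    refine ⟨r ++ u, by simp [hr], ?_⟩
    have h1 := ht.2.2 t (u ++ s ++ r) ht.2.1 he (hbz 2 (u ++ s ++ r ++ u) (s ++ r) (by simp [rep]))
    have h2 : (t.snoc u).concat (s ++ (r ++ u)) = t.snoc (u ++ s ++ r ++ u) := by
      simp [Tup.concat]
    rw [h2]
    exact h1

/-- A pointed tuple has a safe word that is not safe for a given child. -/
theorem exists_kill {n : ℕ} {t : Tup α (n + 1)} (ht : Pointed D.language (n + 1) t)
    {u : List α} (hu : ¬ Bot D.language (t.snoc u)) :
    ∃ s, ¬ Bot D.language (t.concat (u ++ s)) ∧ Bot D.language (t.snoc (u ++ s)) := by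
  by_contra hno
  push Not at hno
  obtain ⟨r, hr, hur, he, hl, -⟩ := exists_loop_of_not_bot hu
  -- If the child survived all safe words, every power of a loop on `t` could be enclosed in a loop
  -- on `t` of either acceptance. Then `Low.step` would apply until `M = 0`.
  have key : ∀ (M : ℕ) (b : Prop) (z : List α), Eqv D.language (t.concat z) t →
      ¬ D.Low M t.flatten z b := by
    intro M
    induction M with
    | zero => exact fun b z _ hlow => absurd hlow.pos (by omega)
    | succ M ih =>
      intro b z hz hlow
      obtain ⟨K, hK⟩ := hlow.step
      suffices h : ∃ a s, Eqv D.language (t.concat a) t ∧ a ++ rep z K ++ s ≠ [] ∧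
          Eqv D.language (t.concat (a ++ rep z K ++ s)) t ∧
          (LoopIn D.language t.flatten (a ++ rep z K ++ s) ↔ ¬ b) by
        obtain ⟨a, s, h1, h2, h3, h4⟩ := h
        obtain ⟨K', -, hlow'⟩ := hK t.flatten a s
          (by rw [← Tup.flatten_concat]; exact h1.resEq) h2
          (by rw [← Tup.flatten_concat]; exact h3.resEq) h4
        exact ih _ _ (h3.concat_rep K') hlow'
      have hrep := hz.concat_rep K
      -- The child supplies the loops accepted iff `n + 2` is odd. The last component of `t`
      -- supplies those accepted iff `n + 1` is odd, conjugated into loops on `t`.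
      by_cases hb : b ↔ Even (n + 1 + 1)
      · have h1 : ¬ Bot D.language (t.concat (u ++ (r ++ rep z K))) := by
          rw [← List.append_assoc, ← Tup.concat_concat]
          exact fun h => ht.not_bot (((he.concat _).trans hrep).bot_iff.mp h)
        obtain ⟨s, -, hs, hes, hls, -⟩ := exists_loop_of_not_bot (hno _ h1)
        refine ⟨u ++ r, s, he, ?_, ?_, ?_⟩
        · simp [hr]
        · simpa using hes
        · rw [hb, ← hls]
          simp
      · cases t with
        | snoc t v =>
          have h1 : ¬ Bot D.language (t.snoc (v ++ rep z K)) := fun h =>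
            ht.not_bot (hrep.bot_iff.mp h)
          obtain ⟨s, hs, -, hes, hls, hbs⟩ := exists_loop_of_not_bot h1
          refine ⟨[], s ++ v, ?_, by simp [hs], ?_, ?_⟩
          · rw [Tup.concat_nil]
            exact Eqv.refl _
          · have h2 := ht.2.2 t (v ++ rep z K ++ s) ht.2.1 hes
              (hbs 2 (v ++ rep z K ++ s ++ v) (rep z K ++ s) (by simp [rep]))
            have h3 : (t.snoc v).concat ([] ++ rep z K ++ (s ++ v)) =
                t.snoc (v ++ rep z K ++ s ++ v) := by simp [Tup.concat]
            rw [h3]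
            exact h2
          · have h2 : (t.snoc v).flatten = t.flatten ++ v := rfl
            rw [h2, List.nil_append, ← List.append_assoc, ← loopIn_append_comm,
              ← List.append_assoc, hls]
            rw [Nat.even_add_one (n := n + 1)] at hb
            tauto
  exact key D.d _ _ he (DetParityAutomaton.low_of_loop hur
    (by rw [← Tup.flatten_concat]; exact he.resEq) hl)

theorem normal : (congruenceAutomaton D.language d hd).Normal := by
  intro q hq
  obtain ⟨n, t, ht, rfl⟩ := exists_eq_state q
  obtain ⟨n, rfl⟩ : ∃ m, n = m + 1 := Nat.exists_eq_succ_of_ne_zero (by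
    rintro rfl
    change 2 ≤ 0 + 1 at hq
    omega)
  constructor
  · intro s q' hs
    have hb : ¬ Bot D.language (t.concat s) := (run_ne_none_iff (hd := hd) ht).mp (by simp [hs])
    obtain ⟨r, hr, he⟩ := exists_return ht hb
    refine ⟨r, hr, ?_⟩
    rw [← run_append_of hs, run_state ht fun h => ht.not_bot (he.bot_iff.mp h)]
    exact congrArg some (state_eq_iff.mpr he)
  · intro p hl hμ
    obtain ⟨m, t', ht', rfl⟩ := exists_eq_state p
    obtain rfl : m = n + 1 + 1 := Nat.succ.inj hl
    cases t' with
    | snoc x u =>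
      have he : Eqv D.language (x.concat u) t :=
        by rwa [μ_state, state_eq_iff] at hμ
      obtain ⟨s, h1, h2⟩ := exists_kill ht'.2.1 ht'.not_bot
      refine ⟨s, (run_ne_none_iff ht).mpr fun h => h1 ?_, run_eq_none ht' h2⟩
      change Bot D.language (x.concat (u ++ s))
      rw [← Tup.concat_concat]
      exact (he.concat s).bot_iff.mpr h

/-- For a loop `u r` on `x`, the word `r u` is safe from `(x, u)`, hence from `(x', u')`. Since `x'
u' r ≈ x u r ≈ x`, pointedness of `(x, u)` identifies it with the state reached. N1 gives the way
back. -/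
theorem centralised : (congruenceAutomaton D.language d hd).Centralised := by
  intro p q hp hl hμ hsub
  obtain ⟨n, t, ht, rfl⟩ := exists_eq_state p
  obtain ⟨m, t', ht', rfl⟩ := exists_eq_state q
  obtain rfl : m = n := Nat.succ.inj hl
  obtain ⟨n, rfl⟩ : ∃ n, m = n + 1 := Nat.exists_eq_succ_of_ne_zero (by
    rintro rfl
    change 2 ≤ 0 + 1 at hp
    omega)
  have hsub' := safe_subset_iff.mp hsub
  have h6 := anc_self (A := congruenceAutomaton D.language d hd) (state t ht)
  have h7 := anc_self (A := congruenceAutomaton D.language d hd) (state t' ht')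
  rw [hl] at h7
  rw [h6, h7] at hsub'
  cases t with
  | snoc x u =>
    cases t' with
    | snoc x' u' =>
      have he : Eqv D.language (x.concat u) (x'.concat u') :=
        by rwa [μ_state, μ_state, state_eq_iff] at hμ
      obtain ⟨r, hr, -, her, -, hbr⟩ := exists_loop_of_not_bot ht.not_bot
      have h1 : ¬ Bot D.language ((x.snoc u).concat (r ++ u)) := by
        have h2 : (x.snoc u).concat (r ++ u) = x.snoc (u ++ r ++ u) := by simp [Tup.concat]
        rw [h2]
        exact hbr 2 _ r (by simp [rep])
      have h3 := (run_ne_none_iff ht').mp (hsub' _ ((run_ne_none_iff ht).mpr h1))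
      have h4 : (x'.snoc u').concat (r ++ u) = x'.snoc (u' ++ r ++ u) := by simp [Tup.concat]
      have h5 : Eqv D.language ((x'.snoc u').concat (r ++ u)) (x.snoc u) := by
        rw [h4] at h3 ⊢
        refine ht.2.2 x' (u' ++ r) ht'.2.1 ?_ h3
        have h8 := he.concat r
        rw [Tup.concat_concat, Tup.concat_concat] at h8
        exact h8.symm.trans her
      have hqp : (congruenceAutomaton D.language d hd).run (state (x'.snoc u') ht') (r ++ u) =
          some (state (x.snoc u) ht) := by
        rw [run_state ht' h3]
        exact congrArg some (state_eq_iff.mpr h5)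
      obtain ⟨s, -, hs⟩ := (normal (state (x'.snoc u') ht') (hl ▸ hp)).1 _ _ hqp
      exact ⟨⟨s, hs⟩, _, hqp⟩

theorem isCanonical : (congruenceAutomaton D.language d hd).IsCanonical D.language where
  finite := by
    have := fun n => finite_tupClass D n
    let f : PointedClass D.language → Σ n : Fin d, TupClass D.language n := fun c =>
      ⟨⟨c.idx, (congruenceAutomaton D.language d hd).layer_le_depth c⟩, c.tupClass⟩
    refine Finite.of_injective (β := Σ n : Fin d, TupClass D.language n) f fun c c' h => ?_
    obtain ⟨n, t, ht, rfl⟩ := exists_eq_state c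
    obtain ⟨m, t', ht', rfl⟩ := exists_eq_state c'
    obtain rfl : n = m := congrArg (fun x => x.1.1) h
    exact state_eq_iff.mpr (cls_eq_iff.mp (eq_of_heq (Sigma.mk.inj h).2))
  consistent := consistent
  recognizes := recognizes
  safeMinimal := safeMinimal
  normal := normal
  centralised := centralised

end Properties

end congruenceAutomaton

end LayeredAutomata

theorem mainTheorem5 {α : Type u} (L : Set (Stream' α)) (hL : LayeredAutomata.IsOmegaRegular L) :
    ∃ (d : ℕ) (hd : IsGreatest (LayeredAutomata.tupleLengths L) d),
      let A := LayeredAutomata.congruenceAutomaton L d hd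
      Finite A.State ∧ A.Consistent ∧ A.Recognizes L ∧
      A.SafeMinimal ∧ A.Normal ∧ A.Centralised ∧
      (∀ B : LayeredAutomata.LayeredAutomaton.{u, v} α,
        Finite B.State → B.Consistent → B.Recognizes L →
          (B.SafeMinimal → B.Normal → B.Centralised → B.Isomorphic A) ∧
          (∃ C : LayeredAutomata.LayeredAutomaton.{u, v} α, C.IsSubautomaton B ∧
            ∃ φ : C.State → A.State, Function.Surjective φ ∧ C.IsStrongMorphism A φ) ∧
          Nat.card A.State ≤ Nat.card B.State ∧
          Nat.card A.semantics.State ≤ Nat.card B.semantics.State) := by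
  obtain ⟨Q, hQ, D, rfl⟩ := hL
  obtain ⟨d, hd⟩ := LayeredAutomata.exists_isGreatest_tupleLengths D
  have hA := LayeredAutomata.congruenceAutomaton.isCanonical (hd := hd)
  refine ⟨d, hd, hA.finite, hA.consistent, hA.recognizes, hA.safeMinimal, hA.normal,
    hA.centralised, fun B hfin hB hBL => ⟨fun h1 h2 h3 => ?_, hA.exists_subautomaton hB hBL,
      hA.card_le hB hBL, hA.card_semantics_le hB hBL⟩⟩
  exact LayeredAutomata.LayeredAutomaton.IsCanonical.isomorphic ⟨hfin, hB, hBL, h1, h2, h3⟩ hA
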